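/- Let $[m]=(q^m-q^{-m})/(q-q^{-1})$. For $n\ge 0$ let $\mathrm{TL}^D_{n+1}$ be the $\mathbb{C}(q)$-algebra with generators $E_0,\dots,E_n$ and relations $E_i^2=-[2]E_i$, $E_iE_jE_i=E_i$ if $i,j$ are adjacent in the Dynkin diagram $D_{n+1}$ (the nodes $0$ and $1$ are both joined to $2$, and $2-3-\cdots-n$ is a path), and $E_iE_j=E_jE_i$ otherwise; let $\mathrm{TL}^A_{n+1}$ be the algebra with generators $E_1,\dots,E_n$ and the analogous relations for the path $1-2-\cdots-n$. The Jones--Wenzl projections $(Q_n)_{n\ge0}$, $Q_n\in\mathrm{TL}^D_{n+1}$, are characterized by $Q_n\ne0$, $Q_nQ_i=Q_iQ_n=Q_n$ for $0\le i\le n$, and $E_iQ_n=Q_nE_i=0$ for all generators $E_i$ of $\mathrm{TL}^D_{n+1}$; the projections $(P_n)_{n\ge 0}$, $P_n\in\mathrm{TL}^A_{n+1}$, are characterized in the same way. A reduced word is a product of generators which cannot be written, up to a scalar, with fewer generators. A reduced word is represented by a diagram with $n+1$ non-crossing strands joining $n+1$ top and $n+1$ bottom points: one stacks the diagrams of its generators,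 the first one on top. Here $E_i$, $i\ge1$, has a cup and a cap at the points $i,i+1$ and no dots, and $E_0$ is $E_1$ with one dot on the cup and one dot on the cap (for $n=0$ the word $E_0$ has no such diagram, and the single strand represents $1$). Loops are deleted, and if the number of dots is odd, then the dots are replaced by a single dot on the strand through the left-most bottom point. The diagrams of type $D$ with $n+1$ strands (at most one dot on each strand) are (i) those with an even number of dots, all on outer-most cups, outer-most caps or the left-most vertical strand, where an outer-most cup or cap is one with no larger cup or cap around it and no vertical strand to its left, and (ii) those with a unique dot, which lies on the strand through the left-most bottom point, and whose strands are not all vertical. The diagrams of type $A$ are those without dots. For a non-crossing connectivity $C$ of $n+1$ strands let $C^{\mathrm{odd}}$ be the diagram of type (ii) with connectivity $C$; if $C=\mathbf 1$ ($n+1$ vertical strands), there is none, and its coefficient is read as $0$. Let $I(C)\subseteq[1,n+1]$ be the set of positions of inner-most caps: $i\in I(C)$ with $i\le n$ if the bottom points $i$ and $i+1$ are joined, and $n+1\in I(C)$ if the right-most top and bottom points are joined. For $n\geq 1$ and $i\in I(C)$ let $C_i$ be the connectivity of $n$ strands obtained by removing this inner-most cap (if $i\le n$, the right-most top point is then moved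 to the bottom as its right-most point). For $n\ge1$ put $$\mathrm{coef}(g_{n,1})=\frac{[n]}{[2n]},\qquad \mathrm{coef}(g_{n,i})=\frac{[n][2i-2]}{[2n][i-1]}\ (2\le i\le n+1),\qquad \mathrm{coef}(h_{n,j})=\frac{[n][n+1-j]}{[2n][n+1]}\ (1\le j\le n+1).$$ **Proposition.** The reduced words form a basis of $\mathrm{TL}^D_{n+1}$ and of $\mathrm{TL}^A_{n+1}$ for every $n\ge0$, every diagram of type $D$ (resp. $A$) with $n+1$ strands represents exactly one element that is given by a reduced word, and the families $(Q_n)$ and $(P_n)$ exist and are unique, so that the coefficient of a diagram in $Q_n$ or $P_n$ is well defined. Let $n\ge1$, let $D$ be a diagram with $n+1$ strands and a unique dot (type (ii)), and let $D_i$ be the connectivity obtained from $D$ by forgetting the dot and removing the inner-most cap at position $i\in I(D)$. Then $$\mathrm{coef}_{Q_n}(D)=\sum_{i\in I(D)}\mathrm{coef}(h_{n,i})\,D_i^A+\sum_{i\in I(D)}2^{\delta(i=1)}\,\mathrm{coef}(g_{n,i})\,\mathrm{coef}_{Q_{n-1}}(D_i^{\mathrm{odd}}),$$ where $$D_i^A=\sum_{D'}\mathrm{coef}_{Q_{n-1}}(D')-[2]\,\mathrm{coef}_{Q_{n-1}}(D_i^{\mathrm{odd}}),$$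 the sum being over all diagrams $D'$ of type $D$ with connectivity $D_i$ and an even number of dots. Moreover, $D_i^A$ equals the coefficient of the type $A$ diagram $D_i$ in $P_{n-1}$, for every $i\in I(D)$. -/

import Mathlib

namespace TemperleyLieb

noncomputable section

/-! ## The ground field and quantum integers -/

/-- The field `ℂ(q)`. -/
abbrev K : Type := RatFunc ℂ

/-- The indeterminate `q`. -/
def q : K := RatFunc.X

/-- The quantum integer `[n] = (q^n - q^{-n}) / (q - q^{-1})`. -/
def qInt (n : ℕ) : K := (q ^ n - (q ^ n)⁻¹) / (q - q⁻¹)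

/-! ## Temperley--Lieb algebras by generators and relations -/

/-- The Temperley--Lieb relations for a simply laced Dynkin diagram `G`. -/
inductive Rel {V : Type} (G : SimpleGraph V) : FreeAlgebra K V → FreeAlgebra K V → Prop
  | loop (i : V) :
      Rel G (FreeAlgebra.ι K i * FreeAlgebra.ι K i) ((-qInt 2) • FreeAlgebra.ι K i)
  | adjacent (i j : V) (h : G.Adj i j) :
      Rel G (FreeAlgebra.ι K i * FreeAlgebra.ι K j * FreeAlgebra.ι K i) (FreeAlgebra.ι K i)
  | commute (i j : V) (h : ¬ G.Adj i j) :
      Rel G (FreeAlgebra.ι K i * FreeAlgebra.ι K j) (FreeAlgebra.ι K j * FreeAlgebra.ι K i)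

/-- The Temperley--Lieb algebra attached to a simply laced Dynkin diagram `G`. -/
abbrev TL {V : Type} (G : SimpleGraph V) : Type := RingQuot (Rel G)

/-- The generator `E_i`. -/
def E {V : Type} (G : SimpleGraph V) (i : V) : TL G :=
  RingQuot.mkAlgHom K (Rel G) (FreeAlgebra.ι K i)

/-- The homomorphism `E_i ↦ E_{f i}` induced by the embedding of a full subdiagram. -/
def TL.map {V W : Type} {G : SimpleGraph V} {H : SimpleGraph W} (f : G ↪g H) :
    TL G →ₐ[K] TL H :=
  RingQuot.liftAlgHom K ⟨FreeAlgebra.lift K (fun i => E H (f i)), by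
    intro x y h
    cases h with
    | loop i =>
      simpa [E] using RingQuot.mkAlgHom_rel K (Rel.loop (G := H) (f i))
    | adjacent i j h =>
      simpa [E] using RingQuot.mkAlgHom_rel K (Rel.adjacent (f i) (f j) (f.map_adj_iff.2 h))
    | commute i j h =>
      simpa [E] using RingQuot.mkAlgHom_rel K
        (Rel.commute (f i) (f j) (fun h' => h (f.map_adj_iff.1 h')))⟩

/-- The Dynkin diagram `D_{n+1}` with nodes `0, 1, …, n`: the nodes `0` and `1` are both joined to
`2`, and `2 - 3 - ⋯ - n` is a path. -/
def dynkinD (n : ℕ) : SimpleGraph (Fin (n + 1)) where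
  Adj i j := (i.val = 0 ∧ j.val = 2) ∨ (j.val = 0 ∧ i.val = 2) ∨
    (1 ≤ i.val ∧ j.val = i.val + 1) ∨ (1 ≤ j.val ∧ i.val = j.val + 1)
  symm := ⟨fun i j h => by omega⟩
  loopless := ⟨fun i h => by omega⟩

/-- The type `A` Dynkin diagram with `n` nodes. The node `k : Fin n` carries the label `k + 1`, so
that the labels are `1, …, n`. -/
abbrev dynkinA (n : ℕ) : SimpleGraph (Fin n) := SimpleGraph.pathGraph n

/-- `TL^D_{n+1}`, generated by `E_0, …, E_n`. -/
abbrev TLD (n : ℕ) : Type := TL (dynkinD n)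

/-- `TL^A_{n+1}`, generated by `E_1, …, E_n`. -/
abbrev TLA (n : ℕ) : Type := TL (dynkinA n)

/-- `TL^D_{i+1} → TL^D_{n+1}`, `E_k ↦ E_k`, for `i ≤ n`. -/
def inclD {i n : ℕ} (h : i ≤ n) : TLD i →ₐ[K] TLD n :=
  TL.map (G := dynkinD i) (H := dynkinD n)
    ⟨(Fin.castLEEmb (Nat.succ_le_succ h)), by
      intro a b
      change (dynkinD n).Adj (Fin.castLE (Nat.succ_le_succ h) a) (Fin.castLE (Nat.succ_le_succ h) b) ↔ _
      simp only [dynkinD, Fin.val_castLE]⟩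

/-- `TL^A_{i+1} → TL^A_{n+1}`, `E_k ↦ E_k`, for `i ≤ n`. -/
def inclA {i n : ℕ} (h : i ≤ n) : TLA i →ₐ[K] TLA n :=
  TL.map (G := dynkinA i) (H := dynkinA n)
    ⟨(Fin.castLEEmb h), by intro a b; simp [SimpleGraph.pathGraph_adj]⟩

/-! ## Jones--Wenzl projections -/

/-- `Q 0, Q 1, …` are the Jones--Wenzl projections of type `D`. -/
def IsJonesWenzlD (Q : ∀ n, TLD n) : Prop :=
  ∀ n, Q n ≠ 0 ∧
    (∀ (i : ℕ) (h : i ≤ n), Q n * inclD h (Q i) = Q n ∧ inclD h (Q i) * Q n = Q n) ∧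
    (∀ i : Fin (n + 1), E (dynkinD n) i * Q n = 0 ∧ Q n * E (dynkinD n) i = 0)

/-- `P 0, P 1, …` are the Jones--Wenzl projections of type `A`. -/
def IsJonesWenzlA (P : ∀ n, TLA n) : Prop :=
  ∀ n, P n ≠ 0 ∧
    (∀ (i : ℕ) (h : i ≤ n), P n * inclA h (P i) = P n ∧ inclA h (P i) * P n = P n) ∧
    (∀ i : Fin n, E (dynkinA n) i * P n = 0 ∧ P n * E (dynkinA n) i = 0)

/-! ## Reduced expressions and coefficients -/

/-- The word `E_w = E_{s_1} ⋯ E_{s_l}`. -/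
def word {V : Type} (G : SimpleGraph V) (w : List V) : TL G := (w.map (E G)).prod

/-- `w` is reduced: up to a scalar, `E_w` cannot be written with fewer generators. -/
def IsReducedWord {V : Type} (G : SimpleGraph V) (w : List V) : Prop :=
  ∀ (w' : List V) (c : K), word G w = c • word G w' → w.length ≤ w'.length

/-- The elements `E_w` with `w` reduced. -/
def monomials {V : Type} (G : SimpleGraph V) : Set (TL G) :=
  {x | ∃ w, IsReducedWord G w ∧ word G w = x}

/-- The reduced words form a basis of the algebra. -/
def MonomialsFormBasis {V : Type} (G : SimpleGraph V) : Prop :=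
  LinearIndependent K (fun x : monomials G => (x : TL G)) ∧
    ⊤ ≤ Submodule.span K (Set.range (fun x : monomials G => (x : TL G)))

open Classical in
/-- The coefficient in `x` of the reduced word `m` (with respect to the basis of reduced words). -/
def coeff {V : Type} {G : SimpleGraph V} (x m : TL G) : K :=
  if h : MonomialsFormBasis G ∧ m ∈ monomials G then
    (Module.Basis.mk h.1.1 h.1.2).repr x ⟨m, h.2⟩
  else 0

/-! ## Diagrams

A diagram with `n + 1` strands has `2 (n + 1)` marked points. They are numbered `0, …, 2 n + 1`
along the boundary: first the top points from left to right, then the bottom points from right to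
left. So the `k`-th top point from the left is `k - 1`, the `k`-th bottom point from the left is
`2 (n + 1) - k`, and `k` vertical strands correspond to `Fin.rev`. -/

/-- The connectivity of a diagram with `n + 1` strands: each marked point is sent to the other end
of its strand. -/
abbrev Conn (n : ℕ) : Type := Fin (2 * (n + 1)) → Fin (2 * (n + 1))

/-- `p` is a non-crossing perfect matching of the marked points, that is, a Temperley--Lieb diagram
(without dots). -/
def IsTLDiagram {n : ℕ} (p : Conn n) : Prop :=
  (∀ x, p (p x) = x) ∧ (∀ x, p x ≠ x) ∧ ∀ x y, ¬ (x < y ∧ y < p x ∧ p x < p y)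

/-- The connectivity of the identity diagram, which consists of `n + 1` vertical strands. -/
def idConn (n : ℕ) : Conn n := Fin.rev

/-- The bottom point number `i + 1` from the left. -/
def footL {n : ℕ} (i : Fin (n + 1)) : Fin (2 * (n + 1)) := ⟨2 * n + 1 - i.val, by omega⟩

/-- The marked point that precedes `footL i` along the boundary: the bottom point number `i + 2`
from the left if `i < n`, and the right-most top point if `i = n`. -/
def footR {n : ℕ} (i : Fin (n + 1)) : Fin (2 * (n + 1)) := ⟨2 * n - i.val, by omega⟩

/-- The set `I(D)` of positions of inner-most caps (dotted or not), where `i : Fin (n + 1)` stands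
for the position `i + 1`. Position `n + 1` means that the right-most points on the top and on the
bottom are joined by a vertical strand. -/
def innermost {n : ℕ} (p : Conn n) : Finset (Fin (n + 1)) :=
  Finset.univ.filter fun i => p (footL i) = footR i

/-- The order-preserving injection of `2 (n + 1)` points into `2 (n + 2)` points that omits
`footR i` and `footL i`. -/
def skip {n : ℕ} (i : Fin (n + 2)) (k : Fin (2 * (n + 1))) : Fin (2 * (n + 2)) :=
  ⟨if k.val < 2 * (n + 1) - i.val then k.val else k.val + 2, by split <;> omega⟩

/-- A left inverse of `skip i`. -/
def unskip {n : ℕ} (i : Fin (n + 2)) (k : Fin (2 * (n + 2))) : Fin (2 * (n + 1)) :=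
  ⟨if k.val < 2 * (n + 1) - i.val then k.val else k.val - 2, by split <;> omega⟩

/-- The connectivity of `D_i`: the inner-most cap at position `i + 1` is removed, and the remaining
`2 (n + 1)` marked points are again regarded as `n + 1` top points followed by `n + 1` bottom
points (so if a cap is removed, the right-most top point moves to the bottom). -/
def remove {n : ℕ} (p : Conn (n + 1)) (i : Fin (n + 2)) : Conn n :=
  fun k => unskip i (p (skip i k))

/-- A diagram with `n + 1` strands, possibly with dots: `dotted x` says that the strand through
the marked point `x` has a dot. -/
@[ext]
structure Diagram (n : ℕ) where
  partner : Conn n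
  dotted : Fin (2 * (n + 1)) → Bool

namespace Diagram

/-- `D` is a Temperley--Lieb diagram with at most one dot on each strand. -/
def IsDotted {n : ℕ} (D : Diagram n) : Prop :=
  IsTLDiagram D.partner ∧ ∀ x, D.dotted (D.partner x) = D.dotted x

/-- The number of dots. A strand is counted at its smaller end point. -/
def numDots {n : ℕ} (D : Diagram n) : ℕ :=
  (Finset.univ.filter fun x => x < D.partner x ∧ D.dotted x = true).card

/-- The strand through `x` is an outer-most cup, an outer-most cap or the left-most vertical
strand, which in the present numbering of the marked points means that no other strand encloses
it. -/
def IsOutermost {n : ℕ} (D : Diagram n) (x : Fin (2 * (n + 1))) : Prop :=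
  ∀ y, ¬ (y < x ∧ x < D.partner y ∧ y < D.partner x ∧ D.partner x < D.partner y)

/-- A diagram of type `D` with an even number of dots: the dots are on outer-most cups and caps and
on the left-most vertical strand. (In particular vertical strands alone carry no dot.) -/
def IsEven {n : ℕ} (D : Diagram n) : Prop :=
  D.IsDotted ∧ Even D.numDots ∧ ∀ x, D.dotted x = true → D.IsOutermost x

/-- A diagram of type `D` with a unique dot: it does not consist of vertical strands only, and the
dot is on the strand through the left-most bottom point. -/
def IsOdd {n : ℕ} (D : Diagram n) : Prop :=
  D.IsDotted ∧ D.numDots = 1 ∧ D.dotted (footL 0) = true ∧ D.partner ≠ idConn n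

end Diagram

/-- The diagram with connectivity `p` and one dot, on the strand through the left-most bottom
point. -/
def oddDiagram {n : ℕ} (p : Conn n) : Diagram n :=
  ⟨p, fun x => decide (x = footL 0 ∨ x = p (footL 0))⟩

/-! ## Graphical representation of words -/

/-- The connectivity after a generator `E` with a cup and a cap at position `i + 1` is put below a
diagram with connectivity `p`. -/
def stackConn {n : ℕ} (p : Conn n) (i : Fin (n + 1)) : Conn n := fun x =>
  if x = footL i then footR i
  else if x = footR i then footL i
  else if x = p (footL i) then p (footR i)
  else if x = p (footR i) then p (footL i)
  else p x

/-- The dots after a generator at position `i + 1` is put below `D`; the generator has dots on its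
cup and on its cap if `e` is true, and no dots otherwise. The two strands of `D` that end at
the cup of the generator are joined by it; if they form a loop, the loop is deleted. -/
def stackDots {n : ℕ} (D : Diagram n) (i : Fin (n + 1)) (e : Bool) :
    Fin (2 * (n + 1)) → Bool := fun x =>
  if x = footL i ∨ x = footR i then e
  else if x = D.partner (footL i) ∨ x = D.partner (footR i) then
    (D.dotted (footL i) ^^ D.dotted (footR i)) ^^ e
  else D.dotted x

/-- `E_s` put below `D`, for `s = 0, …, n`. The generators `E_0` and `E_1` are at position `1`, and
`E_s` is at position `s` for `s ≥ 1`; only `E_0` has dots. -/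
def stackD {n : ℕ} (D : Diagram n) (s : Fin (n + 1)) : Diagram n :=
  let i : Fin (n + 1) := ⟨s.val - 1, by omega⟩
  ⟨stackConn D.partner i, stackDots D i (decide (s = 0))⟩

open Classical in
/-- If the number of dots is odd, the dot is moved to the strand through the left-most bottom
point. -/
def normalizeDots {n : ℕ} (D : Diagram n) : Diagram n :=
  if Even D.numDots then D else oddDiagram D.partner

/-- The graphical representation of a (reduced) word of `TL^D_{n+1}`. -/
def wordDiagramD {n : ℕ} (w : List (Fin (n + 1))) : Diagram n :=
  normalizeDots (w.foldl stackD ⟨idConn n, fun _ => false⟩)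

/-- The graphical representation of a (reduced) word of `TL^A_{n+1}`; recall that `k : Fin n` is
the node with label `k + 1`. -/
def wordConnA {n : ℕ} (w : List (Fin n)) : Conn n :=
  w.foldl (fun p k => stackConn p k.castSucc) (idConn n)

/-- `x` is a reduced word of `TL^D_{n+1}` that is represented by the diagram `D`. -/
def RepresentsD {n : ℕ} (D : Diagram n) (x : TLD n) : Prop :=
  ∃ w, IsReducedWord (dynkinD n) w ∧ wordDiagramD w = D ∧ word (dynkinD n) w = x

/-- `x` is a reduced word of `TL^A_{n+1}` that is represented by the diagram `p`. -/
def RepresentsA {n : ℕ} (p : Conn n) (x : TLA n) : Prop :=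
  ∃ w, IsReducedWord (dynkinA n) w ∧ wordConnA w = p ∧ word (dynkinA n) w = x

/-- The coefficient in `x` of the diagram `D` of type `D`. -/
def coefD {n : ℕ} (x : TLD n) (D : Diagram n) : K :=
  coeff x (Classical.epsilon (RepresentsD D))

/-- The coefficient in `x` of the diagram `p` of type `A`. -/
def coefA {n : ℕ} (x : TLA n) (p : Conn n) : K :=
  coeff x (Classical.epsilon (RepresentsA p))

/-! ## The terms of the recurrence -/

/-- `coef(g_{n,i})`. -/
def coefG (n i : ℕ) : K :=
  if i = 1 then qInt n / qInt (2 * n)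
  else qInt n * qInt (2 * i - 2) / (qInt (2 * n) * qInt (i - 1))

/-- `coef(h_{n,j})` for `j ≤ n + 1` (it is `0` for `j = n + 1`). -/
def coefH (n j : ℕ) : K :=
  qInt n * qInt (n + 1 - j) / (qInt (2 * n) * qInt (n + 1))

open Classical in
/-- The coefficient in `x` of the diagram `D^odd` with a unique dot and connectivity `p`. There is
no such diagram if `p` is the identity. -/
def oddTerm {n : ℕ} (x : TLD n) (p : Conn n) : K :=
  if p = idConn n then 0 else coefD x (oddDiagram p)

open Classical in
/-- The combination `D^A = ∑ D - [2] D^odd`, where the sum is over the diagrams `D` with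
connectivity `p` and an even number of dots, and where each diagram of type `D` stands for its
coefficient in `x`. -/
def typeACombination {n : ℕ} (x : TLD n) (p : Conn n) : K :=
  (∑ d ∈ Finset.univ.filter (fun d : Fin (2 * (n + 1)) → Bool => (Diagram.mk p d).IsEven),
      coefD x ⟨p, d⟩) - qInt 2 * oddTerm x p

end

end TemperleyLieb

open TemperleyLieb

namespace TemperleyLieb

/-! ## Matchings with dots on an arbitrary set of points -/

/-! The diagram calculus is made exact on words, and the recurrence is then read off a product
formula for `Q`. A diagram is encoded as a matching of the boundary points, with dots counted modulo
two on each strand, and with one extra value `none` that is taken as soon as a loop with an odd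
number of dots has been deleted. From then on the position of dots is immaterial; except for the
single strand, such a state corresponds to a diagram of type (ii). The generator `E_0` is `E_1`
conjugated by toggling the dot on the strand through the left-most bottom point, and toggling
commutes with `E_s` for `s ≥ 2`, so that statements about `E_0` reduce to statements about undotted
generators.

Bases: every diagram arises from one with a strand less by inserting an innermost cap
(`Valid.exists_ins`), which in the algebra is right multiplication by a ladder `E_{n+1} ⋯ E_k`. The
exchange relations between ladders show that the resulting product depends only on the diagram
(`DRel.evCanon_mul_lad`), and the relations between ladders and generators mirror the action on
diagrams (`DRel.mul_of_ins`). A dotted loop can be slid from one generator to another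
(`DRel.mul_dloop`); hence multiplication by a dotted loop is a well-defined map `addLoop` from words
of type `A` to type `D`, and it supplies the elements of type (ii). These elements span, and they
are independent because the algebra acts on the free module on the diagrams (`DiagramModel`).

Projections: an element that is killed by the generators and has counit one is unique, so it
suffices to exhibit one. The choice is `Q_m = Q_{m-1} * jwFactor m`, where the factor combines
ladders with coefficients `coefG` and ladders with a dotted loop with coefficients `coefH`. Modulo
terms killed by `Q_{m-1}`, multiplication by a generator is tridiagonal on ladders, and everything
cancels by three-term relations of the coefficients. The homomorphism `forget`, which sends `E_0` to
`E_1`, carries `Q` to `P`.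

Recurrence: let a basis diagram `τ` be multiplied by `jwFactor`. A ladder inserts a cap into `τ` and
gives an odd diagram only if `τ` is odd; the ladders ending in `E_0` and `E_1` give the same odd
diagram, whence the factor 2. A ladder with a dotted loop always gives an odd diagram, with weight
`1` or `-[2]` according as `τ` is even or odd. These are the weights of `τ` in the combination
`D_i^A`, and also the factors by which `forget` sends `τ` to its connectivity, so `D_i^A` is a
coefficient of `P`. -/

/-- A matching of the points `X`, with dots; `dots = none` records that a loop with an odd number of
dots has been deleted. -/
@[ext]
structure Config (X : Type) where
  conn : X → X
  dots : Option (X → Bool)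

namespace Config

section
variable {X Y Z : Type} [DecidableEq X] [DecidableEq Y] [DecidableEq Z]

/-- The matching after `p a` and `p b` are joined through `a` and `b`. -/
def join (a b : X) (p : X → X) : X → X := fun x =>
  if x = a then b else if x = b then a else if x = p a then p b else if x = p b then p a else p x

/-- The dots after `p a` and `p b` are joined through `a` and `b`. -/
def joinDots (a b : X) (p : X → X) (d : X → Bool) : X → Bool := fun x =>
  if x = a ∨ x = b then false else if x = p a ∨ x = p b then d a ^^ d b else d x

/-- An undotted generator at the points `a` and `b`. -/
def close (a b : X) (σ : Config X) : Config X :=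
  ⟨join a b σ.conn, σ.dots.bind fun d =>
    if σ.conn a = b ∧ d a = true then none else some (joinDots a b σ.conn d)⟩

/-- Toggle the dot on the strand through `a`. -/
def flip (a : X) (σ : Config X) : Config X :=
  ⟨σ.conn, σ.dots.map fun d x => d x ^^ decide (x = a ∨ x = σ.conn a)⟩

/-- The dots are on the strands of a fixed point free involution. -/
structure Wf (σ : Config X) : Prop where
  inv : ∀ x, σ.conn (σ.conn x) = x
  ne : ∀ x, σ.conn x ≠ x
  dots : ∀ d, σ.dots = some d → ∀ x, d (σ.conn x) = d x

theorem join_inv {a b : X} (hab : a ≠ b) {p : X → X} (hp : ∀ x, p (p x) = x) (hf : ∀ x, p x ≠ x)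
    (x : X) : join a b p (join a b p x) = x := by
  unfold join; grind (splits := 60)

theorem join_ne {a b : X} (hab : a ≠ b) {p : X → X} (hp : ∀ x, p (p x) = x) (hf : ∀ x, p x ≠ x)
    (x : X) : join a b p x ≠ x := by
  unfold join; grind (splits := 60)

theorem joinDots_join {a b : X} {p : X → X} {d : X → Bool} (hp : ∀ x, p (p x) = x)
    (hf : ∀ x, p x ≠ x) (hd : ∀ x, d (p x) = d x) (x : X) :
    joinDots a b p d (join a b p x) = joinDots a b p d x := by
  unfold join joinDots; grind (splits := 60)

theorem Wf.close {a b : X} (hab : a ≠ b) {σ : Config X} (h : σ.Wf) : (close a b σ).Wf := by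
  refine ⟨join_inv hab h.inv h.ne, join_ne hab h.inv h.ne, ?_⟩
  intro d hd x
  obtain ⟨p, d'⟩ := σ
  cases d' with
  | none => simp [Config.close] at hd
  | some d' =>
    simp only [Config.close, Option.bind_some] at hd
    split_ifs at hd
    simp only [Option.some.injEq] at hd
    subst hd
    exact joinDots_join h.inv h.ne (h.dots d' rfl) x

theorem Wf.flip (a : X) {σ : Config X} (h : σ.Wf) : (flip a σ).Wf := by
  refine ⟨h.inv, h.ne, ?_⟩
  intro d hd x
  obtain ⟨p, d'⟩ := σ
  cases d' with
  | none => simp [Config.flip] at hd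
  | some d' =>
    simp only [Config.flip, Option.map_some, Option.some.injEq] at hd
    subst hd
    have h1 := h.dots d' rfl x
    have h2 := h.inv
    simp only [Config.flip] at h1 h2 ⊢
    rw [h1]
    congr 1
    refine decide_eq_decide.2 ⟨?_, ?_⟩
    · rintro (h | h)
      · exact Or.inr (by rw [← h, h2])
      · exact Or.inl (by rw [← h2 x, h, h2])
    · rintro (h | h)
      · exact Or.inr (by rw [h])
      · exact Or.inl (by rw [h, h2])

theorem join_join {a b : X} (hab : a ≠ b) (p : X → X) : join a b (join a b p) = join a b p := by
  funext x; unfold join; grind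

theorem join_braid {a b c : X} (hab : a ≠ b) (hac : a ≠ c) (hbc : b ≠ c) {p : X → X}
    (hp : ∀ x, p (p x) = x) (hf : ∀ x, p x ≠ x) :
    join a b (join b c (join a b p)) = join a b p := by
  funext x; unfold join; grind

theorem join_comm {a b c d : X} (hab : a ≠ b) (hcd : c ≠ d) (hac : a ≠ c) (hbc : b ≠ c)
    (hda : d ≠ a) (hdb : d ≠ b) {p : X → X} (hp : ∀ x, p (p x) = x) (hf : ∀ x, p x ≠ x) :
    join a b (join c d p) = join c d (join a b p) := by
  funext x; unfold join; grind (splits := 60)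

theorem join_symm {a b : X} {p : X → X} (hp : ∀ x, p (p x) = x) : join a b p = join b a p := by
  funext x; unfold join; grind

theorem joinDots_symm (a b : X) (p : X → X) (d : X → Bool) :
    joinDots a b p d = joinDots b a p d := by
  funext x; unfold joinDots; grind

theorem joinDots_joinDots {a b : X} (hab : a ≠ b) (p : X → X) (d : X → Bool) :
    joinDots a b (join a b p) (joinDots a b p d) = joinDots a b p d := by
  funext x; unfold join joinDots; grind

theorem joinDots_braid {a b c : X} (hab : a ≠ b) (hac : a ≠ c) (hbc : b ≠ c) {p : X → X}
    {d : X → Bool} (hp : ∀ x, p (p x) = x) (hf : ∀ x, p x ≠ x) (hd : ∀ x, d (p x) = d x) :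
    joinDots a b (join b c (join a b p)) (joinDots b c (join a b p) (joinDots a b p d)) =
      joinDots a b p d := by
  funext x
  have hj : ∀ (a b : X) (p : X → X) (x : X), join a b p x = if x = a then b else if x = b then a
    else if x = p a then p b else if x = p b then p a else p x := fun _ _ _ _ => rfl
  have hk : ∀ (a b : X) (p : X → X) (d : X → Bool) (x : X), joinDots a b p d x =
    if x = a ∨ x = b then false else if x = p a ∨ x = p b then
      (if d a = true then (if d b = true then false else true) else d b) else d x := by
    intro a b p d x; unfold joinDots; cases d a <;> cases d b <;> rfl
  have h1 := hj a b p
  have h2 := hj b c (join a b p)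
  have h3 := hk a b p d
  have h4 := hk b c (join a b p) (joinDots a b p d)
  have h5 := hk a b (join b c (join a b p)) (joinDots b c (join a b p) (joinDots a b p d)) x
  clear hj hk
  have := h1 a; have := h1 b; have := h1 c
  have := h2 a; have := h2 b; have := h3 a; have := h3 b; have := h3 c
  have := h4 a; have := h4 b; have := h4 x; have := h3 x
  clear h1 h2 h3 h4
  grind (splits := 60)

theorem joinDots_comm {a b c e : X} (hab : a ≠ b) (hce : c ≠ e) (hac : a ≠ c) (hbc : b ≠ c)
    (hea : e ≠ a) (heb : e ≠ b) {p : X → X} {d : X → Bool} (hp : ∀ x, p (p x) = x)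
    (hf : ∀ x, p x ≠ x) (hd : ∀ x, d (p x) = d x) :
    joinDots a b (join c e p) (joinDots c e p d) = joinDots c e (join a b p) (joinDots a b p d) := by
  funext x
  have hj : ∀ (a b : X) (p : X → X) (x : X), join a b p x = if x = a then b else if x = b then a
    else if x = p a then p b else if x = p b then p a else p x := fun _ _ _ _ => rfl
  have hk : ∀ (a b : X) (p : X → X) (d : X → Bool) (x : X), joinDots a b p d x =
    if x = a ∨ x = b then false else if x = p a ∨ x = p b then
      (if d a = true then (if d b = true then false else true) else d b) else d x := by
    intro a b p d x; unfold joinDots; cases d a <;> cases d b <;> rfl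
  have h1 := hj a b p
  have h2 := hj c e p
  have h3 := hk a b p d
  have h4 := hk c e p d
  have := hk a b (join c e p) (joinDots c e p d) x
  have := hk c e (join a b p) (joinDots a b p d) x
  clear hj hk
  have := h1 c; have := h1 e
  have := h2 a; have := h2 b; have := h3 c; have := h3 e; have := h3 x
  have := h4 a; have := h4 b; have := h4 x
  clear h1 h2 h3 h4
  have := hp a; have := hp b; have := hp c; have := hp e
  have := hf a; have := hf b; have := hf c; have := hf e
  have := hd a; have := hd b; have := hd c; have := hd e
  clear hp hf hd
  grind (splits := 60)
end
end Config
end TemperleyLieb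

/-! ### Closing, toggling and inserting strands: relations on matchings with dots. -/

namespace TemperleyLieb
namespace Config
section
set_option linter.unusedSectionVars false
variable {X Y Z : Type} [DecidableEq X] [DecidableEq Y] [DecidableEq Z]

theorem close_none (a b : X) (p : X → X) :
    close a b ⟨p, none⟩ = ⟨join a b p, none⟩ := rfl

theorem close_some (a b : X) (p : X → X) (d : X → Bool) :
    close a b ⟨p, some d⟩ =
      ⟨join a b p, if p a = b ∧ d a = true then none else some (joinDots a b p d)⟩ := rfl

theorem flip_none (a : X) (p : X → X) : flip a ⟨p, none⟩ = ⟨p, none⟩ := rfl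

theorem flip_some (a : X) (p : X → X) (d : X → Bool) :
    flip a ⟨p, some d⟩ = ⟨p, some fun x => d x ^^ decide (x = a ∨ x = p a)⟩ := rfl

theorem close_conn (a b : X) (σ : Config X) : (close a b σ).conn = join a b σ.conn := rfl

theorem join_left (a b : X) (p : X → X) : join a b p a = b := by simp [join]

theorem flip_flip (a : X) (σ : Config X) : flip a (flip a σ) = σ := by
  obtain ⟨p, _ | d⟩ := σ
  · rfl
  · simp [flip_some]

theorem flip_injective (a : X) : Function.Injective (flip a : Config X → Config X) :=
  fun x y h => by rw [← flip_flip a x, h, flip_flip]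

theorem close_symm {a b : X} {σ : Config X} (h : σ.Wf) : close a b σ = close b a σ := by
  refine Config.ext (join_symm h.inv) ?_
  obtain ⟨p, _ | d⟩ := σ
  · rfl
  · have hd := h.dots d rfl
    have hp := h.inv
    simp only at hd hp
    have : (p a = b ∧ d a = true) ↔ (p b = a ∧ d b = true) := by
      constructor
      · rintro ⟨rfl, h2⟩; exact ⟨hp _, by rw [hd, h2]⟩
      · rintro ⟨rfl, h2⟩; exact ⟨hp _, by rw [hd, h2]⟩
    simp only [close, Option.bind_some, this, joinDots_symm a b]

theorem close_close {a b : X} (hab : a ≠ b) {σ : Config X} :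
    close a b (close a b σ) = close a b σ := by
  obtain ⟨p, _ | d⟩ := σ
  · simp only [close_none, join_join hab]
  · rw [close_some]
    split_ifs
    · simp only [close_none, join_join hab]
    · simp [close_some, join_join hab, joinDots_joinDots hab, joinDots]

theorem close_braid {a b c : X} (hab : a ≠ b) (hac : a ≠ c) (hbc : b ≠ c) {σ : Config X}
    (h : σ.Wf) : close a b (close b c (close a b σ)) = close a b σ := by
  obtain ⟨p, _ | d⟩ := σ
  · simp only [close_none, join_braid hab hac hbc h.inv h.ne]
  · rw [close_some]
    split_ifs
    · simp only [close_none, join_braid hab hac hbc h.inv h.ne]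
    -- After the first closing `b` is joined to `a`, so closing `b, c` deletes no loop; after that
    -- `b` is joined to `c`, so the last closing deletes none either.
    · have h1 : join a b p b = a := by simp [join, hab.symm]
      have h2 : join b c (join a b p) a ≠ b := by
        intro h'
        have := join_inv hbc (join_inv hab h.inv h.ne) (join_ne hab h.inv h.ne) a
        rw [h', join_left] at this
        exact hac this.symm
      rw [close_some, if_neg (by rw [h1]; exact fun h => hac h.1), close_some,
        if_neg (fun h => h2 h.1), join_braid hab hac hbc h.inv h.ne,
        joinDots_braid hab hac hbc h.inv h.ne (h.dots d rfl)]

/-- A strand between `c` and `e` either was there before or runs through the new connection of `a`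
with `b`. The comparison of loops in the two orders of closing rests on this. -/
theorem join_eq_iff {a b c e : X} (hab : a ≠ b) (hce : c ≠ e) (hac : a ≠ c) (hbc : b ≠ c)
    (hea : e ≠ a) (heb : e ≠ b) {p : X → X} (hp : ∀ x, p (p x) = x) (hf : ∀ x, p x ≠ x) :
    join a b p c = e ↔ p c = e ∨ (p c = a ∧ p b = e) ∨ (p c = b ∧ p a = e) := by
  unfold join; grind

theorem close_comm {a b c e : X} (hab : a ≠ b) (hce : c ≠ e) (hac : a ≠ c) (hbc : b ≠ c)
    (hea : e ≠ a) (heb : e ≠ b) {σ : Config X} (h : σ.Wf) :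
    close a b (close c e σ) = close c e (close a b σ) := by
  obtain ⟨p, _ | d⟩ := σ
  · simp only [close_none, join_comm hab hce hac hbc hea heb h.inv h.ne]
  · have e1 := join_comm hab hce hac hbc hea heb h.inv h.ne
    have e2 := joinDots_comm hab hce hac hbc hea heb h.inv h.ne (h.dots d rfl)
    have i1 := join_eq_iff hab hce hac hbc hea heb h.inv h.ne
    have i2 := join_eq_iff hce hab hac.symm hea hbc heb.symm h.inv h.ne
    have hp := h.inv
    have hd := h.dots d rfl
    simp only at e1 e2 i1 i2 hp hd
    have k1 : joinDots a b p d c = if c = a ∨ c = b then false else if c = p a ∨ c = p b then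
      (if d a = true then (if d b = true then false else true) else d b) else d c := by
        unfold joinDots; cases d a <;> cases d b <;> rfl
    have k2 : joinDots c e p d a = if a = c ∨ a = e then false else if a = p c ∨ a = p e then
      (if d c = true then (if d e = true then false else true) else d e) else d a := by
        unfold joinDots; cases d c <;> cases d e <;> rfl
    have a1 := hp a
    have a2 := hp b
    have a3 := hp c
    have a4 := hp e
    have b1 := hd a
    have b2 := hd b
    have b3 := hd c
    have b4 := hd e
    rw [close_some, close_some]
    -- The condition for deleting an odd loop is independent of the order. Two separate loops are
    -- each tested on their own; a single loop through all four points has the parity of the two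
    -- strands that compose it.
    have key : (p c = e ∧ d c = true ∨ (join c e p a = b ∧ joinDots c e p d a = true)) ↔
      (p a = b ∧ d a = true ∨ (join a b p c = e ∧ joinDots a b p d c = true)) := by
      rw [i1, i2]
      clear e1 e2 i1 i2 hp hd h
      grind (splits := 40)
    split_ifs with h1 h2 h2 <;> simp only [close_none, close_some] <;> (try split_ifs) <;>
      simp_all

/-- The end point `a` survives the closing. If its strand is one of the two that are joined, the
toggled dot is inherited by the joined strand, which now ends at `a`. -/
theorem join_ne_pts {a c e : X} (hac : a ≠ c) (hae : a ≠ e) {p : X → X}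
    (hp : ∀ x, p (p x) = x) (hf : ∀ x, p x ≠ x) (d : X → Bool) (hd : ∀ x, d (p x) = d x)
    (hce : c ≠ e) (x : X) :
    joinDots c e p (fun x => d x ^^ decide (x = a ∨ x = p a)) x =
      (joinDots c e p d x ^^ decide (x = a ∨ x = join c e p a)) := by
  have hx : ∀ u v : Bool, (u ^^ v) =
      if u = true then (if v = true then false else true) else v := by decide
  have h1 := hp a
  have h2 := hp c
  have h3 := hp e
  have h4 := hp x
  have h5 := hf a
  have h6 := hf c
  have h7 := hf e
  have h8 := hd a
  have h9 := hd c
  have h10 := hd e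
  clear hp hf hd
  simp only [joinDots, join, hx]
  by_cases h1 : p a = c <;> by_cases h2 : p a = e <;> by_cases h3 : x = a <;>
    by_cases h4 : x = c <;> by_cases h5 : x = e <;> by_cases h6 : x = p a <;> cases d c <;> cases d e <;> cases d x <;>
    grind (splits := 40)

theorem flip_close {a c e : X} (hac : a ≠ c) (hae : a ≠ e) (hce : c ≠ e) {σ : Config X}
    (h : σ.Wf) : flip a (close c e σ) = close c e (flip a σ) := by
  obtain ⟨p, _ | d⟩ := σ
  · rfl
  · have hp := h.inv
    have hd := h.dots d rfl
    simp only at hp hd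
    -- A strand from `c` to `e` does not end at `a`, so the toggle does not affect the parity of the
    -- loop that is deleted.
    have key : p c = e → ¬ (c = a ∨ c = p a) := by
      rintro h1 (h2 | h2)
      · exact hac h2.symm
      · rw [h2, hp] at h1; exact hae h1
    rw [close_some, flip_some, close_some]
    by_cases h1 : p c = e
    · have := key h1
      simp only [h1, this, decide_false, Bool.xor_false, true_and]
      split_ifs
      · rfl
      · rw [flip_some]
        congr 2
        funext x
        exact (join_ne_pts hac hae hp h.ne d hd hce x).symm
    · rw [if_neg (fun h => h1 h.1), if_neg (fun h => h1 h.1), flip_some]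
      congr 2
      funext x
      exact (join_ne_pts hac hae hp h.ne d hd hce x).symm

/-- After the first closing the strand from `a` to `b` is undotted, so the toggle puts exactly one
dot on it and the second closing turns it into a loop with one dot. This is how `E_0` and `E_1`
together produce `none`. -/
theorem close_flip_close {a b : X} (hab : a ≠ b) (σ : Config X) :
    close a b (flip a (close a b σ)) = ⟨join a b σ.conn, none⟩ := by
  obtain ⟨p, _ | d⟩ := σ
  · simp only [close_none, flip_none, join_join hab]
  · rw [close_some]
    split_ifs
    · simp only [close_none, flip_none, join_join hab]
    · rw [flip_some, close_some, join_join hab, if_pos]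
      simp [joinDots, join_left]

/-! ### Inserting a strand that joins two consecutive points -/

/-- `ι` is an injection that omits exactly `a` and `b`, with left inverse `r`. -/
structure IsGap (ι : X → Y) (r : Y → X) (a b : Y) : Prop where
  left : ∀ x, r (ι x) = x
  right : ∀ y, y = a ∨ y = b ∨ ι (r y) = y
  ne_a : ∀ x, ι x ≠ a
  ne_b : ∀ x, ι x ≠ b
  ab : a ≠ b

/-- Add an undotted strand that joins `a` and `b`. -/
def insert (ι : X → Y) (r : Y → X) (a b : Y) (σ : Config X) : Config Y :=
  ⟨fun y => if y = a then b else if y = b then a else ι (σ.conn (r y)),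
    σ.dots.map fun d y => if y = a ∨ y = b then false else d (r y)⟩

variable {ι : X → Y} {r : Y → X} {a b : Y}

theorem IsGap.inj (h : IsGap ι r a b) {x y : X} (hxy : ι x = ι y) : x = y := by
  rw [← h.left x, hxy, h.left]

theorem insert_conn_a (ι : X → Y) (r : Y → X) (a b : Y) (σ : Config X) :
    (insert ι r a b σ).conn a = b := by simp [insert]

theorem insert_conn_b (ι : X → Y) (r : Y → X) {a b : Y} (hab : a ≠ b) (σ : Config X) :
    (insert ι r a b σ).conn b = a := by simp [insert, hab.symm]

theorem insert_conn (h : IsGap ι r a b) (σ : Config X) (x : X) :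
    (insert ι r a b σ).conn (ι x) = ι (σ.conn x) := by
  simp [insert, h.ne_a, h.ne_b, h.left]

theorem IsGap.ext_iff (h : IsGap ι r a b) {T : Type} {f g : Y → T} :
    f = g ↔ f a = g a ∧ f b = g b ∧ ∀ x, f (ι x) = g (ι x) := by
  constructor
  · rintro rfl; simp
  · rintro ⟨h1, h2, h3⟩
    funext y
    rcases h.right y with rfl | rfl | hy
    · exact h1
    · exact h2
    · rw [← hy]; exact h3 _

theorem IsGap.forall_iff (h : IsGap ι r a b) {P : Y → Prop} :
    (∀ y, P y) ↔ P a ∧ P b ∧ ∀ x, P (ι x) := by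
  constructor
  · intro h; exact ⟨h _, h _, fun x => h _⟩
  · rintro ⟨h1, h2, h3⟩ y
    rcases h.right y with rfl | rfl | hy
    · exact h1
    · exact h2
    · rw [← hy]; exact h3 _

theorem insert_injective (h : IsGap ι r a b) : Function.Injective (insert ι r a b) := by
  rintro ⟨p, d⟩ ⟨p', d'⟩ he
  have h1 : p = p' := by
    funext x
    have := congrArg (fun σ => r (σ.conn (ι x))) he
    simpa [insert_conn h, h.left] using this
  have h2 := congrArg Config.dots he
  subst h1
  congr
  cases d <;> cases d' <;> simp [insert] at h2 ⊢
  funext x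
  have := congrFun h2 (ι x)
  simpa [h.ne_a, h.ne_b, h.left] using this

theorem Wf.insert (h : IsGap ι r a b) {σ : Config X} (hσ : σ.Wf) : (insert ι r a b σ).Wf := by
  have hab := h.ab
  refine ⟨fun x => ?_, fun x => ?_, fun d hd x => ?_⟩
  · rcases h.right x with rfl | rfl | hx
    · rw [insert_conn_a, insert_conn_b _ _ hab]
    · rw [insert_conn_b _ _ hab, insert_conn_a]
    · rw [← hx, insert_conn h, insert_conn h, hσ.inv]
  · rcases h.right x with rfl | rfl | hx
    · rw [insert_conn_a]; exact hab.symm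
    · rw [insert_conn_b _ _ hab]; exact hab
    · rw [← hx, insert_conn h]; exact fun h' => hσ.ne _ (h.inj h')
  · obtain ⟨p, _ | d'⟩ := σ
    · simp [Config.insert] at hd
    · simp only [Config.insert, Option.map_some, Option.some.injEq] at hd
      subst hd
      rcases h.right x with rfl | rfl | hx
      · rw [insert_conn_a]; simp
      · rw [insert_conn_b _ _ hab]; simp
      · rw [← hx, insert_conn h]
        simpa [h.ne_a, h.ne_b, h.left] using hσ.dots d' rfl (r x)

theorem close_insert (h : IsGap ι r a b) (σ : Config X) :
    close a b (insert ι r a b σ) = insert ι r a b σ := by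
  have hab := h.ab
  have e1 : join a b (insert ι r a b σ).conn = (insert ι r a b σ).conn := by
    funext y
    unfold join
    rw [insert_conn_a, insert_conn_b _ _ hab]
    simp only [insert]
    grind
  obtain ⟨p, _ | d⟩ := σ
  · exact Config.ext e1 rfl
  · refine Config.ext e1 ?_
    simp only [close, insert, Option.map_some, Option.bind_some]
    simp
    funext y
    simp only [joinDots]
    grind

theorem flip_insert (h : IsGap ι r a b) (x : X) (σ : Config X) :
    flip (ι x) (insert ι r a b σ) = insert ι r a b (flip x σ) := by
  obtain ⟨p, _ | d⟩ := σ
  · rfl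
  · refine Config.ext rfl ?_
    simp only [flip, insert, Option.map_some, Option.some.injEq]
    refine h.ext_iff.2 ⟨?_, ?_, fun y => ?_⟩
    · simp [(h.ne_a _).symm, h.left, h.ne_a, h.ne_b]
    · simp [(h.ne_b _).symm, h.left, h.ne_a, h.ne_b]
    · simp only [h.ne_a, h.ne_b, h.left, or_self, if_false]
      congr 2
      apply propext
      exact or_congr ⟨h.inj, fun h => by rw [h]⟩ ⟨fun h' => h.inj h', fun h => by rw [h]⟩

theorem close_insert_comm (h : IsGap ι r a b) (c e : X) (σ : Config X) :
    close (ι c) (ι e) (insert ι r a b σ) = insert ι r a b (close c e σ) := by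
  have hinj : ∀ x y, ι x = ι y ↔ x = y := fun x y => ⟨h.inj, fun h => by rw [h]⟩
  have hab := h.ab
  have e1 : join (ι c) (ι e) (insert ι r a b σ).conn = (insert ι r a b (close c e σ)).conn := by
    refine h.ext_iff.2 ⟨?_, ?_, fun y => ?_⟩
    · simp [join, insert_conn_a, insert_conn h, (h.ne_a _).symm]
    · simp [join, insert_conn_b _ _ hab, insert_conn h, (h.ne_b _).symm]
    · simp only [join, insert_conn h, hinj, close_conn]
      split_ifs <;> rfl
  refine Config.ext e1 ?_
  obtain ⟨p, _ | d⟩ := σ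
  · rfl
  · have h0 := insert_conn h ⟨p, some d⟩
    simp only [close, Option.bind_some]
    simp only [insert_conn h, hinj]
    simp only [insert, Option.map_some, Option.bind_some, h.left, h.ne_a, h.ne_b, or_self, if_false]
    by_cases h1 : p c = e ∧ d c = true
    · simp [h1]
    · rw [if_neg h1, if_neg h1]
      simp only [Option.map_some, Option.some.injEq]
      refine h.ext_iff.2 ⟨?_, ?_, fun y => ?_⟩ <;>
        simp [joinDots, (h.ne_a _).symm, (h.ne_b _).symm, h.ne_a, h.ne_b, h.left, hinj]

/-- An isotopy: the strand that arrives at `a` continues through the closing to `b` and along the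
inserted strand to `c`, and is pulled straight. Accordingly `hκ` moves the end at `a` to `c` and
keeps all other points. -/
theorem close_insert_adj {κ : X → Y} {t : Y → X} {c : Y} (h : IsGap ι r b c) (k : IsGap κ t a b)
    (hac : a ≠ c) (hκ : ∀ x, κ x = if ι x = a then c else ι x) {σ : Config X} (hσ : σ.Wf) :
    close a b (insert ι r b c σ) = insert κ t a b σ := by
  have hbc := h.ab
  have hab := k.ab
  have hinj : ∀ x y, ι x = ι y ↔ x = y := fun x y => ⟨h.inj, fun h => by rw [h]⟩
  obtain ⟨z, hz⟩ : ∃ z, ι z = a := by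
    rcases h.right a with h1 | h1 | h1
    · exact absurd h1 hab
    · exact absurd h1 hac
    · exact ⟨_, h1⟩
  have hκz : κ z = c := by rw [hκ, if_pos hz]
  have hκ' : ∀ x, x ≠ z → κ x = ι x := fun x hx => by
    rw [hκ, if_neg]; rw [← hz, hinj]; exact hx
  have hpz := hσ.ne z
  have hp := hσ.inv
  have pa : (insert ι r b c σ).conn a = ι (σ.conn z) := by rw [← hz, insert_conn h]
  have pb : (insert ι r b c σ).conn b = c := insert_conn_a _ _ _ _ _
  have e1 : join a b (insert ι r b c σ).conn = (insert κ t a b σ).conn := by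
    refine k.ext_iff.2 ⟨?_, ?_, fun y => ?_⟩
    · simp [join, insert_conn_a]
    · simp [join, insert_conn_b _ _ hab, hab.symm]
    · rw [insert_conn k]
      simp only [join, pa, pb, k.ne_a, k.ne_b, if_false]
      by_cases hy : y = z
      · subst hy
        rw [hκz, if_neg (h.ne_b _).symm, if_pos rfl, hκ' _ hpz]
      · simp only [hκ' _ hy, hinj]
        by_cases hy2 : y = σ.conn z
        · rw [if_pos hy2, hy2, hp, hκz]
        · rw [if_neg hy2, if_neg (h.ne_b _), insert_conn h, hκ' _ (fun h' => hy2 (by rw [← h', hp]))]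
  refine Config.ext e1 ?_
  obtain ⟨p, _ | d⟩ := σ
  · rfl
  · have hd := hσ.dots d rfl
    have hra : r a = z := by rw [← hz, h.left]
    have nb := h.ne_a (p z)
    simp only at pa hpz hp hd
    simp only [close, pa]
    simp only [insert, Option.map_some, Option.bind_some, nb, false_and, if_false,
      Option.some.injEq]
    refine k.ext_iff.2 ⟨?_, ?_, fun y => ?_⟩
    · simp [joinDots]
    · simp [joinDots]
    · simp only [joinDots, k.ne_a, k.ne_b, or_self, if_false, k.left, hab, hac, hra,
        true_or, if_true, Bool.xor_false]
      by_cases hy : y = z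
      · subst hy
        simp [hκz, h.ne_b, hab.symm, hbc, hac.symm, hbc.symm]
      · rw [hκ' _ hy]
        have : ι y ≠ a := by rw [← hz, Ne, hinj]; exact hy
        simp only [h.ne_a, h.ne_b, h.left, if_false, if_true, or_self, hinj]
        by_cases hy2 : y = p z
        · simp [hy2, hd]
        · simp [hy2, h.ne_b]

theorem insert_insert {X' : Type} [DecidableEq X']
    {κ : X' → Y} {t : Y → X'} {c e : Y} {κ' : Z → X} {t' : X → Z} {c' e' : X}
    {κ'' : Z → X'} {t'' : X' → Z} {a'' b'' : X'}
    (h : IsGap ι r a b) (h' : IsGap κ' t' c' e') (k : IsGap κ t c e) (k' : IsGap κ'' t'' a'' b'')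
    (hc : ι c' = c) (he : ι e' = e) (ha : κ a'' = a) (hb : κ b'' = b)
    (hcomp : ∀ z, ι (κ' z) = κ (κ'' z)) (σ : Config Z) :
    insert ι r a b (insert κ' t' c' e' σ) = insert κ t c e (insert κ'' t'' a'' b'' σ) := by
  refine Config.ext ?_ ?_
  · refine h.ext_iff.2 ⟨?_, ?_, h'.forall_iff.2 ⟨?_, ?_, fun z => ?_⟩⟩
    · rw [insert_conn_a, ← ha, insert_conn k, insert_conn_a, hb]
    · rw [insert_conn_b _ _ h.ab, ← hb, insert_conn k, insert_conn_b _ _ k'.ab, ha]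
    · rw [insert_conn h, insert_conn_a, hc, he, insert_conn_a]
    · rw [insert_conn h, insert_conn_b _ _ h'.ab, hc, he, insert_conn_b _ _ k.ab]
    · rw [insert_conn h, insert_conn h', hcomp, hcomp, insert_conn k, insert_conn k']
  · obtain ⟨p, _ | d⟩ := σ
    · rfl
    · simp only [insert, Option.map_some, Option.some.injEq]
      refine h.ext_iff.2 ⟨?_, ?_, h'.forall_iff.2 ⟨?_, ?_, fun z => ?_⟩⟩
      · simp [← ha, k.left, k.ne_a, k.ne_b]
      · simp [← hb, k.left, k.ne_a, k.ne_b]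
      · simp only [h.left, h.ne_a, h.ne_b]
        simp [hc]
      · simp only [h.left, h.ne_a, h.ne_b]
        simp [he]
      · simp only [h.left, h.ne_a, h.ne_b, h'.left, h'.ne_a, h'.ne_b, or_self, if_false]
        rw [hcomp]
        simp [k.left, k.ne_a, k.ne_b, k'.left, k'.ne_a, k'.ne_b]

end
end Config
end TemperleyLieb

/-! ### Generators and innermost caps at the marked points of a strip. -/

namespace TemperleyLieb
namespace Config

theorem IsGap.symm {X Y : Type} {ι : X → Y} {r : Y → X} {a b : Y} (h : IsGap ι r a b) :
    IsGap ι r b a :=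
  ⟨h.left, fun y => by rcases h.right y with h | h | h <;> simp [h], h.ne_b, h.ne_a, h.ab.symm⟩

theorem insert_symm {X Y : Type} [DecidableEq Y] (ι : X → Y) (r : Y → X) {a b : Y} (hab : a ≠ b)
    (σ : Config X) : insert ι r a b σ = insert ι r b a σ := by
  refine Config.ext ?_ ?_
  · funext y; simp only [insert]; grind
  · simp only [insert, or_comm]

/-- The marked points of a diagram with `n + 1` strands. -/
abbrev Pt (n : ℕ) : Type := Fin (2 * (n + 1))

variable {n : ℕ}

/-- The undotted generator at position `i + 1`. -/
def closeAt (i : Fin (n + 1)) (σ : Config (Pt n)) : Config (Pt n) := close (footL i) (footR i) σ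

/-- Add an undotted innermost cap at position `i + 1`. -/
def insertAt (i : Fin (n + 2)) (σ : Config (Pt n)) : Config (Pt (n + 1)) :=
  insert (skip i) (unskip i) (footL i) (footR i) σ

/-- Toggle the dot on the strand through the left-most bottom point. -/
def toggle (σ : Config (Pt n)) : Config (Pt n) := flip (footL 0) σ

theorem footL_ne_footR (i : Fin (n + 1)) : footL i ≠ footR i := by
  simp only [footL, footR, ne_eq, Fin.mk.injEq]; omega

theorem isGap (i : Fin (n + 2)) : IsGap (skip i) (unskip i) (footL i) (footR i) := by
  refine ⟨fun x => ?_, fun y => ?_, fun x => ?_, fun x => ?_, footL_ne_footR i⟩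
  · simp only [skip, unskip, Fin.ext_iff]; have := x.2; have := i.2; grind
  · simp only [skip, unskip, footL, footR, Fin.ext_iff]; have := y.2; have := i.2; grind
  · simp only [skip, footL, ne_eq, Fin.mk.injEq]; have := x.2; have := i.2; grind
  · simp only [skip, footR, ne_eq, Fin.mk.injEq]; have := x.2; have := i.2; grind

theorem Wf.closeAt {σ : Config (Pt n)} (h : σ.Wf) (i : Fin (n + 1)) : (closeAt i σ).Wf :=
  h.close (footL_ne_footR i)

theorem Wf.toggle {σ : Config (Pt n)} (h : σ.Wf) : (toggle σ).Wf := h.flip _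

theorem Wf.insertAt {σ : Config (Pt n)} (h : σ.Wf) (i : Fin (n + 2)) : (insertAt i σ).Wf :=
  h.insert (isGap i)

theorem toggle_toggle (σ : Config (Pt n)) : toggle (toggle σ) = σ := flip_flip _ _

theorem skip_footL_lt {i : Fin (n + 2)} {j : Fin (n + 2)} {j' : Fin (n + 1)} (h : j.val + 2 ≤ i.val)
    (hj : j'.val = j.val) : skip i (footL j') = footL j ∧ skip i (footR j') = footR j := by
  simp only [skip, footL, footR, Fin.ext_iff]; have := i.2; grind

theorem skip_footL_gt {i : Fin (n + 2)} {j : Fin (n + 2)} {j' : Fin (n + 1)} (h : i.val + 2 ≤ j.val)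
    (hj : j'.val + 2 = j.val) : skip i (footL j') = footL j ∧ skip i (footR j') = footR j := by
  simp only [skip, footL, footR, Fin.ext_iff]; have := i.2; have := j.2; grind

theorem skip_footL_zero {i : Fin (n + 2)} (h : 1 ≤ i.val) :
    skip i (footL (0 : Fin (n + 1))) = footL 0 := by
  simp only [skip, footL, Fin.ext_iff]; have := i.2; grind

theorem closeAt_insertAt (i : Fin (n + 2)) (σ : Config (Pt n)) :
    closeAt i (insertAt i σ) = insertAt i σ := close_insert (isGap i) σ

theorem footR_eq_footL {i j : Fin (n + 1)} (h : j.val = i.val + 1) : footR i = footL j := by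
  simp only [footL, footR, Fin.ext_iff]; omega

theorem footL_ne_footR' {i j : Fin (n + 1)} (h : i.val < j.val) : footL i ≠ footR j := by
  simp only [footL, footR, ne_eq, Fin.ext_iff]; omega

theorem closeAt_insertAt_succ {i j : Fin (n + 2)} (h : j.val = i.val + 1) {σ : Config (Pt n)}
    (hσ : σ.Wf) : closeAt i (insertAt j σ) = insertAt i σ := by
  have hb := footR_eq_footL h
  unfold closeAt insertAt
  rw [← hb]
  refine close_insert_adj (hb ▸ isGap j) (isGap i) (footL_ne_footR' (by omega)) (fun x => ?_) hσ
  simp only [skip, footL, footR, Fin.ext_iff]; have := i.2; have := j.2; grind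

/-- The mirror image of `closeAt_insertAt_succ`: both closings and insertions are symmetric in the
two feet, so the same straightening lemma applies with the feet exchanged. -/
theorem closeAt_succ_insertAt {i j : Fin (n + 2)} (h : j.val = i.val + 1) {σ : Config (Pt n)}
    (hσ : σ.Wf) : closeAt j (insertAt i σ) = insertAt j σ := by
  have hb := footR_eq_footL h
  have hw := hσ.insertAt i
  unfold closeAt
  rw [close_symm hw]
  unfold insertAt
  rw [insert_symm _ _ (footL_ne_footR i), insert_symm _ _ (footL_ne_footR j), hb]
  refine close_insert_adj (hb ▸ (isGap i).symm) (isGap j).symm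
    (footL_ne_footR' (by omega)).symm (fun x => ?_) hσ
  simp only [skip, footL, footR, Fin.ext_iff]; have := i.2; have := j.2; grind

theorem closeAt_insertAt_lt {i j : Fin (n + 2)} {j' : Fin (n + 1)} (h : j.val + 2 ≤ i.val)
    (hj : j'.val = j.val) (σ : Config (Pt n)) :
    closeAt j (insertAt i σ) = insertAt i (closeAt j' σ) := by
  unfold closeAt
  rw [← (skip_footL_lt h hj).1, ← (skip_footL_lt h hj).2]
  exact close_insert_comm (isGap i) _ _ σ

theorem closeAt_insertAt_gt {i j : Fin (n + 2)} {j' : Fin (n + 1)} (h : i.val + 2 ≤ j.val)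
    (hj : j'.val + 2 = j.val) (σ : Config (Pt n)) :
    closeAt j (insertAt i σ) = insertAt i (closeAt j' σ) := by
  unfold closeAt
  rw [← (skip_footL_gt h hj).1, ← (skip_footL_gt h hj).2]
  exact close_insert_comm (isGap i) _ _ σ

theorem insertAt_insertAt {i j : Fin (n + 3)} {i' j' : Fin (n + 2)} (h : i.val + 2 ≤ j.val)
    (hi : i'.val = i.val) (hj : j'.val + 2 = j.val) (σ : Config (Pt n)) :
    insertAt i (insertAt j' σ) = insertAt j (insertAt i' σ) := by
  unfold insertAt
  refine insert_insert (isGap i) (isGap j') (isGap j) (isGap i') (skip_footL_gt h hj).1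
    (skip_footL_gt h hj).2 (skip_footL_lt h hi).1 (skip_footL_lt h hi).2 (fun z => ?_) σ
  simp only [skip, Fin.ext_iff]; have := i.2; have := j.2; have := z.2; grind

theorem toggle_insertAt {i : Fin (n + 2)} (h : 1 ≤ i.val) (σ : Config (Pt n)) :
    toggle (insertAt i σ) = insertAt i (toggle σ) := by
  unfold toggle
  rw [← skip_footL_zero h]
  exact flip_insert (isGap i) _ σ

/-- A generator at a position other than the first does not touch the left-most bottom point, so the
dot on the strand ending there can be toggled before or after. -/
theorem toggle_closeAt {i : Fin (n + 1)} (h : 1 ≤ i.val) {σ : Config (Pt n)} (hσ : σ.Wf) :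
    toggle (closeAt i σ) = closeAt i (toggle σ) := by
  refine flip_close ?_ ?_ (footL_ne_footR i) hσ
  · simp only [footL, ne_eq, Fin.ext_iff]; simp; omega
  · simp only [footL, footR, ne_eq, Fin.ext_iff]; simp; omega

/-- The position of the generator `E_s`, counted from `0`. -/
def pos (n s : ℕ) : Fin (n + 1) := ⟨min (s - 1) n, by omega⟩

theorem pos_val {s : ℕ} (h : s ≤ n + 1) : (pos n s).val = s - 1 := by simp [pos]; omega

theorem pos_zero : pos n 0 = 0 := by simp [pos]

theorem pos_one : pos n 1 = 0 := by simp [pos]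

/-- `E_s` put below a diagram. -/
def act (s : ℕ) (σ : Config (Pt n)) : Config (Pt n) :=
  if s = 0 then toggle (closeAt 0 (toggle σ)) else closeAt (pos n s) σ

/-- The connectivity and dots of `σ ⊔ 1` followed by `E_{n+1} ⋯ E_k`, where `k = 0` stands for
`E_{n+1} ⋯ E_2 E_0`. -/
def ins (k : ℕ) (σ : Config (Pt n)) : Config (Pt (n + 1)) :=
  if k = 0 then toggle (insertAt 0 (toggle σ)) else insertAt (pos (n + 1) k) σ

/-- `1` if a loop appears when `E_s` is put below the diagram, and `0` otherwise. -/
def loops (s : ℕ) (p : Conn n) : ℕ := if p (footL (pos n s)) = footR (pos n s) then 1 else 0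

theorem act_of_ne_zero {s : ℕ} (hs : s ≠ 0) (σ : Config (Pt n)) : act s σ = closeAt (pos n s) σ :=
  if_neg hs

/-- Together with `toggle_act`, this conjugation carries every relation for `E_1` to the
corresponding relation for `E_0`. -/
theorem act_zero (σ : Config (Pt n)) : act 0 σ = toggle (act 1 (toggle σ)) := by
  simp [act, pos_one]

theorem ins_of_ne_zero {s : ℕ} (hs : s ≠ 0) (σ : Config (Pt n)) :
    ins s σ = insertAt (pos (n + 1) s) σ := if_neg hs

theorem ins_zero (σ : Config (Pt n)) : ins 0 σ = toggle (ins 1 (toggle σ)) := by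
  simp [ins, pos_one]

theorem Wf.act {σ : Config (Pt n)} (h : σ.Wf) (s : ℕ) : (act s σ).Wf := by
  unfold Config.act; split_ifs
  · exact (h.toggle.closeAt _).toggle
  · exact h.closeAt _

theorem Wf.ins {σ : Config (Pt n)} (h : σ.Wf) (s : ℕ) : (ins s σ).Wf := by
  unfold Config.ins; split_ifs
  · exact (h.toggle.insertAt _).toggle
  · exact h.insertAt _

theorem toggle_act {s : ℕ} (hs : 2 ≤ s) (hn : s ≤ n) {σ : Config (Pt n)} (hσ : σ.Wf) :
    toggle (act s σ) = act s (toggle σ) := by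
  rw [act_of_ne_zero (by omega), act_of_ne_zero (by omega)]
  exact toggle_closeAt (by rw [pos_val (by omega)]; omega) hσ

theorem toggle_ins {k : ℕ} (hk : 2 ≤ k) (σ : Config (Pt n)) :
    toggle (ins k σ) = ins k (toggle σ) := by
  rw [ins_of_ne_zero (by omega), ins_of_ne_zero (by omega)]
  exact toggle_insertAt (by simp [pos]; omega) σ

theorem ins_injective (k : ℕ) : Function.Injective (ins k : Config (Pt n) → _) := by
  intro x y h
  unfold ins at h
  split_ifs at h
  · exact flip_injective _ (insert_injective (isGap _) (flip_injective _ h))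
  · exact insert_injective (isGap _) h

theorem act_ins_self {k : ℕ} (σ : Config (Pt n)) : act k (ins k σ) = ins k σ := by
  have key : ∀ (k : ℕ) (_ : k ≠ 0) (σ : Config (Pt n)), act k (ins k σ) = ins k σ := by
    intro k hk σ
    rw [act_of_ne_zero hk, ins_of_ne_zero hk, closeAt_insertAt]
  rcases Nat.eq_zero_or_pos k with rfl | hk
  · rw [act_zero, ins_zero, toggle_toggle, key 1 one_ne_zero]
  · exact key k (by omega) σ

theorem act_succ_ins {k : ℕ} (hk : 1 ≤ k) (hn : k ≤ n + 1) {σ : Config (Pt n)} (hσ : σ.Wf) :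
    act (k + 1) (ins k σ) = ins (k + 1) σ := by
  rw [act_of_ne_zero (by omega), ins_of_ne_zero (by omega), ins_of_ne_zero (by omega)]
  exact closeAt_succ_insertAt (by rw [pos_val (by omega), pos_val (by omega)]; omega) hσ

theorem act_two_ins_zero {σ : Config (Pt n)} (hn : 1 ≤ n) (hσ : σ.Wf) :
    act 2 (ins 0 σ) = ins 2 σ := by
  rw [ins_zero, ← toggle_act le_rfl (by omega) (hσ.toggle.ins 1),
    act_succ_ins le_rfl (by omega) hσ.toggle, toggle_ins le_rfl, toggle_toggle]

theorem act_ins_succ {k : ℕ} (hk : 1 ≤ k) (hn : k ≤ n + 1) {σ : Config (Pt n)} (hσ : σ.Wf) :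
    act k (ins (k + 1) σ) = ins k σ := by
  rw [act_of_ne_zero (by omega), ins_of_ne_zero (by omega), ins_of_ne_zero (by omega)]
  exact closeAt_insertAt_succ (by rw [pos_val (by omega), pos_val (by omega)]; omega) hσ

theorem act_zero_ins_two {σ : Config (Pt n)} (hσ : σ.Wf) : act 0 (ins 2 σ) = ins 0 σ := by
  rw [act_zero, toggle_ins le_rfl, act_ins_succ le_rfl (by omega) hσ.toggle, ← ins_zero]

/-- The inserted cap occupies two points to the left of the generator. Without it, positions drop by
two. -/
theorem act_ins_gt {k s : ℕ} (hk : 1 ≤ k) (hs : k ≤ s) (hn : s + 2 ≤ n + 1)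
    (σ : Config (Pt n)) : act (s + 2) (ins k σ) = ins k (act s σ) := by
  rw [act_of_ne_zero (by omega), ins_of_ne_zero (by omega), ins_of_ne_zero (by omega),
    act_of_ne_zero (by omega)]
  exact closeAt_insertAt_gt (by rw [pos_val (by omega), pos_val (by omega)]; omega)
    (by rw [pos_val (by omega), pos_val (by omega)]; omega) σ

theorem act_ins_zero_gt {s : ℕ} (hs : 2 ≤ s) (hn : s + 2 ≤ n + 1)
    {σ : Config (Pt n)} (hσ : σ.Wf) : act (s + 2) (ins 0 σ) = ins 0 (act s σ) := by
  rw [ins_zero, ← toggle_act (by omega) (by omega) (hσ.toggle.ins 1),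
    act_ins_gt le_rfl (by omega) hn, ins_zero, toggle_act hs (by omega) hσ]

/-- Below the cap, `E_3` acts on the smaller diagram as `E_1`. The inner toggle in `ins 0`
conjugates this into `E_0`. -/
theorem act_three_ins_zero (hn : 3 ≤ n + 1)
    {σ : Config (Pt n)} (hσ : σ.Wf) : act 3 (ins 0 σ) = ins 0 (act 0 σ) := by
  rw [ins_zero, ← toggle_act (by omega) (by omega) (hσ.toggle.ins 1),
    act_ins_gt le_rfl (by omega) hn, ins_zero, act_zero, toggle_toggle]

theorem act_ins_lt {k s : ℕ} (hs1 : 1 ≤ s) (hs : s + 2 ≤ k) (hn : k ≤ n + 2)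
    (σ : Config (Pt n)) : act s (ins k σ) = ins k (act s σ) := by
  rw [act_of_ne_zero (by omega), ins_of_ne_zero (by omega), ins_of_ne_zero (by omega),
    act_of_ne_zero (by omega)]
  exact closeAt_insertAt_lt (by rw [pos_val (by omega), pos_val (by omega)]; omega)
    (by rw [pos_val (by omega), pos_val (by omega)]) σ

theorem act_zero_ins {k : ℕ} (hk : 3 ≤ k) (hn : k ≤ n + 2) (σ : Config (Pt n)) :
    act 0 (ins k σ) = ins k (act 0 σ) := by
  rw [act_zero, toggle_ins (by omega), act_ins_lt le_rfl (by omega) hn, toggle_ins (by omega),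
    ← act_zero]

theorem ins_conn_congr (k : ℕ) {σ σ' : Config (Pt n)} (h : σ.conn = σ'.conn) :
    (ins k σ).conn = (ins k σ').conn := by
  unfold ins; split_ifs <;> simp [toggle, flip, insertAt, insert, h]

theorem ins_zero_conn (σ : Config (Pt n)) : (ins 0 σ).conn = (ins 1 σ).conn := by
  rw [ins_zero]; exact ins_conn_congr _ rfl

theorem act_conn_congr (s : ℕ) {σ σ' : Config (Pt n)} (h : σ.conn = σ'.conn) :
    (act s σ).conn = (act s σ').conn := by
  unfold act; split_ifs <;> simp [toggle, flip, closeAt, close, h]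

theorem act_zero_conn (σ : Config (Pt n)) : (act 0 σ).conn = (act 1 σ).conn := by
  rw [act_zero]; exact act_conn_congr _ rfl

theorem act_none (s : ℕ) (p : Conn n) : (act s ⟨p, none⟩).dots = none := by
  unfold act; split_ifs <;> rfl

theorem ins_none (s : ℕ) (p : Conn n) : (ins s ⟨p, none⟩).dots = none := by
  unfold ins; split_ifs <;> rfl

/-- The cap inserted by `ins 0` can be viewed as an undotted closing followed by a toggle, so the
undotted generator below it closes a loop with a single dot. -/
theorem act_one_ins_zero (σ : Config (Pt n)) :
    act 1 (ins 0 σ) = ⟨(ins 1 σ).conn, none⟩ := by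
  rw [ins_zero, ← act_ins_self (k := 1)]
  simp only [act_of_ne_zero one_ne_zero, closeAt, pos_one, toggle]
  rw [close_flip_close (footL_ne_footR _)]
  refine Config.ext ?_ rfl
  have := congrArg conn (act_ins_self (k := 1) (flip (footL 0) σ))
  simp only [act_of_ne_zero one_ne_zero, closeAt, pos_one, close_conn] at this
  rw [this]
  exact ins_conn_congr _ rfl

theorem act_zero_ins_one (σ : Config (Pt n)) :
    act 0 (ins 1 σ) = ⟨(ins 1 σ).conn, none⟩ := by
  have h := act_one_ins_zero (toggle σ)
  rw [ins_zero, toggle_toggle] at h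
  rw [act_zero, h]
  exact Config.ext (ins_conn_congr _ rfl) rfl

/-! ### Loops -/

theorem ins_conn (k : ℕ) (σ : Config (Pt n)) :
    (ins k σ).conn = (insertAt (pos (n + 1) k) σ).conn := by
  rcases Nat.eq_zero_or_pos k with rfl | hk
  · rw [ins_zero_conn, pos_zero, ← pos_one]; rfl
  · rw [ins_of_ne_zero (by omega)]

theorem loops_ins_of_pos {k s : ℕ} (h : pos (n + 1) k = pos (n + 1) s) (σ : Config (Pt n)) :
    loops s (ins k σ).conn = 1 := by
  rw [loops, ins_conn, h, insertAt, insert_conn_a, if_pos rfl]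

theorem loops_insertAt_of_skip {i j : Fin (n + 2)} {j' : Fin (n + 1)} (σ : Config (Pt n))
    (hs : skip i (footL j') = footL j ∧ skip i (footR j') = footR j) :
    (insertAt i σ).conn (footL j) = footR j ↔ σ.conn (footL j') = footR j' := by
  rw [← hs.1, ← hs.2]
  unfold insertAt
  rw [insert_conn (isGap i)]
  exact ⟨fun h => (isGap i).inj h, fun h => by rw [h]⟩

theorem loops_ins_gt {k s s' : ℕ} (h : (pos (n + 1) k).val + 2 ≤ (pos (n + 1) s).val)
    (h' : (pos n s').val + 2 = (pos (n + 1) s).val) (σ : Config (Pt n)) :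
    loops s (ins k σ).conn = loops s' σ.conn := by
  simp only [loops, ins_conn, loops_insertAt_of_skip σ (skip_footL_gt h h')]

theorem loops_ins_lt {k s s' : ℕ} (h : (pos (n + 1) s).val + 2 ≤ (pos (n + 1) k).val)
    (h' : (pos n s').val = (pos (n + 1) s).val) (σ : Config (Pt n)) :
    loops s (ins k σ).conn = loops s' σ.conn := by
  simp only [loops, ins_conn, loops_insertAt_of_skip σ (skip_footL_lt h h')]

theorem loops_ins_adj {k s : ℕ} (h : (pos (n + 1) s).val = (pos (n + 1) k).val + 1 ∨
    (pos (n + 1) k).val = (pos (n + 1) s).val + 1) (σ : Config (Pt n)) :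
    loops s (ins k σ).conn = 0 := by
  have hne := footL_ne_footR (pos (n + 1) k)
  rw [loops, ins_conn, if_neg]
  unfold insertAt
  rcases h with h | h
  · rw [← footR_eq_footL h, insert_conn_b _ _ hne]
    exact footL_ne_footR' (by omega)
  · rw [footR_eq_footL h]
    intro h'
    have hw : (insert (skip (pos (n + 1) k)) (unskip (pos (n + 1) k)) (footL (pos (n + 1) k))
      (footR (pos (n + 1) k)) σ).conn (footL (pos (n + 1) k)) = footR (pos (n + 1) k) :=
      insert_conn_a _ _ _ _ _
    obtain ⟨z, hz⟩ : ∃ z, skip (pos (n + 1) k) z = footL (pos (n + 1) s) := by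
      rcases (isGap (pos (n + 1) k)).right (footL (pos (n + 1) s)) with h1 | h1 | h1
      · simp only [footL, Fin.ext_iff] at h1; omega
      · simp only [footL, footR, Fin.ext_iff] at h1; omega
      · exact ⟨_, h1⟩
    rw [← hz, insert_conn (isGap _)] at h'
    exact (isGap _).ne_a _ h'

end Config
end TemperleyLieb

/-! ### Parity of dots, non-crossing matchings, and removal of an innermost cap. -/

namespace TemperleyLieb
namespace Config

section
set_option linter.unusedSectionVars false
variable {X Y : Type} [DecidableEq X] [DecidableEq Y]

/-- Remove the strand that joins `a` and `b`. -/
def restrict (ι : X → Y) (r : Y → X) (σ : Config Y) : Config X :=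
  ⟨fun x => r (σ.conn (ι x)), σ.dots.map fun d x => d (ι x)⟩

theorem insert_restrict {ι : X → Y} {r : Y → X} {a b : Y} (h : IsGap ι r a b) {σ : Config Y}
    (hσ : σ.Wf) (hab : σ.conn a = b) (hd : ∀ d, σ.dots = some d → d a = false) :
    insert ι r a b (restrict ι r σ) = σ := by
  obtain ⟨p, d⟩ := σ
  have hp := hσ.inv
  simp only at hab hp
  have hba : p b = a := by rw [← hab, hp]
  refine Config.ext ?_ ?_
  · refine h.ext_iff.2 ⟨?_, ?_, fun x => ?_⟩
    · rw [insert_conn_a]; exact hab.symm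
    · rw [insert_conn_b _ _ h.ab]; exact hba.symm
    · rw [insert_conn h]
      simp only [restrict]
      rcases h.right (p (ι x)) with h1 | h1 | h1
      · have := hp (ι x); rw [h1, hab] at this; exact absurd this.symm (h.ne_b _)
      · have := hp (ι x); rw [h1, hba] at this; exact absurd this.symm (h.ne_a _)
      · exact h1
  · cases d with
    | none => rfl
    | some d =>
      have hda := hd d rfl
      have hdb : d b = false := by rw [← hda, ← hab]; exact hσ.dots d rfl a
      simp only [insert, restrict, Option.map_some, Option.some.injEq]
      refine h.ext_iff.2 ⟨?_, ?_, fun x => ?_⟩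
      · simp [hda]
      · simp [hdb]
      · simp [h.ne_a, h.ne_b, h.left]

/-- The number of marked points whose strand has a dot. -/
def dotCount [Fintype X] (d : X → Bool) : ℕ := ∑ x, (d x).toNat

theorem sum_add_sum_eq [Fintype X] (f g : X → ℕ) (s : Finset X) (h : ∀ x, x ∉ s → f x = g x) :
    ∑ x, f x + ∑ x ∈ s, g x = ∑ x, g x + ∑ x ∈ s, f x := by
  rw [← Finset.sum_add_sum_compl s f, ← Finset.sum_add_sum_compl s g,
    Finset.sum_congr rfl (fun x hx => h x (Finset.mem_compl.1 hx))]
  ring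

/-- The dots after a generator with cup and cap at `a` and `b` is put below; `e` says whether the
generator has dots. -/
def joinDotsWith (e : Bool) (a b : X) (p : X → X) (d : X → Bool) : X → Bool := fun x =>
  if x = a ∨ x = b then e else if x = p a ∨ x = p b then (d a ^^ d b) ^^ e else d x

theorem joinDotsWith_false (a b : X) (p : X → X) (d : X → Bool) :
    joinDotsWith false a b p d = joinDots a b p d := by
  funext x; simp [joinDotsWith, joinDots]

/-- Each dotted strand is counted at both ends, so the count modulo 4 is the parity of the number of
dots. Joining two different strands preserves this parity. It changes only if a loop is deleted
whose dot differs from the dot of the cap that replaces it. -/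
theorem dotCount_joinDotsWith [Fintype X] (e : Bool) {a b : X} (hab : a ≠ b) {p : X → X}
    {d : X → Bool} (hp : ∀ x, p (p x) = x) (hf : ∀ x, p x ≠ x) (hd : ∀ x, d (p x) = d x) :
    dotCount (joinDotsWith e a b p d) % 4 =
      if p a = b ∧ d a ≠ e then (dotCount d + 2) % 4 else dotCount d % 4 := by
  have hda := hd a
  have hdb := hd b
  have hfa := hf a
  have hfb := hf b
  have key := sum_add_sum_eq (fun x => (joinDotsWith e a b p d x).toNat) (fun x => (d x).toNat)
    {a, b, p a, p b} (fun x hx => by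
      simp only [Finset.mem_insert, Finset.mem_singleton, not_or] at hx
      simp [joinDotsWith, hx])
  change dotCount _ + _ = dotCount _ + _ at key
  by_cases h : p a = b
  · have h' : p b = a := by rw [← h, hp]
    have hs : ({a, b, p a, p b} : Finset X) = {a, b} := by
      rw [h, h']; ext; simp; tauto
    have hdab : d a = d b := by rw [← h, hd]
    rw [hs, Finset.sum_pair hab, Finset.sum_pair hab] at key
    simp only [joinDotsWith, true_or, or_true, if_true, hdab] at key
    simp only [h, hdab]
    revert key
    cases d b <;> cases e <;> simp <;> omega
  · have h1 : p a ≠ p b := fun h' => hab (by rw [← hp a, h', hp])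
    have h2 : a ≠ p b := fun h' => h (by rw [h', hp])
    have h3 : b ≠ p a := fun h' => h h'.symm
    rw [Finset.sum_insert (by simp [hab, h2, hfa.symm]), Finset.sum_insert (by simp [h3, hfb.symm]),
      Finset.sum_pair h1, Finset.sum_insert (by simp [hab, h2, hfa.symm]),
      Finset.sum_insert (by simp [h3, hfb.symm]), Finset.sum_pair h1] at key
    simp only [joinDotsWith, true_or, or_true, if_true, hda, hdb, hfa, hfb, h3.symm, h2.symm,
      or_self, if_false] at key
    simp only [h, false_and, if_false]
    revert key
    cases d a <;> cases d b <;> cases e <;> simp <;> omega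

theorem dotCount_flip [Fintype X] {a : X} {p : X → X} {d : X → Bool} (hf : ∀ x, p x ≠ x)
    (hd : ∀ x, d (p x) = d x) :
    dotCount (fun x => d x ^^ decide (x = a ∨ x = p a)) % 4 = (dotCount d + 2) % 4 := by
  have key := sum_add_sum_eq (fun x => (d x ^^ decide (x = a ∨ x = p a)).toNat)
    (fun x => (d x).toNat) {a, p a} (fun x hx => by
      simp only [Finset.mem_insert, Finset.mem_singleton, not_or] at hx
      simp [hx])
  change dotCount _ + _ = dotCount _ + _ at key
  rw [Finset.sum_pair (hf a).symm, Finset.sum_pair (hf a).symm] at key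
  simp only [hd a, true_or, or_true, decide_true] at key
  revert key
  cases d a <;> simp <;> omega

theorem dotCount_insert [Fintype X] [Fintype Y] {ι : X → Y} {r : Y → X} {a b : Y}
    (h : IsGap ι r a b) (d : X → Bool) :
    dotCount (fun y => if y = a ∨ y = b then false else d (r y)) = dotCount d := by
  unfold dotCount
  rw [← Finset.sum_image (s := Finset.univ) (g := ι)
    (f := fun y => (if y = a ∨ y = b then false else d (r y)).toNat)
    (fun x _ y _ hxy => h.inj hxy) |>.trans (Finset.sum_congr rfl fun x _ => by
      simp [h.ne_a, h.ne_b, h.left])]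
  symm
  refine Finset.sum_subset (Finset.subset_univ _) fun y _ hy => ?_
  rcases h.right y with h1 | h1 | h1
  · simp [h1]
  · simp [h1]
  · exact absurd (Finset.mem_image.2 ⟨r y, Finset.mem_univ _, h1⟩) hy

/-- Twice the number of strands with a dot is congruent to `m` modulo `4`. -/
def DotsMod [Fintype X] (m : ℕ) (σ : Config X) : Prop :=
  ∀ d, σ.dots = some d → dotCount d % 4 = m % 4

theorem DotsMod.close [Fintype X] {m : ℕ} {σ : Config X} (hm : DotsMod m σ) (hσ : σ.Wf) {a b : X}
    (hab : a ≠ b) : DotsMod m (close a b σ) := by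
  obtain ⟨p, _ | d'⟩ := σ
  · intro d hd; simp [close_none] at hd
  · intro d hd
    rw [close_some] at hd
    simp only at hd
    split_ifs at hd with h
    cases hd
    rw [← joinDotsWith_false, dotCount_joinDotsWith _ hab hσ.inv hσ.ne (hσ.dots _ rfl), if_neg,
      hm _ rfl]
    simpa using h

theorem DotsMod.flip [Fintype X] {m : ℕ} {σ : Config X} (hm : DotsMod m σ) (hσ : σ.Wf) (a : X) :
    DotsMod (m + 2) (flip a σ) := by
  obtain ⟨p, _ | d'⟩ := σ
  · intro d hd; simp [flip_none] at hd
  · intro d hd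
    cases hd
    rw [dotCount_flip hσ.ne (hσ.dots _ rfl)]
    have := hm _ rfl
    omega

theorem DotsMod.of_flip [Fintype X] {m : ℕ} {σ : Config X} {a : X}
    (hm : DotsMod m (Config.flip a σ))
    (hσ : σ.Wf) : DotsMod (m + 2) σ := by
  have := hm.flip (hσ.flip a) a
  rwa [flip_flip] at this

theorem DotsMod.of_insert [Fintype X] [Fintype Y] {ι : X → Y} {r : Y → X} {a b : Y}
    (h : IsGap ι r a b) {m : ℕ} {σ : Config X} (hm : DotsMod m (insert ι r a b σ)) :
    DotsMod m σ := by
  obtain ⟨p, _ | d'⟩ := σ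
  · intro d hd; simp at hd
  · intro d hd
    cases hd
    rw [← hm _ rfl, dotCount_insert h]

theorem DotsMod.mod {m m' : ℕ} [Fintype X] {σ : Config X} (hm : DotsMod m σ) (h : m % 4 = m' % 4) :
    DotsMod m' σ := fun d hd => (hm d hd).trans h
end

variable {n : ℕ}

theorem DotsMod.act {m : ℕ} {σ : Config (Pt n)} (hm : DotsMod m σ) (hσ : σ.Wf) (s : ℕ) :
    DotsMod m (act s σ) := by
  unfold Config.act
  split_ifs
  · have h1 := hm.flip hσ (footL 0)
    have h2 := h1.close (hσ.flip _) (footL_ne_footR 0)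
    have h3 := h2.flip ((hσ.flip _).closeAt 0) (footL 0)
    exact h3.mod (by omega)
  · exact hm.close hσ (footL_ne_footR _)

theorem DotsMod.of_ins {m : ℕ} {k : ℕ} {σ : Config (Pt n)} (hσ : σ.Wf) (hm : DotsMod m (ins k σ)) :
    DotsMod m σ := by
  unfold Config.ins at hm
  split_ifs at hm
  · have h2 := hm.of_flip (hσ.toggle.insertAt 0)
    have h3 := DotsMod.of_flip (DotsMod.of_insert (isGap _) h2) hσ
    exact h3.mod (by omega)
  · exact DotsMod.of_insert (isGap _) hm

/-! ### Diagrams of type `D` -/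

/-- No strand encloses the strand through `x`. -/
def Outer (p : Conn n) (x : Pt n) : Prop :=
  ∀ y, ¬ (y < x ∧ x < p y ∧ y < p x ∧ p x < p y)

/-- The matching is non-crossing and only strands that are not enclosed by others have dots. -/
structure Valid (σ : Config (Pt n)) : Prop where
  isTL : IsTLDiagram σ.conn
  sym : ∀ d, σ.dots = some d → ∀ x, d (σ.conn x) = d x
  outer : ∀ d, σ.dots = some d → ∀ x, d x = true → Outer σ.conn x

theorem Valid.wf {σ : Config (Pt n)} (h : σ.Valid) : σ.Wf := ⟨h.isTL.1, h.isTL.2.1, h.sym⟩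

theorem valid_none {p : Conn n} (h : IsTLDiagram p) : Valid ⟨p, none⟩ :=
  ⟨h, fun _ h => by simp at h, fun _ h => by simp at h⟩

theorem skip_lt_skip (i : Fin (n + 2)) {x y : Pt n} : skip i x < skip i y ↔ x < y := by
  simp only [skip, Fin.lt_def]; grind

/-- The left-most bottom point is the last marked point along the boundary, so no strand can reach
beyond it. -/
theorem outer_footL_zero {p : Conn n} (hp : ∀ x, p (p x) = x) (x : Pt n)
    (hx : x = footL 0 ∨ x = p (footL 0)) : Outer p x := by
  intro y hy
  have h1 := (p y).2
  rcases hx with rfl | rfl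
  · simp only [footL, Fin.lt_def] at hy
    simp at hy; omega
  · rw [hp] at hy
    simp only [footL, Fin.lt_def] at hy
    simp at hy; omega

theorem Valid.toggle {σ : Config (Pt n)} (h : σ.Valid) : (toggle σ).Valid := by
  refine ⟨h.isTL, h.wf.toggle.dots, fun d hd x hx => ?_⟩
  obtain ⟨p, _ | d'⟩ := σ
  · simp [Config.toggle, flip_none] at hd
  · simp only [Config.toggle, flip_some, Option.some.injEq] at hd
    subst hd
    by_cases h1 : x = footL 0 ∨ x = p (footL 0)
    · exact outer_footL_zero h.isTL.1 x h1
    · simp only [h1, decide_false, Bool.xor_false] at hx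
      exact h.outer _ rfl x hx

theorem Valid.of_insertAt {i : Fin (n + 2)} {σ : Config (Pt n)} (h : (insertAt i σ).Valid) :
    σ.Valid := by
  have g := isGap i
  have hc : ∀ x, (insertAt i σ).conn (skip i x) = skip i (σ.conn x) := insert_conn g σ
  refine ⟨⟨fun x => ?_, fun x hx => ?_, fun x y hxy => ?_⟩, fun d hd x => ?_, fun d hd x hx y hy => ?_⟩
  · have := h.isTL.1 (skip i x)
    rw [hc, hc] at this
    exact g.inj this
  · exact h.isTL.2.1 (skip i x) (by rw [hc, hx])
  · refine h.isTL.2.2 (skip i x) (skip i y) ?_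
    simpa only [hc, skip_lt_skip] using hxy
  · obtain ⟨p, _ | d'⟩ := σ
    · simp at hd
    · cases hd
      have := h.sym _ rfl (skip i x)
      rw [hc] at this
      simpa [g.ne_a, g.ne_b, g.left] using this
  · obtain ⟨p, _ | d'⟩ := σ
    · simp at hd
    · cases hd
      refine h.outer _ rfl (skip i x) (by simpa [g.ne_a, g.ne_b, g.left] using hx) (skip i y) ?_
      simpa only [hc, skip_lt_skip] using hy

/-- `z` lies strictly between `u` and `v`. -/
def Btw (u v z : Pt n) : Prop :=
  (u.val < z.val ∧ z.val < v.val) ∨ (v.val < z.val ∧ z.val < u.val)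

/-- Non-crossing in symmetric form: both ends of a strand lie on the same side of any other strand.
No assumption is made on which end of a strand comes first. -/
theorem _root_.TemperleyLieb.IsTLDiagram.btw_iff {p : Conn n} (hp : IsTLDiagram p) {x y : Pt n}
    (h1 : y ≠ x) (h2 : y ≠ p x) : Btw x (p x) y ↔ Btw x (p x) (p y) := by
  obtain ⟨hi, -, hc⟩ := hp
  have h3 : p y ≠ x := fun h => h2 (by rw [← h, hi])
  have h4 : p y ≠ p x := fun h => h1 (by rw [← hi y, h, hi])
  have := hc x y; have := hc y x; have := hc x (p y); have := hc (p y) x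
  have := hc (p x) y; have := hc y (p x); have := hc (p x) (p y); have := hc (p y) (p x)
  simp only [hi, Fin.lt_def, ne_eq, Fin.ext_iff, Btw] at *
  omega

theorem isTL_of_btw {p : Conn n} (hi : ∀ x, p (p x) = x) (hf : ∀ x, p x ≠ x)
    (h : ∀ x y, y ≠ x → y ≠ p x → Btw x (p x) y → Btw x (p x) (p y)) : IsTLDiagram p := by
  refine ⟨hi, hf, fun x y hxy => ?_⟩
  have := h x y (by rintro rfl; omega) (by rintro rfl; omega)
  simp only [Btw, Fin.lt_def] at *
  omega

/-- Without crossings a strand is enclosed as soon as one of its ends is. -/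
theorem _root_.TemperleyLieb.IsTLDiagram.outer_iff {p : Conn n} (hp : IsTLDiagram p) {x : Pt n} :
    Outer p x ↔ ∀ y, ¬ Btw y (p y) x := by
  constructor
  · intro h y hy
    have h1 : x ≠ y := by rintro rfl; simp only [Btw] at hy; omega
    have h2 : x ≠ p y := by rintro rfl; simp only [Btw] at hy; omega
    have h3 := (hp.btw_iff h1 h2).1 hy
    have h4 := h y
    have h5 := h (p y)
    simp only [hp.1, Btw, Fin.lt_def] at *
    omega
  · intro h y hy
    have := h y
    simp only [Btw, Fin.lt_def] at *
    omega

/-- As `a` and `b` are consecutive, a strand ending at neither of them has both on the same side.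
Hence the far ends of the strands through `a` and `b` are also on one side of it and can be
reconnected without a crossing. -/
theorem join_isTL {a b : Pt n} (hab : b.val + 1 = a.val) {p : Conn n} (hp : IsTLDiagram p) :
    IsTLDiagram (join a b p) := by
  have hne : a ≠ b := fun h => by rw [h] at hab; omega
  have hi := hp.1
  refine isTL_of_btw (join_inv hne hp.1 hp.2.1) (join_ne hne hp.1 hp.2.1) fun x y h1 h2 h => ?_
  have hj : ∀ z, join a b p z = if z = a then b else if z = b then a else if z = p a then p b
    else if z = p b then p a else p z := fun _ => rfl
  by_cases hxa : x = a
  · rw [hj, if_pos hxa, hxa] at h; simp only [Btw] at h; omega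
  by_cases hxb : x = b
  · rw [hj, if_neg hxa, if_pos hxb, hxb] at h; simp only [Btw] at h; omega
  have hx : ∀ (_ : x ≠ p a) (_ : x ≠ p b), join a b p x = p x := fun h1 h2 => by
    rw [hj, if_neg hxa, if_neg hxb, if_neg h1, if_neg h2]
  by_cases hya : y = a
  · have : join a b p y = b := by rw [hj, if_pos hya]
    rw [this]
    rw [hya] at h h1 h2
    clear hi hx hj
    have h3 : b ≠ join a b p x := fun h' => hxa <| by
      rw [← join_inv hne hp.1 hp.2.1 x, ← h']; simp [join, hne.symm]
    clear hp this
    generalize join a b p x = w at *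
    simp only [Btw, ne_eq, Fin.ext_iff] at *; omega
  by_cases hyb : y = b
  · have : join a b p y = a := by rw [hj, if_neg hya, if_pos hyb]
    rw [this]
    rw [hyb] at h h1 h2
    clear hi hx hj
    have h3 : a ≠ join a b p x := fun h' => hxb <| by
      rw [← join_inv hne hp.1 hp.2.1 x, ← h', join_left]
    clear hp this
    generalize join a b p x = w at *
    simp only [Btw, ne_eq, Fin.ext_iff] at *; omega
  have nax := fun (h1 : x ≠ p a) => hp.btw_iff (x := x) (y := a) (Ne.symm hxa)
    (fun h' => h1 (by rw [h', hi]))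
  have nbx := fun (h1 : x ≠ p b) => hp.btw_iff (x := x) (y := b) (Ne.symm hxb)
    (fun h' => h1 (by rw [h', hi]))
  have nay := fun (h1 : y ≠ p a) => hp.btw_iff (x := a) (y := y) hya h1
  have nby := fun (h1 : y ≠ p b) => hp.btw_iff (x := b) (y := y) hyb h1
  by_cases hxpa : x = p a
  · have e : join a b p x = p b := by rw [hj, if_neg hxa, if_neg hxb, if_pos hxpa]
    rw [e] at h h2 ⊢
    have hypa : y ≠ p a := fun h' => h1 (h'.trans hxpa.symm)
    rw [hj, if_neg hya, if_neg hyb, if_neg hypa, if_neg h2]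
    have k1 := nay hypa
    have k2 := nby h2
    have k3 : p y ≠ a := fun h' => hypa (by rw [← h', hi])
    have k4 : p y ≠ b := fun h' => h2 (by rw [← h', hi])
    have k5 : p y ≠ p a := fun h' => hya (by rw [← hi y, h', hi])
    have k6 : p y ≠ p b := fun h' => hyb (by rw [← hi y, h', hi])
    subst hxpa
    clear nax nbx nay nby hi hj hx e
    simp only [Btw, ne_eq, Fin.ext_iff] at *
    omega
  by_cases hxpb : x = p b
  · have e : join a b p x = p a := by rw [hj, if_neg hxa, if_neg hxb, if_neg hxpa, if_pos hxpb]
    rw [e] at h h2 ⊢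
    have hypb : y ≠ p b := fun h' => h1 (h'.trans hxpb.symm)
    rw [hj, if_neg hya, if_neg hyb, if_neg h2, if_neg hypb]
    have k1 := nay h2
    have k2 := nby hypb
    have k3 : p y ≠ a := fun h' => h2 (by rw [← h', hi])
    have k4 : p y ≠ b := fun h' => hypb (by rw [← h', hi])
    have k5 : p y ≠ p a := fun h' => hya (by rw [← hi y, h', hi])
    have k6 : p y ≠ p b := fun h' => hyb (by rw [← hi y, h', hi])
    subst hxpb
    clear nax nbx nay nby hi hj hx e
    simp only [Btw, ne_eq, Fin.ext_iff] at *
    omega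
  have e := hx hxpa hxpb
  rw [e] at h h2 ⊢
  have m1 := nax hxpa
  have m2 := nbx hxpb
  have m3 := hp.btw_iff h1 h2
  have k1 : p x ≠ a := fun h' => hxpa (by rw [← h', hi])
  have k2 : p x ≠ b := fun h' => hxpb (by rw [← h', hi])
  -- A strand that avoids the neighbours `a` and `b` cannot separate them.
  have m4 : Btw x (p x) a ↔ Btw x (p x) b := by
    clear nax nbx nay nby hi hj hx e m1 m2 m3 h hp
    simp only [Btw, ne_eq, Fin.ext_iff] at *; omega
  rw [hj, if_neg hya, if_neg hyb]
  split_ifs with hypa hypb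
  · rw [hypa] at h; exact m2.1 (m4.1 (m1.2 h))
  · rw [hypb] at h; exact m1.1 (m4.2 (m2.2 h))
  · exact m3.1 h

theorem footR_val_succ (i : Fin (n + 1)) : (footR i).val + 1 = (footL i).val := by
  simp only [footR, footL]; omega

/-- If the reconnected strand has a dot, then one of the two strands that form it had a dot and was
not enclosed. A strand enclosing the new one would enclose the neighbours `a` and `b`, hence also
the dotted one of these two. -/
theorem Valid.closeAt {σ : Config (Pt n)} (h : σ.Valid) (i : Fin (n + 1)) : (closeAt i σ).Valid := by
  have hab := footR_val_succ i
  have hne := footL_ne_footR i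
  have hT := join_isTL hab h.isTL
  refine ⟨hT, (h.wf.closeAt i).dots, fun d hd x hx => ?_⟩
  unfold Config.closeAt at hd
  refine hT.outer_iff.2 ?_
  intro y
  obtain ⟨p, _ | d'⟩ := σ
  · simp [close_none] at hd
  rw [close_some] at hd
  simp only at hd hT
  split_ifs at hd with hl
  cases hd
  have hp := h.isTL
  have hi := hp.1
  have ho : ∀ x, d' x = true → ∀ y, ¬ Btw y (p y) x := fun x hx => hp.outer_iff.1 (h.outer _ rfl x hx)
  have hs := h.sym _ rfl
  simp only at hp hi hs
  change ¬ Btw y (join (footL i) (footR i) p y) x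
  generalize footL i = a at *
  generalize footR i = b at *
  have hj : ∀ z, join a b p z = if z = a then b else if z = b then a else if z = p a then p b
    else if z = p b then p a else p z := fun _ => rfl
  have hxa : x ≠ a := by rintro rfl; simp [joinDots] at hx
  have hxb : x ≠ b := by rintro rfl; simp [joinDots] at hx
  by_cases hya : y = a
  · rw [hj, if_pos hya, hya]; simp only [Btw]; omega
  by_cases hyb : y = b
  · rw [hj, if_neg hya, if_pos hyb, hyb]; simp only [Btw]; omega
  simp only [joinDots, hxa, hxb, or_self, if_false] at hx
  by_cases hxp : x = p a ∨ x = p b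
  · simp only [hxp, if_true] at hx
    by_cases hypa : y = p a
    · rw [hj, if_neg hya, if_neg hyb, if_pos hypa, hypa]
      rcases hxp with rfl | rfl <;> simp only [Btw] <;> omega
    by_cases hypb : y = p b
    · rw [hj, if_neg hya, if_neg hyb, if_neg hypa, if_pos hypb, hypb]
      rcases hxp with rfl | rfl <;> simp only [Btw] <;> omega
    rw [hj, if_neg hya, if_neg hyb, if_neg hypa, if_neg hypb]
    have m1 := hp.btw_iff (x := y) (y := a) (Ne.symm hya) (fun h' => hypa (by rw [h', hi]))
    have m2 := hp.btw_iff (x := y) (y := b) (Ne.symm hyb) (fun h' => hypb (by rw [h', hi]))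
    -- An odd sum of dots means that the strand through `a` or the one through `b` is dotted, and
    -- dotted strands are not enclosed.
    have m3 : ¬ Btw y (p y) a ∨ ¬ Btw y (p y) b := by
      by_cases hda : d' a = true
      · exact Or.inl (ho a hda y)
      · refine Or.inr (ho b ?_ y)
        simpa [hda] using hx
    have m4 : Btw y (p y) a ↔ Btw y (p y) b := by
      have k3 : p y ≠ a := fun h' => hypa (by rw [← h', hi])
      have k4 : p y ≠ b := fun h' => hypb (by rw [← h', hi])
      clear hi ho hs hp hj
      simp only [Btw, ne_eq, Fin.ext_iff] at *; omega
    rcases hxp with rfl | rfl <;> tauto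
  · simp only [hxp, if_false] at hx
    have k1 := ho x hx a
    have k2 := ho x hx b
    have k3 := ho x hx y
    rw [not_or] at hxp
    rw [hj, if_neg hya, if_neg hyb]
    obtain ⟨k4, k5⟩ := hxp
    clear hi ho hs hp hj
    split_ifs with h1 h1
    · subst h1
      simp only [Btw, ne_eq, Fin.ext_iff] at *; omega
    · subst h1
      simp only [Btw, ne_eq, Fin.ext_iff] at *; omega
    · exact k3

theorem Valid.act {σ : Config (Pt n)} (h : σ.Valid) (s : ℕ) : (act s σ).Valid := by
  unfold Config.act
  split_ifs
  · exact (h.toggle.closeAt 0).toggle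
  · exact h.closeAt _

/-! ### Decomposition of a diagram -/

/-- The strand that starts at the point after `x` lies inside the strand from `x` to `p x` and is
shorter; induction on the length ends at two consecutive points. -/
theorem exists_innermost {p : Conn n} (hp : IsTLDiagram p) (x : Pt n) (hx : x < p x) :
    ∃ y : Pt n, x ≤ y ∧ y < p x ∧ (p y).val = y.val + 1 := by
  obtain ⟨m, hm⟩ : ∃ m, m = (p x).val - x.val := ⟨_, rfl⟩
  induction m using Nat.strong_induction_on generalizing x with
  | _ m ih =>
    by_cases h : (p x).val = x.val + 1
    · exact ⟨x, le_rfl, hx, h⟩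
    · have h1 : x.val + 1 < 2 * (n + 1) := by have := (p x).2; rw [Fin.lt_def] at hx; omega
      obtain ⟨z, hz⟩ : ∃ z : Pt n, z.val = x.val + 1 := ⟨⟨_, h1⟩, rfl⟩
      have hzx : z ≠ x := fun h => by rw [h] at hz; omega
      have hzp : z ≠ p x := fun h' => h (by rw [← h', hz])
      have h2 := hp.btw_iff hzx hzp
      have hzz := hp.2.1 z
      have hpx : p z ≠ x := fun h' => hzp (by rw [← h', hp.1])
      obtain ⟨y, hy1, hy2, hy3⟩ := ih ((p z).val - z.val)
        (by simp only [Btw, ne_eq, Fin.ext_iff, Fin.lt_def] at *; omega) z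
        (by simp only [Btw, ne_eq, Fin.ext_iff, Fin.lt_def] at *; omega) rfl
      refine ⟨y, ?_, ?_, hy3⟩ <;>
        simp only [Btw, ne_eq, Fin.ext_iff, Fin.lt_def, Fin.le_def] at * <;> omega

/-- In a diagram with at least two strands, the left-most bottom strand is an innermost cap or it
encloses an innermost cap of the shape `I(C)`. -/
theorem exists_position {p : Conn (n + 1)} (hp : IsTLDiagram p) :
    p (footL 0) = footR 0 ∨ ∃ i : Fin (n + 2), p (footL i) = footR i ∧ ¬ Outer p (footL i) := by
  by_cases h0 : p (footL 0) = footR 0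
  · exact Or.inl h0
  right
  obtain ⟨z, hz⟩ : ∃ z, z = p (footL 0) := ⟨_, rfl⟩
  have hpz : p z = footL 0 := by rw [hz, hp.1]
  have hl : (footL (0 : Fin (n + 2))).val = 2 * n + 3 := by simp [footL]; ring
  have hr : (footR (0 : Fin (n + 2))).val = 2 * n + 2 := by simp [footR]; ring
  have hz1 : z.val < 2 * n + 2 := by
    have := z.2
    have h1 : z ≠ footR 0 := fun h => h0 (by rw [← hz, h])
    have h2 : z ≠ footL 0 := fun h => hp.2.1 (footL 0) (by rw [← hz, h])
    simp only [ne_eq, Fin.ext_iff] at h1 h2; omega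
  have hin : ∀ y : Pt (n + 1), z.val < y.val → y.val < 2 * n + 3 →
      z.val < (p y).val ∧ (p y).val < 2 * n + 3 := by
    intro y h1 h2
    have hne1 : y ≠ z := fun h => by rw [h] at h1; omega
    have hne2 : y ≠ p z := fun h => by rw [hpz] at h; rw [h] at h2; omega
    have := hp.btw_iff hne1 hne2
    rw [hpz] at this
    simp only [Btw, hl] at this
    omega
  -- The lower bound on `y` makes the strand a cap at the bottom or the right-most vertical strand,
  -- and the upper bound keeps it strictly inside the strand from `z` to the left-most bottom point.
  have key : ∃ y : Pt (n + 1), z.val < y.val ∧ n + 1 ≤ y.val ∧ y.val < 2 * n + 2 ∧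
      (p y).val = y.val + 1 := by
    suffices ∃ x : Pt (n + 1), z < x ∧ n + 1 ≤ x.val ∧ x < p x ∧ (p x).val < 2 * n + 3 by
      obtain ⟨x, h1, h2, h3, h4⟩ := this
      obtain ⟨y, h5, h6, h7⟩ := exists_innermost hp x h3
      simp only [Fin.lt_def, Fin.le_def] at *
      exact ⟨y, by omega, by omega, by omega, h7⟩
    by_contra hcon
    push Not at hcon
    -- A counting argument. If there were no such strand, all bottom points enclosed by the strand
    -- from `z` would be joined to enclosed top points other than the right-most one, and there are
    -- too few of these.
    let s : Finset (Pt (n + 1)) := Finset.univ.filter fun x => n + 2 ≤ x.val ∧ x.val < 2 * n + 3 ∧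
      z < x
    let t : Finset (Pt (n + 1)) := Finset.univ.filter fun x => x.val < n + 1 ∧ z < x
    have hmap : ∀ x ∈ s, p x ∈ t := by
      intro x hx
      simp only [s, t, Finset.mem_filter, Finset.mem_univ, true_and, Fin.lt_def] at hx ⊢
      obtain ⟨h1, h2, h3⟩ := hx
      obtain ⟨h4, h5⟩ := hin x h3 h2
      refine ⟨?_, h4⟩
      by_contra h6
      have hne := hp.2.1 x
      have c1 := hcon x (Fin.lt_def.2 h3) (by omega)
      have c2 := hcon (p x) (Fin.lt_def.2 h4) (by omega)
      rw [hp.1] at c2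
      simp only [Fin.lt_def, ne_eq, Fin.ext_iff] at c1 c2 hne
      omega
    have hcard := Finset.card_le_card_of_injOn p hmap
      (fun x _ y _ h => by rw [← hp.1 x, h, hp.1])
    have hs : s.card = min (n + 1) (2 * n + 2 - z.val) := by
      rw [← Finset.card_map Fin.valEmbedding]
      have : s.map Fin.valEmbedding = Finset.Ico (max (n + 2) (z.val + 1)) (2 * n + 3) := by
        ext m
        simp only [s, Finset.mem_map, Finset.mem_filter, Finset.mem_univ, true_and,
          Fin.valEmbedding_apply, Finset.mem_Ico, Fin.lt_def]
        constructor
        · rintro ⟨x, hx, rfl⟩; omega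
        · intro h; exact ⟨⟨m, by omega⟩, by simp only; omega, rfl⟩
      rw [this, Nat.card_Ico]; omega
    have ht : t.card = n - z.val := by
      rw [← Finset.card_map Fin.valEmbedding]
      have : t.map Fin.valEmbedding = Finset.Ico (z.val + 1) (n + 1) := by
        ext m
        simp only [t, Finset.mem_map, Finset.mem_filter, Finset.mem_univ, true_and,
          Fin.valEmbedding_apply, Finset.mem_Ico, Fin.lt_def]
        constructor
        · rintro ⟨x, hx, rfl⟩; omega
        · intro h; exact ⟨⟨m, by omega⟩, by simp only; omega, rfl⟩
      rw [this, Nat.card_Ico]; omega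
    omega
  obtain ⟨y, h1, h2, h3, h4⟩ := key
  let i : Fin (n + 2) := ⟨2 * n + 2 - y.val, by omega⟩
  have hi1 : footR i = y := by simp only [footR, i, Fin.ext_iff]; omega
  have hi2 : footL i = p y := by simp only [footL, i, Fin.ext_iff]; omega
  refine ⟨i, by rw [hi1, hi2, hp.1], fun h => ?_⟩
  refine hp.outer_iff.1 h z ?_
  rw [hpz, hi2]
  simp only [Btw, hl]; omega

/-- Remove the innermost cap at position `i + 1`. -/
def removeAt (i : Fin (n + 2)) (σ : Config (Pt (n + 1))) : Config (Pt n) :=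
  restrict (skip i) (unskip i) σ

theorem insertAt_removeAt {i : Fin (n + 2)} {σ : Config (Pt (n + 1))} (hσ : σ.Wf)
    (hi : σ.conn (footL i) = footR i) (hd : ∀ d, σ.dots = some d → d (footL i) = false) :
    insertAt i (removeAt i σ) = σ := insert_restrict (isGap i) hσ hi hd

theorem pos_succ (i : Fin (n + 1)) : pos n (i.val + 1) = i := by
  simp only [pos, Fin.ext_iff]; omega

/-- Either there is a cap at the first position, which is dotted (`k = 0`) or not (`k = 1`), or
there is an innermost cap that is enclosed by another strand and therefore undotted. In the dotted
case the dot is toggled away before the cap is removed. -/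
theorem Valid.exists_ins {σ : Config (Pt (n + 1))} (h : σ.Valid) :
    ∃ k σ', k ≤ n + 2 ∧ σ'.Valid ∧ ins k σ' = σ := by
  have key : ∀ i : Fin (n + 2), σ.conn (footL i) = footR i →
      (∀ d, σ.dots = some d → d (footL i) = false) →
      ∃ k σ', k ≤ n + 2 ∧ σ'.Valid ∧ ins k σ' = σ := by
    intro i hi hd
    have := insertAt_removeAt h.wf hi hd
    refine ⟨i.val + 1, removeAt i σ, by omega, Valid.of_insertAt (i := i) (by rwa [this]), ?_⟩
    rw [ins_of_ne_zero (by omega), pos_succ, this]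
  rcases exists_position h.isTL with h0 | ⟨i, hi, ho⟩
  · by_cases hd : ∀ d, σ.dots = some d → d (footL 0) = false
    · exact key 0 h0 hd
    · push Not at hd
      obtain ⟨d, hd1, hd2⟩ := hd
      have hd' : ∀ d, (Config.toggle σ).dots = some d → d (footL 0) = false := by
        intro d' hd'
        simp only [Config.toggle, flip, hd1, Option.map_some, Option.some.injEq] at hd'
        subst hd'
        simpa using hd2
      have := insertAt_removeAt h.wf.toggle (i := 0) h0 hd'
      refine ⟨0, Config.toggle (removeAt 0 (Config.toggle σ)), by omega,
        (Valid.of_insertAt (i := 0) (by rw [this]; exact h.toggle)).toggle, ?_⟩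
      simp only [ins, if_true]
      rw [toggle_toggle, this, toggle_toggle]
  · refine key i hi fun d hd => ?_
    by_contra h'
    exact ho (h.outer d hd _ (by simpa using h'))

end Config
end TemperleyLieb

namespace TemperleyLieb

/-! ## Words in the generators of type `D` -/

noncomputable section

/-- The value of a loop. -/
def loopVal : K := -qInt 2

/-- Adjacency of the nodes `0, 1, 2, …` of the Dynkin diagrams of type `D`. -/
def AdjD (i j : ℕ) : Prop :=
  (i = 0 ∧ j = 2) ∨ (j = 0 ∧ i = 2) ∨ (1 ≤ i ∧ j = i + 1) ∨ (1 ≤ j ∧ i = j + 1)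

/-- The elements `e 0, …, e N` satisfy the Temperley--Lieb relations of type `D`. -/
structure DRel {R : Type} [Ring R] [Algebra K R] (e : ℕ → R) (N : ℕ) : Prop where
  sq : ∀ s, s ≤ N → e s * e s = loopVal • e s
  braid : ∀ s t, s ≤ N → t ≤ N → AdjD s t → e s * e t * e s = e s
  comm : ∀ s t, s ≤ N → t ≤ N → ¬ AdjD s t → e s * e t = e t * e s

/-- The product of the elements `e s`, for the letters `s` of a word. -/
def ev {R : Type} [Ring R] (e : ℕ → R) (w : List ℕ) : R := (w.map e).prod

/-- The word `m, m - 1, …, k`, and `m, …, 2, 0` for `k = 0`. -/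
def ladder (m k : ℕ) : List ℕ :=
  if k = 0 then (List.range' 2 (m - 1)).reverse ++ [0] else (List.range' k (m + 1 - k)).reverse

/-- Exchange `0` and `1`. -/
def swap01 (s : ℕ) : ℕ := if s = 0 then 1 else if s = 1 then 0 else s

theorem adjD_swap01 {i j : ℕ} : AdjD (swap01 i) (swap01 j) ↔ AdjD i j := by
  unfold AdjD swap01; grind

section
variable {R : Type} [Ring R] {e : ℕ → R} {N : ℕ}

@[simp] theorem ev_nil : ev e [] = 1 := rfl

@[simp] theorem ev_cons (s : ℕ) (w : List ℕ) : ev e (s :: w) = e s * ev e w := by simp [ev]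

@[simp] theorem ev_append (v w : List ℕ) : ev e (v ++ w) = ev e v * ev e w := by simp [ev]

/-- The element `e m ⋯ e k`. -/
def lad (e : ℕ → R) (m k : ℕ) : R := ev e (ladder m k)

theorem lad_top {m k : ℕ} (hk : 1 ≤ k) (h : k ≤ m) : lad e m k = e m * lad e (m - 1) k := by
  have h1 : m + 1 - k = (m - k) + 1 := by omega
  have h2 : m - 1 + 1 - k = m - k := by omega
  simp only [lad, ladder, if_neg (show k ≠ 0 by omega), h1, h2, List.range'_1_concat]
  simp [show k + (m - k) = m by omega]

theorem lad_last {m k : ℕ} (hk : 1 ≤ k) (h : k ≤ m) : lad e m k = lad e m (k + 1) * e k := by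
  have h1 : m + 1 - k = (m - k) + 1 := by omega
  have h2 : m + 1 - (k + 1) = m - k := by omega
  simp only [lad, ladder, if_neg (show k ≠ 0 by omega), if_neg (show k + 1 ≠ 0 by omega), h1, h2,
    List.range'_succ]
  simp

theorem lad_gt {m k : ℕ} (h : m < k) : lad e m k = 1 := by
  simp [lad, ladder, if_neg (show k ≠ 0 by omega), show m + 1 - k = 0 by omega]

theorem lad_zero (m : ℕ) : lad e m 0 = lad e m 2 * e 0 := by
  simp [lad, ladder]

theorem lad_one {m : ℕ} (hm : 1 ≤ m) : lad e m 1 = lad e m 2 * e 1 := lad_last le_rfl hm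

theorem lad_split {m k t : ℕ} (hk : 1 ≤ k) (h : k ≤ t + 1) (ht : t ≤ m) :
    lad e m k = lad e m (t + 1) * lad e t k := by
  obtain ⟨l, rfl⟩ : ∃ l, m = t + l := ⟨m - t, by omega⟩
  induction l with
  | zero => rw [Nat.add_zero, lad_gt (k := t + 1) (by omega), one_mul]
  | succ l ih =>
    rw [lad_top hk (by omega), lad_top (k := t + 1) (by omega) (by omega), mul_assoc,
      show t + (l + 1) - 1 = t + l by omega, ← ih (by omega)]
end

section
variable {R : Type} [Ring R] [Algebra K R] {e : ℕ → R} {N : ℕ}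

/-- Exchanging the nodes `0` and `1` is a symmetry of the Dynkin diagram. Formulas for ladders that
end in `E_0` are the images of those for ladders that end in `E_1`. -/
theorem DRel.swap (h : DRel e N) (hN : 1 ≤ N) : DRel (e ∘ swap01) N := by
  have hs : ∀ s, s ≤ N → swap01 s ≤ N := by intro s hs; unfold swap01; split_ifs <;> omega
  exact ⟨fun s h1 => h.sq _ (hs s h1), fun s t h1 h2 h3 => h.braid _ _ (hs s h1) (hs t h2)
    (adjD_swap01.2 h3), fun s t h1 h2 h3 => h.comm _ _ (hs s h1) (hs t h2)
    (fun h => h3 (adjD_swap01.1 h))⟩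

theorem lad_swap_of_two_le {R : Type} [Ring R] {e : ℕ → R} {m k : ℕ} (hk : 2 ≤ k) :
    lad (e ∘ swap01) m k = lad e m k := by
  unfold lad ev
  congr 1
  refine List.map_congr_left fun s hs => ?_
  simp only [ladder, if_neg (show k ≠ 0 by omega), List.mem_reverse, List.mem_range'_1] at hs
  simp only [Function.comp, swap01]
  rw [if_neg (by omega), if_neg (by omega)]

theorem lad_swap_one {R : Type} [Ring R] {e : ℕ → R} {m : ℕ} (hm : 1 ≤ m) :
    lad (e ∘ swap01) m 1 = lad e m 0 := by
  rw [lad_one hm, lad_zero, lad_swap_of_two_le le_rfl]; rfl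

theorem DRel.commute_lad (h : DRel e N) {m k s : ℕ} (hm : m ≤ N) (hs : s ≤ N) (hk : 1 ≤ k)
    (hc : ∀ t, k ≤ t → t ≤ m → ¬ AdjD s t) : e s * lad e m k = lad e m k * e s := by
  have hl : ∀ w : List ℕ, (∀ t ∈ w, t ≤ N ∧ ¬ AdjD s t) → e s * ev e w = ev e w * e s := by
    intro w
    induction w with
    | nil => simp
    | cons t w ih =>
      intro hw
      rw [ev_cons, ← mul_assoc, h.comm s t hs (hw t (by simp)).1 (hw t (by simp)).2, mul_assoc,
        ih (fun t ht => hw t (by simp [ht])), mul_assoc]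
  refine hl _ fun t ht => ?_
  simp only [ladder, if_neg (show k ≠ 0 by omega), List.mem_reverse, List.mem_range'_1] at ht
  exact ⟨by omega, hc t ht.1 (by omega)⟩

/-! ### Multiplying a ladder by a generator on the right -/

theorem DRel.lad_mul_self (h : DRel e N) {m k : ℕ} (hm : m ≤ N) (hm1 : 1 ≤ m) (h2 : k ≤ m) :
    lad e m k * e k = loopVal • lad e m k := by
  rcases Nat.eq_zero_or_pos k with rfl | hk
  · rw [lad_zero, mul_assoc, h.sq 0 (by omega), mul_smul_comm]
  · rw [lad_last hk h2, mul_assoc, h.sq k (by omega), mul_smul_comm]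

theorem DRel.lad_mul_succ (h : DRel e N) {m k : ℕ} (hm : m ≤ N) (hk : 1 ≤ k) (h2 : k + 1 ≤ m) :
    lad e m k * e (k + 1) = lad e m (k + 1) := by
  rw [lad_last hk (by omega), lad_last (by omega) h2, mul_assoc, mul_assoc,
    ← mul_assoc (e (k + 1)), h.braid _ _ (by omega) (by omega) (by unfold AdjD; omega)]

/-- The letter `E_{s+2}` moves left to `E_{s+2} E_{s+1}`, which it contracts. Writing `E_s = E_s
E_{s+1} E_s` restores the missing letter and leaves a factor `E_s`, which commutes to the front.
This is the algebraic form of `act_ins_gt`. -/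
theorem DRel.lad_mul_gt (h : DRel e N) {m k s : ℕ} (hm : m ≤ N) (hk : 1 ≤ k) (hs : k ≤ s)
    (hs2 : s + 2 ≤ m) : lad e m k * e (s + 2) = e s * lad e m k := by
  have e1 : lad e m k = lad e m (s + 3) * (e (s + 2) * (e (s + 1) * lad e s k)) := by
    rw [lad_split hk (t := s + 2) (by omega) hs2, lad_top hk (by omega), lad_top hk (by omega)]
    rfl
  have e2 : lad e s k = e s * lad e (s - 1) k := lad_top hk hs
  have c1 := h.commute_lad (m := s) (k := k) (s := s + 2) (by omega) (by omega) hk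
    (fun t h1 h2 => by unfold AdjD; omega)
  have c2 := h.commute_lad (m := m) (k := s + 3) (s := s) hm (by omega) (by omega)
    (fun t h1 h2 => by unfold AdjD; omega)
  have c3 := h.comm s (s + 2) (by omega) (by omega) (by unfold AdjD; omega)
  have b1 := h.braid (s + 2) (s + 1) (by omega) (by omega) (by unfold AdjD; omega)
  have b2 := h.braid s (s + 1) (by omega) (by omega) (by unfold AdjD; omega)
  calc lad e m k * e (s + 2)
      = lad e m (s + 3) * (e (s + 2) * (e (s + 1) * (lad e s k * e (s + 2)))) := by
        rw [e1]; simp only [mul_assoc]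
    _ = lad e m (s + 3) * (e (s + 2) * e (s + 1) * e (s + 2) * lad e s k) := by
        rw [← c1]; simp only [mul_assoc]
    _ = lad e m (s + 3) * (e (s + 2) * lad e s k) := by rw [b1]
    _ = lad e m (s + 3) * (e (s + 2) * (e s * e (s + 1) * e s * lad e (s - 1) k)) := by
        rw [b2, ← e2]
    _ = lad e m (s + 3) * (e s * e (s + 2) * (e (s + 1) * (e s * lad e (s - 1) k))) := by
        rw [c3]; simp only [mul_assoc]
    _ = e s * lad e m k := by
        rw [← e2, e1, ← mul_assoc (e s) (lad e m (s + 3)), c2]; simp only [mul_assoc]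

theorem DRel.lad_mul_lt (h : DRel e N) {m k s : ℕ} (hm : m ≤ N) (hs : s + 2 ≤ k) (hs0 : 1 ≤ s ∨ 3 ≤ k)
    (hk : k ≤ m + 1) (hm1 : 1 ≤ m) : lad e m k * e s = e s * lad e m k :=
  (h.commute_lad hm (by omega) (by omega) fun t h1 h2 => by unfold AdjD; omega).symm

theorem DRel.lad_zero_mul_two (h : DRel e N) {m : ℕ} (hm : m ≤ N) (h2 : 2 ≤ m) :
    lad e m 0 * e 2 = lad e m 2 := by
  have := (h.swap (by omega)).lad_mul_succ (k := 1) hm le_rfl h2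
  rwa [lad_swap_one (by omega), lad_swap_of_two_le le_rfl] at this

theorem DRel.lad_zero_mul_three (h : DRel e N) {m : ℕ} (hm : m ≤ N) (h2 : 3 ≤ m) :
    lad e m 0 * e 3 = e 0 * lad e m 0 := by
  have := (h.swap (by omega)).lad_mul_gt (k := 1) (s := 1) hm le_rfl le_rfl (by omega)
  rwa [lad_swap_one (by omega)] at this

theorem DRel.lad_zero_mul_gt (h : DRel e N) {m s : ℕ} (hm : m ≤ N) (hs : 2 ≤ s) (h2 : s + 2 ≤ m) :
    lad e m 0 * e (s + 2) = e s * lad e m 0 := by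
  have := (h.swap (by omega)).lad_mul_gt (k := 1) (s := s) hm le_rfl (by omega) h2
  rw [lad_swap_one (by omega)] at this
  simpa [swap01, show s ≠ 0 by omega, show s ≠ 1 by omega] using this

/-! ### Exchanging two ladders -/

theorem DRel.top_mul_lad (h : DRel e N) {m k : ℕ} (hm : m + 1 ≤ N) (hk : 1 ≤ k) (hkm : k ≤ m) :
    e m * lad e (m + 1) k = lad e m k := by
  rw [lad_top hk (by omega), Nat.add_sub_cancel, lad_top hk hkm, ← mul_assoc, ← mul_assoc,
    h.braid _ _ (by omega) (by omega) (by unfold AdjD; omega)]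

/-- Both products insert the same two disjoint caps, in different orders. The proof is a descent in
`j` from `m`: the last letter `E_j` of the first ladder passes through the second one as `E_{j+2}`.
-/
theorem DRel.lad_exchange (h : DRel e N) {m i j : ℕ} (hm : m + 1 ≤ N) (hi : 1 ≤ i) (hij : i ≤ j)
    (hj : j ≤ m) : lad e m j * lad e (m + 1) i = lad e m i * lad e (m + 1) (j + 2) := by
  obtain ⟨l, hl⟩ : ∃ l, m = j + l := ⟨m - j, by omega⟩
  induction l generalizing j with
  | zero =>
    obtain rfl : m = j := hl
    rw [lad_gt (k := m + 2) (by omega), mul_one, lad_last (by omega) le_rfl,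
      lad_gt (k := m + 1) (by omega), one_mul]
    exact h.top_mul_lad hm hi hij
  | succ l ih =>
    rw [lad_last (k := j) (by omega) (by omega), mul_assoc,
      ← h.lad_mul_gt hm hi hij (by omega), ← mul_assoc,
      ih (j := j + 1) (by omega) (by omega) (by omega),
      lad_last (k := j + 2) (by omega) (by omega), mul_assoc]

theorem DRel.lad_exchange_zero (h : DRel e N) {m j : ℕ} (hm : m + 1 ≤ N) (hij : 2 ≤ j)
    (hj : j ≤ m) : lad e m j * lad e (m + 1) 0 = lad e m 0 * lad e (m + 1) (j + 2) := by
  have := (h.swap (by omega)).lad_exchange hm le_rfl (by omega : 1 ≤ j) hj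
  rwa [lad_swap_one (by omega), lad_swap_one (by omega), lad_swap_of_two_le hij,
    lad_swap_of_two_le (by omega)] at this

theorem DRel.lad_exchange_zero_zero (h : DRel e N) {m : ℕ} (hm : m + 1 ≤ N)
    (hj : 1 ≤ m) : lad e m 0 * lad e (m + 1) 0 = lad e m 0 * lad e (m + 1) 3 := by
  have := (h.swap (by omega)).lad_exchange hm le_rfl le_rfl hj
  rwa [lad_swap_one (by omega), lad_swap_one (by omega), lad_swap_of_two_le (by omega)] at this

end

/-! ## Canonical words of diagrams -/

open Config in
/-- A word that is represented by the diagram `σ`. -/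
def canon : (n : ℕ) → Config (Pt n) → List ℕ
  | 0, _ => []
  | n + 1, σ =>
    open Classical in
    if h : ∃ x : ℕ × Config (Pt n), x.1 ≤ n + 2 ∧ x.2.Valid ∧ ins x.1 x.2 = σ then
      canon n h.choose.2 ++ ladder (n + 1) h.choose.1
    else []

namespace Config

theorem ins_dots_eq_none {n k : ℕ} {σ : Config (Pt n)} : (ins k σ).dots = none ↔ σ.dots = none := by
  unfold ins
  split_ifs <;> simp [toggle, flip, insertAt, insert]

theorem act_mem_canon {n : ℕ} (σ : Config (Pt n)) : ∀ s ∈ canon n σ, s ≤ n := by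
  induction n with
  | zero => simp [canon]
  | succ n ih =>
    intro s hs
    rw [canon] at hs
    split_ifs at hs with h
    · rcases List.mem_append.1 hs with hs | hs
      · exact (ih _ s hs).trans (by omega)
      · simp only [ladder] at hs
        split_ifs at hs
        · rcases List.mem_append.1 hs with hs | hs
          · rw [List.mem_reverse, List.mem_range'_1] at hs; omega
          · simp at hs; omega
        · rw [List.mem_reverse, List.mem_range'_1] at hs; omega
    · simp at hs

/-- Two disjoint innermost caps can be removed in either order. -/
theorem exists_ins_ins {n k l : ℕ} (hk : 1 ≤ k) (hkl : k < l) (hl : l ≤ n + 3)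
    {σ τ : Config (Pt (n + 1))} (hσ : σ.Valid) (h : ins k σ = ins l τ) :
    ∃ ρ : Config (Pt n), k + 2 ≤ l ∧ ρ.Valid ∧ σ = ins (l - 2) ρ ∧ τ = ins k ρ := by
  have hi : (pos (n + 2) k).val = k - 1 := pos_val (by omega)
  have hj : (pos (n + 2) l).val = l - 1 := pos_val (by omega)
  rw [ins_of_ne_zero (by omega), ins_of_ne_zero (by omega)] at h
  have hcj : (insertAt (pos (n + 2) l) τ).conn (footL (pos (n + 2) l)) = footR (pos (n + 2) l) :=
    insert_conn_a _ _ _ _ _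
  have hci : (insertAt (pos (n + 2) k) σ).conn (footR (pos (n + 2) k)) = footL (pos (n + 2) k) :=
    insert_conn_b _ _ (footL_ne_footR _) _
  have hkl2 : k + 2 ≤ l := by
    by_contra hcon
    have e1 := footR_eq_footL (n := n + 2) (i := pos (n + 2) k) (j := pos (n + 2) l) (by omega)
    rw [h, e1, hcj] at hci
    exact footL_ne_footR' (i := pos (n + 2) k) (j := pos (n + 2) l) (by omega) hci.symm
  have hj' : (pos (n + 1) (l - 2)).val + 2 = (pos (n + 2) l).val := by
    rw [pos_val (by omega)]; omega
  have hi' : (pos (n + 1) k).val = (pos (n + 2) k).val := by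
    rw [pos_val (by omega)]; omega
  have hs := skip_footL_gt (i := pos (n + 2) k) (by omega) hj'
  have hrem := insertAt_removeAt (i := pos (n + 1) (l - 2)) hσ.wf
    (by rw [← h] at hcj
        rwa [loops_insertAt_of_skip σ hs] at hcj)
    (fun d hd => by
      obtain ⟨p, _ | d'⟩ := σ
      · simp at hd
      · cases hd
        obtain ⟨q, _ | d''⟩ := τ
        · simp [insertAt, insert] at h
        · have := congrArg Config.dots h
          simp only [insertAt, insert, Option.map_some, Option.some.injEq] at this
          have := congrFun this (footL (pos (n + 2) l))
          rw [← hs.1] at this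
          have g := isGap (pos (n + 2) k)
          simp only [g.ne_a, g.ne_b, or_self, if_false, g.left] at this
          rw [this, hs.1]
          simp)
  refine ⟨removeAt (pos (n + 1) (l - 2)) σ, hkl2, Valid.of_insertAt (by rw [hrem]; exact hσ), ?_, ?_⟩
  · rw [ins_of_ne_zero (by omega), hrem]
  · rw [ins_of_ne_zero (by omega)]
    refine insert_injective (isGap (pos (n + 2) l)) ?_
    change insertAt _ _ = insertAt _ _
    rw [← h, ← insertAt_insertAt (by omega) hi' hj', hrem]

theorem exists_ins_ins_zero {n l : ℕ} (hl0 : 2 ≤ l) (hl : l ≤ n + 3)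
    {σ τ : Config (Pt (n + 1))} (hσ : σ.Valid) (h : ins 0 σ = ins l τ) :
    ∃ ρ : Config (Pt n), 3 ≤ l ∧ ρ.Valid ∧ σ = ins (if l = 3 then 0 else l - 2) ρ ∧
      τ = ins 0 ρ := by
  have h1 : ins 1 (toggle σ) = ins l (toggle τ) := by
    rw [← toggle_ins hl0, ← h, ins_zero, toggle_toggle]
  obtain ⟨ρ, h2, h3, h4, h5⟩ := exists_ins_ins le_rfl hl0 hl hσ.toggle h1
  refine ⟨toggle ρ, h2, h3.toggle, ?_, ?_⟩
  · rw [← toggle_toggle σ, h4]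
    -- For `l = 3` the remaining cap sits at the first position after removal, and undoing the
    -- toggle puts a dot on it; hence the index `0` instead of `1`.
    split_ifs with h6
    · subst h6; rw [ins_zero, toggle_toggle]
    · rw [toggle_ins (by omega)]
  · rw [ins_zero, toggle_toggle, ← h5, toggle_toggle]

/-- The two caps are at the same place and differ only by a dot. Once a dotted loop has been deleted
this distinction is lost, which is why `none` is excluded. -/
theorem ins_zero_ne_ins_one {n : ℕ} {σ τ : Config (Pt n)} (hσ : σ.dots ≠ none) :
    ins 0 σ ≠ ins 1 τ := by
  obtain ⟨p, _ | d⟩ := σ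
  · exact absurd rfl hσ
  · intro h
    obtain ⟨q, _ | d'⟩ := τ
    · have := congrArg Config.dots h
      simp [ins, toggle, flip, insertAt, insert] at this
    · have := congrArg Config.dots h
      simp only [ins, toggle, flip, insertAt, insert, if_true, Option.map_some,
        Option.some.injEq, one_ne_zero, if_false, pos_one] at this
      have := congrFun this (footL 0)
      simp at this

end Config

/-! ### Independence of the element of a diagram from the chosen decomposition. -/

section
variable {R : Type} [Ring R] [Algebra K R] {e : ℕ → R} {N : ℕ}
open Config

/-- The element of the diagram `σ`. -/
def evCanon (e : ℕ → R) {n : ℕ} (σ : Config (Pt n)) : R := ev e (canon n σ)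

theorem ins_ne_ins_of_adj {n k l : ℕ} (h : (pos (n + 1) l).val = (pos (n + 1) k).val + 1)
    (σ τ : Config (Pt n)) : ins k σ ≠ ins l τ := by
  intro he
  have h1 := congrArg Config.conn he
  rw [ins_conn, ins_conn] at h1
  have h2 : (insertAt (pos (n + 1) k) σ).conn (footR (pos (n + 1) k)) = footL (pos (n + 1) k) :=
    insert_conn_b _ _ (footL_ne_footR _) _
  have h3 : (insertAt (pos (n + 1) l) τ).conn (footL (pos (n + 1) l)) = footR (pos (n + 1) l) :=
    insert_conn_a _ _ _ _ _
  rw [h1, footR_eq_footL h, h3] at h2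
  exact footL_ne_footR' (by omega) h2.symm

/-- The decomposition used by `canon` comes from a choice, so any given one has to be compared with
all others. -/
theorem evCanon_ins_of_forall {n k : ℕ} (hk : k ≤ n + 2)
    {σ : Config (Pt n)} (hσ : σ.Valid)
    (h : ∀ l τ, l ≤ n + 2 → τ.Valid → ins k σ = ins l τ →
      evCanon e σ * lad e (n + 1) k = evCanon e τ * lad e (n + 1) l) :
    evCanon e (ins k σ) = evCanon e σ * lad e (n + 1) k := by
  have hex : ∃ x : ℕ × Config (Pt n), x.1 ≤ n + 2 ∧ x.2.Valid ∧ ins x.1 x.2 = ins k σ :=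
    ⟨(k, σ), hk, hσ, rfl⟩
  unfold evCanon
  rw [canon, dif_pos hex, ev_append]
  exact (h _ _ hex.choose_spec.1 hex.choose_spec.2.1 hex.choose_spec.2.2.symm).symm

/-- The element of a diagram can be computed from any decomposition. -/
theorem DRel.evCanon_mul_lad (h : DRel e N) (n : ℕ) : n + 1 ≤ N → ∀ k l : ℕ, k ≤ n + 2 →
    l ≤ n + 2 → ∀ σ τ : Config (Pt n), σ.Valid → τ.Valid → σ.dots ≠ none → ins k σ = ins l τ →
    evCanon e σ * lad e (n + 1) k = evCanon e τ * lad e (n + 1) l := by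
  have hdots : ∀ {n k l : ℕ} {σ τ : Config (Pt n)}, σ.dots ≠ none → ins k σ = ins l τ →
      τ.dots ≠ none := by
    intro n k l σ τ h1 h2 h3
    rw [Ne, ← ins_dots_eq_none (k := k), h2, ins_dots_eq_none] at h1
    exact h1 h3
  -- By symmetry only `k < l` matters; for equal indices the smaller diagrams agree because
  -- insertion is injective.
  have hred : ∀ n : ℕ, (∀ k l : ℕ, k < l → l ≤ n + 2 → ∀ σ τ : Config (Pt n), σ.Valid →
      σ.dots ≠ none → ins k σ = ins l τ →
      evCanon e σ * lad e (n + 1) k = evCanon e τ * lad e (n + 1) l) → ∀ k l : ℕ, k ≤ n + 2 →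
      l ≤ n + 2 → ∀ σ τ : Config (Pt n), σ.Valid → τ.Valid → σ.dots ≠ none → ins k σ = ins l τ →
      evCanon e σ * lad e (n + 1) k = evCanon e τ * lad e (n + 1) l := by
    intro n hlt k l hk hl σ τ hσ hτ hd he
    rcases lt_trichotomy k l with hkl | rfl | hkl
    · exact hlt k l hkl hl σ τ hσ hd he
    · rw [ins_injective k he]
    · exact (hlt l k hkl hk τ σ hτ (hdots hd he) he.symm).symm
  induction n with
  | zero =>
    intro _
    refine hred 0 fun k l hkl hl σ τ hσ hd he => ?_
    exfalso
    -- With two strands, distinct indices are either `0` and `1`, told apart by the dot, or they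
    -- belong to adjacent positions, where two caps would share a point.
    by_cases h0 : k = 0 ∧ l = 1
    · rw [h0.1, h0.2] at he; exact ins_zero_ne_ins_one hd he
    · refine ins_ne_ins_of_adj ?_ σ τ he
      rw [pos_val (by omega), pos_val (by omega)]
      omega
  | succ n ih =>
    intro hN
    have hcan : ∀ k ≤ n + 2, ∀ ρ : Config (Pt n), ρ.Valid → ρ.dots ≠ none →
        evCanon e (ins k ρ) = evCanon e ρ * lad e (n + 1) k := fun k hk ρ hρ hd =>
      evCanon_ins_of_forall hk hρ fun l τ hl hτ he => ih (by omega) k l hk hl ρ τ hρ hτ hd he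
    -- The two caps are disjoint, so removing both leaves a common diagram `ρ`. By induction each
    -- side is the element of `ρ` times two ladders, and the ladder products agree by exchange.
    refine hred (n + 1) fun k l hkl hl σ τ hσ hd he => ?_
    rcases Nat.eq_zero_or_pos k with rfl | hk
    · by_cases hl1 : l = 1
      · rw [hl1] at he; exact absurd he (ins_zero_ne_ins_one hd)
      · obtain ⟨ρ, h1, h2, h3, h4⟩ := exists_ins_ins_zero (by omega) hl hσ he
        have hρ : ρ.dots ≠ none := by rwa [Ne, h3, ins_dots_eq_none] at hd
        rw [h3, h4, hcan _ (by split_ifs <;> omega) ρ h2 hρ, hcan _ (by omega) ρ h2 hρ, mul_assoc,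
          mul_assoc]
        congr 1
        split_ifs with h5
        · rw [h5]; exact h.lad_exchange_zero_zero (by omega) (by omega)
        · obtain ⟨j, rfl⟩ : ∃ j, l = j + 2 := ⟨l - 2, by omega⟩
          exact h.lad_exchange_zero (by omega) (by omega) (by omega)
    · obtain ⟨ρ, h1, h2, h3, h4⟩ := exists_ins_ins hk hkl hl hσ he
      have hρ : ρ.dots ≠ none := by rwa [Ne, h3, ins_dots_eq_none] at hd
      rw [h3, h4, hcan _ (by omega) ρ h2 hρ, hcan _ (by omega) ρ h2 hρ, mul_assoc, mul_assoc]
      congr 1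
      obtain ⟨j, rfl⟩ : ∃ j, l = j + 2 := ⟨l - 2, by omega⟩
      exact h.lad_exchange (by omega) hk (by omega) (by omega)

theorem DRel.evCanon_ins (h : DRel e N) {n k : ℕ} (hn : n + 1 ≤ N) (hk : k ≤ n + 2)
    {σ : Config (Pt n)} (hσ : σ.Valid) (hd : σ.dots ≠ none) :
    evCanon e (ins k σ) = evCanon e σ * lad e (n + 1) k :=
  evCanon_ins_of_forall hk hσ fun l τ hl hτ he =>
    h.evCanon_mul_lad n hn k l hk hl σ τ hσ hτ hd he
end
end
end TemperleyLieb

namespace TemperleyLieb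
noncomputable section

/-! ## The algebras of type `A` and `D` -/

section
variable {V : Type} (G : SimpleGraph V)

theorem E_mul_self (i : V) : E G i * E G i = loopVal • E G i := by
  have := RingQuot.mkAlgHom_rel K (Rel.loop (G := G) i)
  rwa [map_mul, map_smul] at this

theorem E_braid {i j : V} (h : G.Adj i j) : E G i * E G j * E G i = E G i := by
  simpa [E] using RingQuot.mkAlgHom_rel K (Rel.adjacent (G := G) i j h)

theorem E_comm {i j : V} (h : ¬ G.Adj i j) : E G i * E G j = E G j * E G i := by
  simpa [E] using RingQuot.mkAlgHom_rel K (Rel.commute (G := G) i j h)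

variable {G} {A : Type} [Ring A] [Algebra K A]

/-- The homomorphism given by elements that satisfy the relations. -/
def liftTL (f : V → A) (h1 : ∀ i, f i * f i = loopVal • f i)
    (h2 : ∀ i j, G.Adj i j → f i * f j * f i = f i)
    (h3 : ∀ i j, ¬ G.Adj i j → f i * f j = f j * f i) : TL G →ₐ[K] A :=
  RingQuot.liftAlgHom K ⟨FreeAlgebra.lift K f, by
    intro x y h
    cases h with
    | loop i =>
      rw [map_mul, map_smul, FreeAlgebra.lift_ι_apply]
      exact h1 i
    | adjacent i j h => simpa using h2 i j h
    | commute i j h => simpa using h3 i j h⟩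

@[simp] theorem liftTL_E (f : V → A) (h1 : ∀ i, f i * f i = loopVal • f i)
    (h2 : ∀ i j, G.Adj i j → f i * f j * f i = f i)
    (h3 : ∀ i j, ¬ G.Adj i j → f i * f j = f j * f i) (i : V) :
    liftTL f h1 h2 h3 (E G i) = f i := by
  simp [liftTL, E]

theorem span_word : Submodule.span K (Set.range (word G)) = ⊤ := by
  rw [eq_top_iff]
  rintro x -
  obtain ⟨x, rfl⟩ := RingQuot.mkAlgHom_surjective K (Rel G) x
  induction x using FreeAlgebra.induction with
  | grade0 r =>
    rw [AlgHom.commutes, Algebra.algebraMap_eq_smul_one]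
    exact Submodule.smul_mem _ _ (Submodule.subset_span ⟨[], rfl⟩)
  | grade1 i => exact Submodule.subset_span ⟨[i], by simp [word, E]⟩
  | mul a b ha hb =>
    rw [map_mul]
    generalize RingQuot.mkAlgHom K (Rel G) a = a' at ha
    generalize RingQuot.mkAlgHom K (Rel G) b = b' at hb
    induction ha, hb using Submodule.span_induction₂ with
    | mem_mem x y hx hy =>
      obtain ⟨v, rfl⟩ := hx
      obtain ⟨w, rfl⟩ := hy
      exact Submodule.subset_span ⟨v ++ w, by simp [word]⟩
    | zero_left y hy => simp
    | zero_right x hx => simp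
    | add_left x y z hx hy hz h1 h2 => rw [add_mul]; exact Submodule.add_mem _ h1 h2
    | add_right x y z hx hy hz h1 h2 => rw [mul_add]; exact Submodule.add_mem _ h1 h2
    | smul_left r x y hx hy h => rw [smul_mul_assoc]; exact Submodule.smul_mem _ _ h
    | smul_right r x y hx hy h => rw [mul_smul_comm]; exact Submodule.smul_mem _ _ h
  | add a b ha hb => rw [map_add]; exact Submodule.add_mem _ ha hb

theorem linearMap_ext_word {M : Type} [AddCommGroup M] [Module K M] {f g : TL G →ₗ[K] M}
    (h : ∀ w, f (word G w) = g (word G w)) : f = g :=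
  LinearMap.ext_on_range span_word h

end

/-- The generators of `TL^D_{N+1}`. -/
def eD (N s : ℕ) : TLD N := if h : s < N + 1 then E (dynkinD N) ⟨s, h⟩ else 0

/-- The generators of `TL^A_{N+1}`, where `E_0` is another name for `E_1` (and for `0` if `N = 0`). -/
def eA (N s : ℕ) : TLA N := if h : s - 1 < N then E (dynkinA N) ⟨s - 1, h⟩ else 0

theorem eA_zero (N : ℕ) : eA N 0 = eA N 1 := rfl

theorem eD_val {N : ℕ} (i : Fin (N + 1)) : eD N i.val = E (dynkinD N) i := by
  rw [eD, dif_pos i.2]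

theorem eA_val {N : ℕ} (i : Fin N) : eA N (i.val + 1) = E (dynkinA N) i := by simp [eA]

theorem dRel_eD (N : ℕ) : DRel (eD N) N := by
  refine ⟨fun s hs => ?_, fun s t hs ht h => ?_, fun s t hs ht h => ?_⟩
  · simp only [eD, dif_pos (Nat.lt_succ_of_le hs)]; exact E_mul_self _ _
  · simp only [eD, dif_pos (Nat.lt_succ_of_le hs), dif_pos (Nat.lt_succ_of_le ht)]
    exact E_braid _ h
  · simp only [eD, dif_pos (Nat.lt_succ_of_le hs), dif_pos (Nat.lt_succ_of_le ht)]
    exact E_comm _ h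

/-- With `E_0` read as `E_1`, the relations of type `D` hold in type `A`: both nodes have the same
neighbour and commute with each other. Everything deduced from `DRel` is thereby available for type
`A` as well. -/
theorem dRel_eA (N : ℕ) : DRel (eA N) N := by
  rcases Nat.eq_zero_or_pos N with rfl | hN
  · refine ⟨fun s hs => ?_, fun s t hs ht h => ?_, fun s t hs ht h => ?_⟩ <;> simp [eA]
  refine ⟨fun s hs => ?_, fun s t hs ht h => ?_, fun s t hs ht h => ?_⟩
  · simp only [eA, dif_pos (show s - 1 < N by omega)]; exact E_mul_self _ _
  · simp only [eA, dif_pos (show s - 1 < N by omega), dif_pos (show t - 1 < N by omega)]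
    refine E_braid _ ?_
    rw [SimpleGraph.pathGraph_adj]; simp only; unfold AdjD at h; omega
  · by_cases hst : s - 1 = t - 1
    · simp only [eA, hst]
    simp only [eA, dif_pos (show s - 1 < N by omega), dif_pos (show t - 1 < N by omega)]
    refine E_comm _ ?_
    rw [SimpleGraph.pathGraph_adj]; simp only; unfold AdjD at h; omega

theorem word_eq_evA {N : ℕ} (w : List (Fin N)) :
    word (dynkinA N) w = ev (eA N) (w.map fun i => i.val + 1) := by
  simp only [word, ev, List.map_map]
  congr 2; funext i; exact (eA_val i).symm

/-- The homomorphism `TL^D_{N+1} → TL^A_{N+1}`, `E_0 ↦ E_1` and `E_i ↦ E_i` for `i ≥ 1`. -/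
def forget (N : ℕ) : TLD N →ₐ[K] TLA N :=
  liftTL (fun i => eA N i.val) (fun i => (dRel_eA N).sq _ (by omega))
    (fun i j h => (dRel_eA N).braid _ _ (by omega) (by omega) h)
    (fun i j h => (dRel_eA N).comm _ _ (by omega) (by omega) h)

theorem forget_eD {N s : ℕ} (hs : s ≤ N) : forget N (eD N s) = eA N s := by
  rw [eD, dif_pos (Nat.lt_succ_of_le hs), forget, liftTL_E]

theorem map_ev {R S : Type} [Ring R] [Ring S] (f : R →+* S) (e : ℕ → R) (e' : ℕ → S) (w : List ℕ)
    (h : ∀ s ∈ w, f (e s) = e' s) : f (ev e w) = ev e' w := by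
  induction w with
  | nil => simp
  | cons s w ih =>
    rw [ev_cons, ev_cons, map_mul, h s (by simp), ih fun t ht => h t (by simp [ht])]

theorem forget_ev {N : ℕ} {w : List ℕ} (hw : ∀ s ∈ w, s ≤ N) :
    forget N (ev (eD N) w) = ev (eA N) w :=
  map_ev (forget N).toRingHom _ _ w fun s hs => forget_eD (hw s hs)

theorem TLmap_E {V W : Type} {G : SimpleGraph V} {H : SimpleGraph W} (f : G ↪g H) (i : V) :
    TL.map f (E G i) = E H (f i) := by
  simp [TL.map, E]

theorem inclD_eD {n m s : ℕ} (h : n ≤ m) (hs : s ≤ n) : inclD h (eD n s) = eD m s := by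
  rw [eD, dif_pos (Nat.lt_succ_of_le hs), inclD, TLmap_E, eD,
    dif_pos (Nat.lt_succ_of_le (hs.trans h))]
  rfl

theorem inclD_ev {n m : ℕ} (h : n ≤ m) {w : List ℕ} (hw : ∀ s ∈ w, s ≤ n) :
    inclD h (ev (eD n) w) = ev (eD m) w :=
  map_ev (inclD h).toRingHom _ _ w fun s hs => inclD_eD h (hw s hs)

/-! ## Dotted loops -/

section
variable {R : Type} [Ring R] [Algebra K R] {e : ℕ → R} {N : ℕ}

/-- The element `E_t ⋯ E_2 E_0 E_1 E_2 ⋯ E_t`, which is `E_t` together with a dotted loop. -/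
def dloop (e : ℕ → R) : ℕ → R
  | 0 => e 0 * e 1
  | 1 => e 0 * e 1
  | t + 2 => e (t + 2) * dloop e (t + 1) * e (t + 2)

theorem dloop_succ {t : ℕ} (ht : 1 ≤ t) : dloop e (t + 1) = e (t + 1) * dloop e t * e (t + 1) := by
  obtain ⟨t, rfl⟩ : ∃ u, t = u + 1 := ⟨t - 1, by omega⟩
  rfl

theorem DRel.dloop_swap (h : DRel e N) (hN : 1 ≤ N) (t : ℕ) : dloop (e ∘ swap01) t = dloop e t := by
  have h1 : e 1 * e 0 = e 0 * e 1 := h.comm 1 0 hN (by omega) (by unfold AdjD; omega)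
  induction t with
  | zero => exact h1
  | succ t ih =>
    rcases Nat.eq_zero_or_pos t with rfl | ht
    · exact h1
    · rw [dloop_succ ht, dloop_succ ht, ih]
      simp [swap01, show t ≠ 0 by omega]

theorem DRel.dloop_commute (h : DRel e N) {t s : ℕ} (ht : 1 ≤ t) (hs : t + 2 ≤ s) (hN : s ≤ N) :
    e s * dloop e t = dloop e t * e s := by
  induction t, ht using Nat.le_induction with
  | base =>
    change e s * (e 0 * e 1) = e 0 * e 1 * e s
    rw [← mul_assoc, h.comm s 0 hN (by omega) (by unfold AdjD; omega), mul_assoc,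
      h.comm s 1 hN (by omega) (by unfold AdjD; omega), mul_assoc]
  | succ t ht ih =>
    have c := h.comm s (t + 1) hN (by omega) (by unfold AdjD; omega)
    rw [dloop_succ ht, ← mul_assoc, ← mul_assoc, c, mul_assoc (e (t + 1)), ih (by omega)]
    simp only [mul_assoc]
    rw [c]

theorem DRel.dloop_mul_self (h : DRel e N) {t : ℕ} (ht : 1 ≤ t) (hN : t ≤ N) :
    dloop e t * e t = loopVal • dloop e t := by
  obtain ⟨t, rfl⟩ : ∃ u, t = u + 1 := ⟨t - 1, by omega⟩
  rcases Nat.eq_zero_or_pos t with rfl | ht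
  · change e 0 * e 1 * e 1 = _
    rw [mul_assoc, h.sq 1 (by omega), mul_smul_comm]; rfl
  · rw [dloop_succ ht, mul_assoc, h.sq _ hN, mul_smul_comm]

theorem DRel.self_mul_dloop (h : DRel e N) {t : ℕ} (ht : 1 ≤ t) (hN : t ≤ N) :
    e t * dloop e t = loopVal • dloop e t := by
  obtain ⟨t, rfl⟩ : ∃ u, t = u + 1 := ⟨t - 1, by omega⟩
  rcases Nat.eq_zero_or_pos t with rfl | ht
  · change e 1 * (e 0 * e 1) = loopVal • (e 0 * e 1)
    rw [← mul_assoc, ← h.comm 0 1 (by omega) (by omega) (by unfold AdjD; omega), mul_assoc,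
      h.sq 1 (by omega), mul_smul_comm]
  · rw [dloop_succ ht, ← mul_assoc, ← mul_assoc, h.sq _ hN, smul_mul_assoc, smul_mul_assoc]

theorem DRel.dloop_mul_succ_mul (h : DRel e N) {t : ℕ} (ht : 1 ≤ t) (hN : t + 1 ≤ N) :
    dloop e t * e (t + 1) * e t = dloop e t := by
  have hb := h.braid t (t + 1) (by omega) (by omega) (by unfold AdjD; omega)
  obtain ⟨t, rfl⟩ : ∃ u, t = u + 1 := ⟨t - 1, by omega⟩
  rcases Nat.eq_zero_or_pos t with rfl | ht
  · change e 0 * e 1 * e 2 * e 1 = e 0 * e 1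
    simp only [mul_assoc] at hb ⊢
    rw [hb]
  · rw [dloop_succ ht]
    simp only [mul_assoc] at hb ⊢
    rw [hb]

theorem DRel.mul_succ_mul_dloop (h : DRel e N) {t : ℕ} (ht : 1 ≤ t) (hN : t + 1 ≤ N) :
    e t * e (t + 1) * dloop e t = dloop e t := by
  have hb := h.braid t (t + 1) (by omega) (by omega) (by unfold AdjD; omega)
  obtain ⟨t, rfl⟩ : ∃ u, t = u + 1 := ⟨t - 1, by omega⟩
  rcases Nat.eq_zero_or_pos t with rfl | ht
  · change e 1 * e 2 * (e 0 * e 1) = e 0 * e 1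
    rw [h.comm 0 1 (by omega) (by omega) (by unfold AdjD; omega), ← mul_assoc]
    exact congrArg (· * e 0) hb
  · rw [dloop_succ ht, ← mul_assoc, ← mul_assoc, hb]

theorem DRel.dloop_succ_mul_mul (h : DRel e N) {t : ℕ} (ht : 1 ≤ t) (hN : t + 1 ≤ N) :
    dloop e (t + 1) * e t * e (t + 1) = dloop e (t + 1) := by
  have hb := h.braid (t + 1) t (by omega) (by omega) (by unfold AdjD; omega)
  rw [dloop_succ ht]
  simp only [mul_assoc] at hb ⊢
  rw [hb]

/-- For `j = i + 2` the definition of `dloop` is unfolded twice down to `dloop e i`, and the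
surrounding letters contract by braid relations. Larger `j` follows on conjugating with `E_{j+1}`,
which commutes with `E_i` and its dotted loop. -/
theorem DRel.dloop_far (h : DRel e N) {i j : ℕ} (hi : 1 ≤ i) (hij : i + 2 ≤ j) (hN : j ≤ N) :
    dloop e j * e i = dloop e i * e j ∧ e i * dloop e j = e j * dloop e i := by
  induction j, hij using Nat.le_induction with
  | base =>
    have c1 := h.comm (i + 2) i hN (by omega) (by unfold AdjD; omega)
    have c2 := h.dloop_commute hi le_rfl hN
    have b := h.braid (i + 2) (i + 1) hN (by omega) (by unfold AdjD; omega)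
    have o1 := h.dloop_mul_succ_mul hi (by omega)
    have o2 := h.mul_succ_mul_dloop hi (by omega)
    rw [dloop_succ (t := i + 1) (by omega), dloop_succ hi]
    constructor
    · calc e (i + 2) * (e (i + 1) * dloop e i * e (i + 1)) * e (i + 2) * e i
          = e (i + 2) * e (i + 1) * (dloop e i * e (i + 1) * (e (i + 2) * e i)) := by
            simp only [mul_assoc]
        _ = e (i + 2) * e (i + 1) * ((dloop e i * e (i + 1) * e i) * e (i + 2)) := by
            rw [c1]; simp only [mul_assoc]
        _ = e (i + 2) * e (i + 1) * e (i + 2) * dloop e i := by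
            rw [o1, ← c2]; simp only [mul_assoc]
        _ = dloop e i * e (i + 2) := by rw [b, c2]
    · calc e i * (e (i + 2) * (e (i + 1) * dloop e i * e (i + 1)) * e (i + 2))
          = (e i * e (i + 2)) * e (i + 1) * dloop e i * (e (i + 1) * e (i + 2)) := by
            simp only [mul_assoc]
        _ = e (i + 2) * (e i * e (i + 1) * dloop e i) * (e (i + 1) * e (i + 2)) := by
            rw [← c1]; simp only [mul_assoc]
        _ = dloop e i * (e (i + 2) * e (i + 1) * e (i + 2)) := by
            rw [o2, c2]; simp only [mul_assoc]
        _ = e (i + 2) * dloop e i := by rw [b, c2]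
  | succ j hj ih =>
    obtain ⟨ih1, ih2⟩ := ih (by omega)
    have c1 := h.comm (j + 1) i hN (by omega) (by unfold AdjD; omega)
    have c2 := h.dloop_commute (s := j + 1) hi (by omega) hN
    have b := h.braid (j + 1) j hN (by omega) (by unfold AdjD; omega)
    rw [dloop_succ (t := j) (by omega)]
    constructor
    · rw [mul_assoc, c1, ← mul_assoc, mul_assoc (e (j + 1)), ih1, ← mul_assoc, c2]
      simp only [mul_assoc] at b ⊢
      rw [b]
    · rw [← mul_assoc, ← mul_assoc, ← c1, mul_assoc (e (j + 1)), ih2, ← mul_assoc, mul_assoc, ← c2,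
        ← mul_assoc, b]

/-- A dotted loop can be moved past a generator. -/
theorem DRel.mul_dloop (h : DRel e N) {s t : ℕ} (hs : s ≤ N) (ht : t ≤ N) (hN : 1 ≤ N) :
    e s * dloop e t = dloop e s * e t := by
  -- Stated for an arbitrary family because it is also applied with `E_0` and `E_1` exchanged. That
  -- exchange leaves dotted loops unchanged and settles the cases that involve `E_0`.
  have key : ∀ {e : ℕ → R}, DRel e N → ∀ s t, 1 ≤ s → 1 ≤ t → s ≤ N → t ≤ N →
      e s * dloop e t = dloop e s * e t := by
    intro e h s t hs ht hsN htN
    rcases lt_trichotomy s t with hst | rfl | hst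
    · rcases Nat.eq_or_lt_of_le (Nat.succ_le_of_lt hst) with h1 | h1
      · subst h1
        rw [Nat.succ_eq_add_one, dloop_succ hs, ← mul_assoc, ← mul_assoc,
          h.mul_succ_mul_dloop hs htN]
      · rw [(h.dloop_far hs (by omega) htN).2, h.dloop_commute hs (by omega) htN]
    · rw [h.self_mul_dloop hs hsN, h.dloop_mul_self hs hsN]
    · rcases Nat.eq_or_lt_of_le (Nat.succ_le_of_lt hst) with h1 | h1
      · subst h1
        rw [Nat.succ_eq_add_one, dloop_succ ht, mul_assoc, mul_assoc, ← mul_assoc (dloop e t),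
          h.dloop_mul_succ_mul ht hsN]
      · rw [(h.dloop_far ht (by omega) hsN).1, h.dloop_commute ht (by omega) hsN]
  have k1 := key h
  have k2 := key (h.swap hN)
  simp only [h.dloop_swap hN, Function.comp] at k2
  have a0 : dloop e 0 = dloop e 1 := rfl
  have s1 : swap01 1 = 0 := rfl
  have c1 : ∀ s, 1 ≤ s → s ≤ N → e s * dloop e 1 = dloop e s * e 0 := by
    intro s hs hsN
    rcases Nat.eq_or_lt_of_le hs with rfl | hs2
    · rw [k1 1 1 le_rfl le_rfl hN hN, ← a0]
      change e 0 * e 1 * e 1 = e 0 * e 1 * e 0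
      have := h.comm 0 1 (by omega) hN (by unfold AdjD; omega)
      rw [mul_assoc, h.sq 1 hN, this, mul_assoc, h.sq 0 (by omega), mul_smul_comm, mul_smul_comm,
        this]
    · have := k2 s 1 hs le_rfl hsN hN
      rw [s1] at this
      simpa [swap01, show s ≠ 0 by omega, show s ≠ 1 by omega] using this
  have c2 : ∀ s, 1 ≤ s → s ≤ N → e 0 * dloop e s = dloop e 1 * e s := by
    intro s hs hsN
    rcases Nat.eq_or_lt_of_le hs with rfl | hs2
    · rw [← k1 1 1 le_rfl le_rfl hN hN, ← a0]
      change e 0 * (e 0 * e 1) = e 1 * (e 0 * e 1)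
      have := h.comm 0 1 (by omega) hN (by unfold AdjD; omega)
      rw [← mul_assoc, h.sq 0 (by omega), this, ← mul_assoc, h.sq 1 hN, smul_mul_assoc,
        smul_mul_assoc, this]
    · have := k2 1 s le_rfl hs hN hsN
      rw [s1] at this
      simpa [swap01, show s ≠ 0 by omega, show s ≠ 1 by omega] using this
  rcases Nat.eq_zero_or_pos s with rfl | hs1
  · rcases Nat.eq_zero_or_pos t with rfl | ht1
    · rw [a0, c2 1 le_rfl hN, ← k1 1 1 le_rfl le_rfl hN hN, c1 1 le_rfl hN]
    · rw [c2 t ht1 ht, a0]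
  · rcases Nat.eq_zero_or_pos t with rfl | ht1
    · rw [a0, c1 s hs1 hs]
    · exact k1 s t hs1 ht1 hs ht

/-- The loop is slid from letter to letter; while it sits at the first position, `E_0` and `E_1`
cannot be distinguished. Hence, next to a dotted loop, a word depends only on its image in type `A`.
-/
theorem DRel.dloop_mul_ev (h : DRel e N) (hN : 1 ≤ N) (w : List ℕ) (hw : ∀ t ∈ w, t ≤ N) (s : ℕ)
    (hs : s ≤ N) : dloop e s * ev e (w.map (max 1)) = dloop e s * ev e w := by
  induction w generalizing s with
  | nil => simp
  | cons t w ih =>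
    have ht : t ≤ N := hw t (by simp)
    have h1 : dloop e (max 1 t) = dloop e t := by
      rcases Nat.eq_zero_or_pos t with rfl | ht
      · rfl
      · rw [max_eq_right (show 1 ≤ t from ht)]
    rw [List.map_cons, ev_cons, ev_cons, ← mul_assoc, ← mul_assoc, ← h.mul_dloop hs ht hN,
      ← h.mul_dloop hs (show max 1 t ≤ N from max_le hN ht) hN, h1, mul_assoc, mul_assoc,
      ih (fun u hu => hw u (by simp [hu])) t ht]
end

/-- Right multiplication by `E_i` on `K ⊕ TL^D`, with `(1, 0) E_i = (0, dloop i)`. -/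
def loopStep (N s : ℕ) : Module.End K (K × TLD N) :=
  LinearMap.prod 0 ((LinearMap.toSpanSingleton K (TLD N) (dloop (eD N) s)).coprod
    (LinearMap.mulRight K (eD N s)))

theorem loopStep_apply (N s : ℕ) (v : K × TLD N) :
    loopStep N s v = (0, v.1 • dloop (eD N) s + v.2 * eD N s) := by
  simp [loopStep]

/-- The action of `TL^A` on `K ⊕ TL^D`. -/
def loopRep (N : ℕ) : TLA N →ₐ[K] (Module.End K (K × TLD N))ᵐᵒᵖ :=
  liftTL (fun i => MulOpposite.op (loopStep N (i.val + 1)))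
    (fun i => by
      have h := dRel_eD N
      rw [← MulOpposite.op_mul, ← MulOpposite.op_smul]
      congr 1
      refine LinearMap.ext fun v => ?_
      simp only [Module.End.mul_apply, LinearMap.smul_apply, loopStep_apply, zero_smul, zero_add,
        add_mul, smul_mul_assoc, mul_assoc, h.sq _ (Nat.succ_le_of_lt i.2),
        h.dloop_mul_self (Nat.succ_pos _) (Nat.succ_le_of_lt i.2), mul_smul_comm, Prod.smul_mk,
        smul_zero, smul_add]
      rw [smul_comm])
    (fun i j hij => by
      have h := dRel_eD N
      rw [SimpleGraph.pathGraph_adj] at hij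
      have hi := i.2
      have hj := j.2
      rw [← MulOpposite.op_mul, ← MulOpposite.op_mul]
      congr 1
      refine LinearMap.ext fun v => ?_
      have hb := h.braid (i.val + 1) (j.val + 1) (by omega) (by omega) (by unfold AdjD; omega)
      -- On the summand `K` the relation becomes this identity for the dotted loop itself; on the
      -- summand `TLD N` it is the relation of type `D`.
      have ho : dloop (eD N) (i.val + 1) * eD N (j.val + 1) * eD N (i.val + 1) =
          dloop (eD N) (i.val + 1) := by
        rcases hij with hij | hij
        · rw [← hij]; exact h.dloop_mul_succ_mul (by omega) (by omega)
        · rw [← hij]; exact h.dloop_succ_mul_mul (by omega) (by omega)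
      simp only [mul_assoc] at hb ho
      simp only [Module.End.mul_apply, loopStep_apply, zero_smul, zero_add,
        add_mul, smul_mul_assoc, mul_assoc, hb, ho])
    (fun i j hij => by
      have h := dRel_eD N
      rw [SimpleGraph.pathGraph_adj] at hij
      have hi := i.2
      have hj := j.2
      rw [← MulOpposite.op_mul, ← MulOpposite.op_mul]
      congr 1
      refine LinearMap.ext fun v => ?_
      have hc := h.comm (i.val + 1) (j.val + 1) (by omega) (by omega) (by unfold AdjD; omega)
      have ho : dloop (eD N) (j.val + 1) * eD N (i.val + 1) =
          dloop (eD N) (i.val + 1) * eD N (j.val + 1) := by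
        rcases lt_trichotomy i.val j.val with h1 | h1 | h1
        · exact (h.dloop_far (by omega) (by omega) (by omega)).1
        · rw [h1]
        · exact (h.dloop_far (by omega) (by omega) (by omega)).1.symm
      simp only [Module.End.mul_apply, loopStep_apply, zero_smul, zero_add,
        add_mul, smul_mul_assoc, mul_assoc, hc, ho])

/-- Multiplication by a dotted loop, as a map from the augmentation ideal of `TL^A` to `TL^D`. -/
def addLoop (N : ℕ) : TLA N →ₗ[K] TLD N where
  -- The unit fixes the vector `(1, 0)` and is therefore sent to `0`. The first letter of a nonempty
  -- word turns `1` into a dotted loop, and the remaining letters multiply it.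
  toFun x := ((loopRep N x).unop (1, 0)).2
  map_add' x y := by simp
  map_smul' r x := by simp

theorem loopRep_ev {N : ℕ} (hN : 1 ≤ N) (s : ℕ) (w : List ℕ) (hs : s ≤ N) (hw : ∀ t ∈ w, t ≤ N) :
    (loopRep N (ev (eA N) (s :: w))).unop (1, 0) = (0, dloop (eD N) s * ev (eD N) w) := by
  have hE : ∀ s, s ≤ N → (loopRep N (eA N s)).unop = loopStep N (max 1 s) := by
    intro s hs
    rw [eA, dif_pos (show s - 1 < N by omega), loopRep, liftTL_E]
    simp only [MulOpposite.unop_op]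
    congr 1; omega
  rw [← (dRel_eD N).dloop_mul_ev hN w hw s hs]
  induction w using List.reverseRecOn with
  | nil =>
    rw [ev_cons, ev_nil, mul_one, hE s hs, loopStep_apply]
    have : dloop (eD N) (max 1 s) = dloop (eD N) s := by
      rcases Nat.eq_zero_or_pos s with rfl | h
      · rfl
      · rw [max_eq_right (show 1 ≤ s from h)]
    simp [this]
  | append_singleton w t ih =>
    have h1 : ev (eA N) (s :: (w ++ [t])) = ev (eA N) (s :: w) * eA N t := by
      simp [mul_assoc]
    rw [h1, map_mul, MulOpposite.unop_mul, Module.End.mul_apply,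
      ih fun u hu => hw u (by simp [hu]), hE t (hw t (by simp)), loopStep_apply]
    simp [mul_assoc]

theorem addLoop_ev {N : ℕ} (hN : 1 ≤ N) (s : ℕ) (w : List ℕ) (hs : s ≤ N) (hw : ∀ t ∈ w, t ≤ N) :
    addLoop N (ev (eA N) (s :: w)) = dloop (eD N) s * ev (eD N) w :=
  congrArg Prod.snd (loopRep_ev hN s w hs hw)

theorem addLoop_mul_ev {N : ℕ} (hN : 1 ≤ N) {w v : List ℕ} (hw0 : w ≠ []) (hw : ∀ t ∈ w, t ≤ N)
    (hv : ∀ t ∈ v, t ≤ N) :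
    addLoop N (ev (eA N) w) * ev (eD N) v = addLoop N (ev (eA N) (w ++ v)) := by
  obtain ⟨s, w, rfl⟩ := List.exists_cons_of_ne_nil hw0
  rw [List.cons_append, addLoop_ev hN s w (hw s (by simp)) (fun t ht => hw t (by simp [ht])),
    addLoop_ev hN s (w ++ v) (hw s (by simp)) (fun t ht => by
      rcases List.mem_append.1 ht with h | h
      · exact hw t (by simp [h])
      · exact hv t h), ev_append, mul_assoc]

theorem ev_mul_addLoop {N : ℕ} (hN : 1 ≤ N) {w v : List ℕ} (hw0 : w ≠ []) (hw : ∀ t ∈ w, t ≤ N)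
    (hv : ∀ t ∈ v, t ≤ N) :
    ev (eD N) v * addLoop N (ev (eA N) w) = addLoop N (ev (eA N) (v ++ w)) := by
  induction v with
  | nil => simp
  | cons s v ih =>
    have ih := ih fun t ht => hv t (by simp [ht])
    have hs : s ≤ N := hv s (by simp)
    rw [ev_cons, mul_assoc, ih, List.cons_append]
    obtain ⟨t, u, hu⟩ := List.exists_cons_of_ne_nil (l := v ++ w) (by simp [hw0])
    have hmem : ∀ x ∈ t :: u, x ≤ N := by
      rw [← hu]; intro x hx
      rcases List.mem_append.1 hx with h | h
      · exact hv x (by simp [h])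
      · exact hw x h
    rw [hu, addLoop_ev hN t u (hmem t (by simp)) (fun x hx => hmem x (by simp [hx])),
      addLoop_ev hN s (t :: u) hs hmem, ← mul_assoc,
      (dRel_eD N).mul_dloop hs (hmem t (by simp)) hN, ev_cons, mul_assoc]

/-- When dots are forgotten, the dotted loop becomes an ordinary one and contributes the value of a
loop. -/
theorem forget_dloop {N : ℕ} (hN : 1 ≤ N) {s : ℕ} (hs : s ≤ N) :
    forget N (dloop (eD N) s) = loopVal • eA N s := by
  have h := dRel_eA N
  have h0 : forget N (eD N 0 * eD N 1) = loopVal • eA N 1 := by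
    rw [map_mul, forget_eD (by omega), forget_eD hN, eA_zero, h.sq 1 hN]
  induction s with
  | zero => exact h0
  | succ s ih =>
    rcases Nat.eq_zero_or_pos s with rfl | hs1
    · exact h0
    · rw [dloop_succ hs1, map_mul, map_mul, ih (by omega), forget_eD hs, mul_smul_comm,
        smul_mul_assoc, h.braid _ _ hs (by omega) (by unfold AdjD; omega)]

theorem forget_addLoop {N : ℕ} (hN : 1 ≤ N) {w : List ℕ} (hw0 : w ≠ []) (hw : ∀ t ∈ w, t ≤ N) :
    forget N (addLoop N (ev (eA N) w)) = loopVal • ev (eA N) w := by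
  obtain ⟨s, w, rfl⟩ := List.exists_cons_of_ne_nil hw0
  rw [addLoop_ev hN s w (hw s (by simp)) (fun t ht => hw t (by simp [ht])), map_mul,
    forget_dloop hN (hw s (by simp)), forget_ev (fun t ht => hw t (by simp [ht])), ev_cons,
    smul_mul_assoc]

end
end TemperleyLieb

namespace TemperleyLieb
noncomputable section

/-! ## Multiplying the element of a diagram by a generator -/

namespace Config
variable {n : ℕ}

/-- The undotted diagram with connectivity `p`. -/
def undot (p : Conn n) : Config (Pt n) := ⟨p, some fun _ => false⟩

theorem valid_undot {p : Conn n} (h : IsTLDiagram p) : (undot p).Valid :=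
  ⟨h, fun d hd x => by cases hd; rfl, fun d hd x hx => by cases hd; simp at hx⟩

theorem ins_undot {k : ℕ} (hk : 1 ≤ k) (σ : Config (Pt n)) :
    ins k (undot σ.conn) = undot (ins k σ).conn := by
  rw [ins_of_ne_zero (by omega), ins_of_ne_zero (by omega)]
  refine Config.ext rfl ?_
  simp only [insertAt, insert, undot, Option.map_some, ite_self]

theorem act_conn_ne_idConn {s : ℕ} (hn : 1 ≤ n) (hs : s ≤ n) (σ : Config (Pt n)) :
    (act s σ).conn ≠ idConn n := by
  have key : ∀ i : Fin (n + 1), i.val < n → (closeAt i σ).conn ≠ idConn n := by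
    intro i hi h
    have := congrFun h (footL i)
    simp only [closeAt, close_conn, join_left] at this
    simp only [idConn, footL, footR, Fin.ext_iff, Fin.val_rev] at this
    omega
  rcases Nat.eq_zero_or_pos s with rfl | h0
  · rw [act_zero_conn, act_of_ne_zero one_ne_zero]
    exact key _ (by rw [pos_val (by omega)]; omega)
  · rw [act_of_ne_zero (by omega)]
    exact key _ (by rw [pos_val (by omega)]; omega)

theorem isTL_zero {p : Conn 0} (hp : IsTLDiagram p) : p = idConn 0 := by
  funext x
  have := hp.2.1 x
  simp only [idConn, Fin.ext_iff, Fin.val_rev, ne_eq] at *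
  omega

theorem ins_top_conn {σ : Config (Pt n)} (h : σ.conn = idConn n) :
    (ins (n + 2) σ).conn = idConn (n + 1) := by
  rw [ins_conn]
  funext y
  have hp : (pos (n + 1) (n + 2)).val = n + 1 := by rw [pos_val (by omega)]; omega
  have hy := y.2
  simp only [insertAt, insert, h, idConn, Fin.ext_iff, footL, footR, hp, Fin.val_rev]
  split_ifs with h1 h2
  · simp only; omega
  · simp only; omega
  · simp only [skip, unskip, hp, Fin.val_rev]
    split_ifs <;> omega

theorem exists_canon {σ : Config (Pt (n + 1))} (h : σ.Valid) : ∃ k σ', k ≤ n + 2 ∧ σ'.Valid ∧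
    ins k σ' = σ ∧ canon (n + 1) σ = canon n σ' ++ ladder (n + 1) k := by
  obtain ⟨k, σ', h1, h2, h3⟩ := h.exists_ins
  have hex : ∃ x : ℕ × Config (Pt n), x.1 ≤ n + 2 ∧ x.2.Valid ∧ ins x.1 x.2 = σ :=
    ⟨(k, σ'), h1, h2, h3⟩
  refine ⟨hex.choose.1, hex.choose.2, hex.choose_spec.1, hex.choose_spec.2.1,
    hex.choose_spec.2.2, ?_⟩
  rw [canon, dif_pos hex]

theorem ladder_ne_nil {m k : ℕ} (h : k ≤ m) : ladder m k ≠ [] := by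
  unfold ladder
  split_ifs
  · simp
  · simp; omega

/-- An empty word leaves only insertions of a vertical strand at the far right. The lemma guarantees
a nonempty word for every other connectivity, which is needed because `addLoop` does not represent a
loop on the empty word. -/
theorem conn_of_canon_eq_nil {σ : Config (Pt n)} (h : σ.Valid) (hc : canon n σ = []) :
    σ.conn = idConn n := by
  induction n with
  | zero => exact isTL_zero h.isTL
  | succ n ih =>
    obtain ⟨k, σ', h1, h2, h3, h4⟩ := exists_canon h
    rw [hc] at h4
    obtain ⟨h5, h6⟩ := List.append_eq_nil_iff.1 h4.symm
    have hk : k = n + 2 := by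
      by_contra hk
      exact ladder_ne_nil (by omega) h6
    rw [← h3, hk]
    exact ins_top_conn (ih h2 h5)

end Config

open Config

section
variable {R : Type} [Ring R] [Algebra K R] {e : ℕ → R} {N : ℕ}

/-- A family of elements that is compatible with adding innermost caps is compatible with
multiplication by generators. -/
theorem DRel.mul_of_ins (h : DRel e N) (β : ∀ n, Config (Pt n) → R)
    (hins : ∀ n k (σ : Config (Pt n)), n + 1 ≤ N → k ≤ n + 2 → σ.Valid →
      (σ.dots ≠ none ∨ σ.conn ≠ idConn n) → β (n + 1) (ins k σ) = β n σ * lad e (n + 1) k)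
    (h01 : ∀ n (σ : Config (Pt n)), n + 1 ≤ N → σ.Valid → σ.dots ≠ none →
      β n σ * lad e (n + 1) 0 * e 1 = loopVal • β (n + 1) ⟨(ins 1 σ).conn, none⟩)
    (h10 : ∀ n (σ : Config (Pt n)), n + 1 ≤ N → σ.Valid → σ.dots ≠ none →
      β n σ * lad e (n + 1) 1 * e 0 = loopVal • β (n + 1) ⟨(ins 1 σ).conn, none⟩)
    {n s : ℕ} (hn : 1 ≤ n) (hN : n ≤ N) (hs : s ≤ n) {σ : Config (Pt n)} (hσ : σ.Valid)
    (hd : σ.dots ≠ none) :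
    β n σ * e s = loopVal ^ loops s σ.conn • β n (act s σ) := by
  induction n generalizing s with
  | zero => omega
  | succ n ih =>
    obtain ⟨k, τ, hk, hτ, rfl⟩ := hσ.exists_ins
    have hdτ : τ.dots ≠ none := by rwa [Ne, ins_dots_eq_none] at hd
    have hβ := fun k hk => hins n k τ hN hk hτ (Or.inl hdτ)
    -- The generator is disjoint from the last cap: it passes through the ladder as `E_t`, and
    -- induction applies to the smaller diagram.
    have hrec : ∀ t, 1 ≤ n → t ≤ n → loops s (ins k τ).conn = loops t τ.conn →
        act s (ins k τ) = ins k (act t τ) → lad e (n + 1) k * e s = e t * lad e (n + 1) k →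
        β (n + 1) (ins k τ) * e s =
          loopVal ^ loops s (ins k τ).conn • β (n + 1) (act s (ins k τ)) := by
      intro t hn1 ht hl ha hc
      rw [hβ k hk, mul_assoc, hc, ← mul_assoc, ih hn1 (by omega) ht hτ hdτ, ha, hl,
        hins n k (act t τ) hN hk (hτ.act t) (Or.inr (act_conn_ne_idConn hn1 ht τ)), smul_mul_assoc]
    -- The generator overlaps the last cap in one foot: no loop arises, and the cap is moved to the
    -- position of the generator.
    have hadj : s ≤ n + 2 → ((pos (n + 1) s).val = (pos (n + 1) k).val + 1 ∨
        (pos (n + 1) k).val = (pos (n + 1) s).val + 1) → act s (ins k τ) = ins s τ →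
        lad e (n + 1) k * e s = lad e (n + 1) s →
        β (n + 1) (ins k τ) * e s =
          loopVal ^ loops s (ins k τ).conn • β (n + 1) (act s (ins k τ)) := by
      intro hs2 hp ha hc
      rw [hβ k hk, mul_assoc, hc, ha, loops_ins_adj hp, pow_zero, one_smul, hβ s hs2]
    have pv := fun {m t : ℕ} (ht : t ≤ m + 1) => pos_val (n := m) ht
    rcases lt_trichotomy s k with hsk | rfl | hsk
    · rcases Nat.eq_zero_or_pos s with rfl | hs0
      -- Here `E_0` is put below an undotted cap at its own position. The resulting loop has one
      -- dot, and the hypothesis `h10` supplies its element; `h01` serves the opposite case.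
      · by_cases h1 : k = 1
        · subst h1
          rw [act_zero_ins_one, hβ 1 (by omega), h10 n τ hN hτ hdτ,
            loops_ins_of_pos (by rw [pos_one, pos_zero]), pow_one]
        by_cases h2 : k = 2
        · subst h2
          refine hadj (by omega) ?_ (act_zero_ins_two hτ.wf) ?_
          · rw [pv (by omega), pv (by omega)]; omega
          · rw [lad_zero]
        · refine hrec 0 (by omega) (by omega) ?_ (act_zero_ins (by omega) hk τ)
            (h.lad_mul_lt hN (by omega) (by omega) (by omega) (by omega))
          refine loops_ins_lt ?_ ?_ τ
          · rw [pv (by omega), pv (by omega)]; omega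
          · rw [pv (by omega), pv (by omega)]
      · rcases Nat.eq_or_lt_of_le (Nat.succ_le_of_lt hsk) with h1 | h1
        · subst h1
          refine hadj (by omega) ?_ (act_ins_succ hs0 (by omega) hτ.wf) ?_
          · rw [pv (by omega), pv (by omega)]; omega
          · exact (lad_last hs0 (by omega)).symm
        · refine hrec s (by omega) (by omega) ?_ (act_ins_lt hs0 (by omega) hk τ)
            (h.lad_mul_lt hN (by omega) (by omega) (by omega) (by omega))
          refine loops_ins_lt ?_ ?_ τ
          · rw [pv (by omega), pv (by omega)]; omega
          · rw [pv (by omega), pv (by omega)]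
    · rw [act_ins_self, hβ s hk, mul_assoc, h.lad_mul_self hN (by omega) (by omega),
        loops_ins_of_pos rfl, mul_smul_comm, pow_one]
    · rcases Nat.eq_zero_or_pos k with rfl | hk0
      · by_cases h1 : s = 1
        · subst h1
          rw [act_one_ins_zero, hβ 0 (by omega), h01 n τ hN hτ hdτ,
            loops_ins_of_pos (by rw [pos_one, pos_zero]), pow_one]
        by_cases h2 : s = 2
        · subst h2
          refine hadj (by omega) ?_ (act_two_ins_zero (by omega) hτ.wf) ?_
          · rw [pv (by omega), pv (by omega)]; omega
          · exact h.lad_zero_mul_two hN (by omega)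
        by_cases h3 : s = 3
        · subst h3
          refine hrec 0 (by omega) (by omega) ?_ (act_three_ins_zero (by omega) hτ.wf)
            (h.lad_zero_mul_three hN (by omega))
          refine loops_ins_gt ?_ ?_ τ
          · rw [pv (by omega), pv (by omega)]
          · rw [pv (by omega), pv (by omega)]
        · obtain ⟨t, rfl⟩ : ∃ t, s = t + 2 := ⟨s - 2, by omega⟩
          refine hrec t (by omega) (by omega) ?_ (act_ins_zero_gt (by omega) (by omega) hτ.wf)
            (h.lad_zero_mul_gt hN (by omega) (by omega))
          refine loops_ins_gt ?_ ?_ τ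
          · rw [pv (by omega), pv (by omega)]; omega
          · rw [pv (by omega), pv (by omega)]; omega
      · rcases Nat.eq_or_lt_of_le (Nat.succ_le_of_lt hsk) with h1 | h1
        · subst h1
          refine hadj (by omega) ?_ (act_succ_ins hk0 (by omega) hτ.wf) ?_
          · rw [pv (by omega), pv (by omega)]; omega
          · exact h.lad_mul_succ hN hk0 (by omega)
        · obtain ⟨t, rfl⟩ : ∃ t, s = t + 2 := ⟨s - 2, by omega⟩
          refine hrec t (by omega) (by omega) ?_ (act_ins_gt hk0 (by omega) (by omega) τ)
            (h.lad_mul_gt hN hk0 (by omega) (by omega))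
          refine loops_ins_gt ?_ ?_ τ
          · rw [pv (by omega), pv (by omega)]; omega
          · rw [pv (by omega), pv (by omega)]; omega
end

theorem mem_ladder_le {m k s : ℕ} (hm : 1 ≤ m) (h : s ∈ ladder m k) : s ≤ m := by
  unfold ladder at h
  split_ifs at h
  · rcases List.mem_append.1 h with hs | hs
    · rw [List.mem_reverse, List.mem_range'_1] at hs; omega
    · simp at hs; omega
  · rw [List.mem_reverse, List.mem_range'_1] at h; omega

theorem lad_eA_zero {N m : ℕ} (hm : 1 ≤ m) : lad (eA N) m 0 = lad (eA N) m 1 := by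
  rw [lad_zero, lad_one hm, eA_zero]

/-- The element of `TL^A_{N+1}` of a connectivity. -/
def eltA (N : ℕ) {n : ℕ} (p : Conn n) : TLA N := evCanon (eA N) (undot p)

theorem eltA_ins {N n k : ℕ} (hN : n + 1 ≤ N) (hk : k ≤ n + 2) {σ : Config (Pt n)} (hσ : σ.Valid) :
    eltA N (ins k σ).conn = eltA N σ.conn * lad (eA N) (n + 1) k := by
  have key : ∀ k, 1 ≤ k → k ≤ n + 2 →
      eltA N (ins k σ).conn = eltA N σ.conn * lad (eA N) (n + 1) k := fun k hk1 hk => by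
    unfold eltA
    rw [← ins_undot hk1, (dRel_eA N).evCanon_ins hN hk (valid_undot hσ.isTL) (by simp [undot])]
  rcases Nat.eq_zero_or_pos k with rfl | hk0
  · rw [ins_zero_conn, lad_eA_zero (by omega)]
    exact key 1 le_rfl (by omega)
  · exact key k hk0 hk

/-- A degenerate case of the induction for type `D`: with `E_0 = E_1` the two hypotheses on dotted
loops reduce to a ladder multiplied by its own last letter. -/
theorem eltA_mul {N n s : ℕ} (hn : 1 ≤ n) (hN : n ≤ N) (hs : s ≤ n) {σ : Config (Pt n)}
    (hσ : σ.Valid) :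
    eltA N σ.conn * eA N s = loopVal ^ loops s σ.conn • eltA N (act s σ).conn := by
  have h := dRel_eA N
  have key : ∀ n (σ : Config (Pt n)), n + 1 ≤ N → σ.Valid →
      eltA N σ.conn * lad (eA N) (n + 1) 1 * eA N 1 = loopVal • eltA N (ins 1 σ).conn := by
    intro n σ hN hσ
    rw [mul_assoc, h.lad_mul_self hN (by omega) (by omega), mul_smul_comm,
      eltA_ins hN (by omega) hσ]
  have := h.mul_of_ins (fun n σ => eltA N σ.conn) (fun n k σ hN hk hσ _ => eltA_ins hN hk hσ)
    (fun n σ hN hσ _ => by rw [lad_eA_zero (by omega)]; exact key n σ hN hσ)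
    (fun n σ hN hσ _ => by rw [eA_zero]; exact key n σ hN hσ) hn hN hs (valid_undot hσ.isTL)
    (by simp [undot])
  rw [show (undot σ.conn).conn = σ.conn from rfl] at this
  rw [this, act_conn_congr s (show (undot σ.conn).conn = σ.conn from rfl)]

theorem forget_lad {N m k : ℕ} (hm : 1 ≤ m) (hN : m ≤ N) :
    forget N (lad (eD N) m k) = lad (eA N) m k :=
  forget_ev fun s hs => (mem_ladder_le hm hs).trans hN

/-- Ladders ending in `E_0` and `E_1` have the same image, so only the connectivity survives. -/
theorem forget_evCanon {N n : ℕ} (hN : n ≤ N) {σ : Config (Pt n)} (hσ : σ.Valid)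
    (hd : σ.dots ≠ none) : forget N (evCanon (eD N) σ) = eltA N σ.conn := by
  induction n with
  | zero => simp [evCanon, canon, eltA]
  | succ n ih =>
    obtain ⟨k, τ, hk, hτ, rfl⟩ := hσ.exists_ins
    have hdτ : τ.dots ≠ none := by rwa [Ne, ins_dots_eq_none] at hd
    rw [(dRel_eD N).evCanon_ins hN hk hτ hdτ, map_mul, ih (by omega) hτ hdτ,
      forget_lad (by omega) hN, eltA_ins hN hk hτ]

open Classical in
/-- The element of `TL^D_{N+1}` of a diagram, where a diagram with a dotted loop is divided by
the value of a loop. -/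
def eltD (N : ℕ) {n : ℕ} (σ : Config (Pt n)) : TLD N :=
  if σ.dots = none then loopVal⁻¹ • addLoop N (eltA N σ.conn) else evCanon (eD N) σ

theorem q_ne_zero : q ≠ 0 := RatFunc.X_ne_zero

theorem q_pow_ne_one {m : ℕ} (hm : 1 ≤ m) : q ^ m ≠ 1 := by
  intro h
  have h1 : algebraMap (Polynomial ℂ) (RatFunc ℂ) (Polynomial.X ^ m) =
      algebraMap (Polynomial ℂ) (RatFunc ℂ) 1 := by
    rw [map_pow, RatFunc.algebraMap_X, map_one]; exact h
  have h2 := congrArg Polynomial.natDegree (RatFunc.algebraMap_injective ℂ h1)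
  rw [Polynomial.natDegree_X_pow, Polynomial.natDegree_one] at h2
  omega

theorem q_sub_inv_ne_zero : q - q⁻¹ ≠ 0 := by
  intro h
  have h1 : q * q = 1 := by
    nth_rewrite 2 [sub_eq_zero.1 h]; exact mul_inv_cancel₀ q_ne_zero
  exact q_pow_ne_one (m := 2) (by omega) (by rw [pow_two, h1])

theorem qInt_ne_zero {m : ℕ} (hm : 1 ≤ m) : qInt m ≠ 0 := by
  refine div_ne_zero (fun h => ?_) q_sub_inv_ne_zero
  refine q_pow_ne_one (m := m + m) (by omega) ?_
  rw [pow_add]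
  nth_rewrite 2 [sub_eq_zero.1 h]
  exact mul_inv_cancel₀ (pow_ne_zero _ q_ne_zero)

theorem loopVal_ne_zero : loopVal ≠ 0 := neg_ne_zero.2 (qInt_ne_zero (by omega))

theorem addLoop_eltA_mul_ev {N n : ℕ} (h1 : 1 ≤ N) (hN : n ≤ N) {p : Conn n} (hp : IsTLDiagram p)
    (hp1 : p ≠ idConn n) {v : List ℕ} (hv : ∀ s ∈ v, s ≤ N) :
    addLoop N (eltA N p) * ev (eD N) v = addLoop N (eltA N p * ev (eA N) v) := by
  have := addLoop_mul_ev h1 (w := canon n (undot p)) (v := v)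
    (fun h => hp1 (conn_of_canon_eq_nil (valid_undot hp) h))
    (fun t ht => (act_mem_canon _ t ht).trans hN) hv
  rw [ev_append] at this
  exact this

theorem evCanon_mul_addLoop {N n : ℕ} (h1 : 1 ≤ N) (hN : n ≤ N) {σ : Config (Pt n)} (hσ : σ.Valid)
    (hd : σ.dots ≠ none) {v : List ℕ} (hv0 : v ≠ []) (hv : ∀ s ∈ v, s ≤ N) :
    evCanon (eD N) σ * addLoop N (ev (eA N) v) = addLoop N (eltA N σ.conn * ev (eA N) v) := by
  have h2 : ∀ t ∈ canon n σ, t ≤ N := fun t ht => (act_mem_canon _ t ht).trans hN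
  have := ev_mul_addLoop h1 (w := v) (v := canon n σ) hv0 hv h2
  rw [ev_append] at this
  rw [← forget_evCanon hN hσ hd]
  unfold evCanon
  rw [this, forget_ev h2]

theorem eltD_ins {N n k : ℕ} (hN : n + 1 ≤ N) (hk : k ≤ n + 2) {σ : Config (Pt n)} (hσ : σ.Valid)
    (h : σ.dots ≠ none ∨ σ.conn ≠ idConn n) :
    eltD N (ins k σ) = eltD N σ * lad (eD N) (n + 1) k := by
  unfold eltD
  simp only [ins_dots_eq_none]
  split_ifs with hd
  · rw [smul_mul_assoc]
    unfold lad
    rw [addLoop_eltA_mul_ev (by omega) (by omega) hσ.isTL (h.resolve_left (not_not_intro hd))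
      (fun s hs => (mem_ladder_le (by omega) hs).trans hN), eltA_ins hN hk hσ]
    rfl
  · exact (dRel_eD N).evCanon_ins hN hk hσ hd

theorem addLoop_lad_one {N m : ℕ} (hm : 1 ≤ m) (hN : m ≤ N) :
    addLoop N (lad (eA N) m 1) = lad (eD N) m 2 * (eD N 0 * eD N 1) := by
  have h1 : addLoop N (ev (eA N) [1]) = eD N 0 * eD N 1 := by
    rw [addLoop_ev (by omega) 1 [] (by omega) (by simp)]
    simp [dloop]
  have h2 : ∀ t ∈ ladder m 2, t ≤ N := fun t ht => (mem_ladder_le hm ht).trans hN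
  have := ev_mul_addLoop (N := N) (by omega) (w := [1]) (v := ladder m 2) (by simp)
    (by simp; omega) h2
  rw [h1, ev_append] at this
  rw [lad_one hm]
  unfold lad
  rw [this]
  simp

/-- Dividing by the value of a loop in `eltD` makes the creation of a dotted loop cost the same
factor as that of an ordinary one. One formula then covers both, and the induction `DRel.mul_of_ins`
applies. -/
theorem eltD_mul {N n s : ℕ} (hn : 1 ≤ n) (hN : n ≤ N) (hs : s ≤ n) {σ : Config (Pt n)}
    (hσ : σ.Valid) (h : σ.dots ≠ none ∨ σ.conn ≠ idConn n) :
    eltD N σ * eD N s = loopVal ^ loops s σ.conn • eltD N (act s σ) := by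
  by_cases hd : σ.dots = none
  · have hd' : (act s σ).dots = none := by
      obtain ⟨p, d⟩ := σ
      simp only at hd
      subst hd
      exact act_none s p
    rw [eltD, if_pos hd, eltD, if_pos hd', smul_mul_assoc]
    have := addLoop_eltA_mul_ev (N := N) (v := [s]) (by omega) hN hσ.isTL
      (h.resolve_left (not_not_intro hd)) (by simp; omega)
    simp only [ev_cons, ev_nil, mul_one] at this
    rw [this, eltA_mul hn hN hs hσ, map_smul, smul_comm]
  · have hR := dRel_eD N
    have key : ∀ n (σ : Config (Pt n)), n + 1 ≤ N → σ.Valid → σ.dots ≠ none →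
        eltD N σ * (lad (eD N) (n + 1) 2 * (eD N 0 * eD N 1)) =
          loopVal • eltD N (⟨(ins 1 σ).conn, none⟩ : Config (Pt (n + 1))) := by
      intro n σ hN hσ hd
      rw [eltD, if_neg hd, eltD, if_pos rfl, smul_smul, mul_inv_cancel₀ loopVal_ne_zero, one_smul,
        ← addLoop_lad_one (by omega) hN]
      simp only
      rw [eltA_ins hN (by omega) hσ]
      exact evCanon_mul_addLoop (by omega) (by omega) hσ hd (ladder_ne_nil (by omega))
        (fun s hs => (mem_ladder_le (by omega) hs).trans hN)
    refine hR.mul_of_ins (fun n σ => eltD N σ) (fun n k σ hN hk hσ h => eltD_ins hN hk hσ h)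
      (fun n σ hN hσ hd => ?_) (fun n σ hN hσ hd => ?_) hn hN hs hσ hd
    · rw [← key n σ hN hσ hd, lad_zero]; simp only [mul_assoc]
    · rw [← key n σ hN hσ hd, lad_one (by omega), hR.comm 0 1 (by omega) (by omega)
        (by unfold AdjD; omega)]
      simp only [mul_assoc]

theorem forget_eltD {N n : ℕ} (h1 : 1 ≤ N) (hN : n ≤ N) {σ : Config (Pt n)} (hσ : σ.Valid)
    (h : σ.dots ≠ none ∨ σ.conn ≠ idConn n) : forget N (eltD N σ) = eltA N σ.conn := by
  by_cases hd : σ.dots = none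
  · rw [eltD, if_pos hd, map_smul]
    have := forget_addLoop h1 (w := canon n (undot σ.conn))
      (fun hc => h.resolve_left (not_not_intro hd) (conn_of_canon_eq_nil (σ := undot σ.conn) (valid_undot hσ.isTL) hc))
      (fun t ht => (act_mem_canon _ t ht).trans hN)
    rw [eltA, evCanon, this, smul_smul, inv_mul_cancel₀ loopVal_ne_zero, one_smul]
  · rw [eltD, if_neg hd, forget_evCanon hN hσ hd]

end
end TemperleyLieb

namespace TemperleyLieb
noncomputable section

/-! ## Bases of diagrams -/

/-- A diagrammatic description of a basis of a Temperley--Lieb algebra. -/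
structure DiagramModel {V : Type} (G : SimpleGraph V) (S : Type) where
  /-- the diagram of the empty word -/
  one : S
  /-- multiplication by a generator -/
  step : V → S → S
  /-- the scalar that arises from multiplication by a generator -/
  weight : V → S → K
  /-- the element that is represented by a diagram -/
  elt : S → TL G
  weight_ne_zero : ∀ s σ, weight s σ ≠ 0
  step_step : ∀ s σ, step s (step s σ) = step s σ
  weight_step : ∀ s σ, weight s (step s σ) = loopVal
  step_braid : ∀ s t σ, G.Adj s t → step s (step t (step s σ)) = step s σ
  weight_braid : ∀ s t σ, G.Adj s t → weight t (step s σ) * weight s (step t (step s σ)) = 1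
  step_comm : ∀ s t σ, ¬ G.Adj s t → step s (step t σ) = step t (step s σ)
  weight_comm : ∀ s t σ, ¬ G.Adj s t →
    weight t σ * weight s (step t σ) = weight s σ * weight t (step s σ)
  elt_one : elt one = 1
  elt_mul : ∀ s σ, elt σ * E G s = elt (step s σ) ∨
    (step s σ = σ ∧ elt σ * E G s = loopVal • elt σ)
  exists_word : ∀ σ, ∃ w : List V, w.foldl (fun σ s => step s σ) one = σ

namespace DiagramModel
variable {V : Type} {G : SimpleGraph V} {S : Type} (M : DiagramModel G S)

/-- The diagram of a word. -/
def state (w : List V) : S := w.foldl (fun σ s => M.step s σ) M.one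

theorem state_append_singleton (w : List V) (s : V) :
    M.state (w ++ [s]) = M.step s (M.state w) := by simp [state]

theorem word_append (v w : List V) : word G (v ++ w) = word G v * word G w := by simp [word]

theorem word_singleton (s : V) : word G [s] = E G s := by simp [word]

/-- The action of a generator. -/
def stepMap (s : V) : Module.End K (S →₀ K) :=
  Finsupp.lift (S →₀ K) K S fun σ => Finsupp.single (M.step s σ) (M.weight s σ)

theorem stepMap_single (s : V) (σ : S) (c : K) :
    M.stepMap s (Finsupp.single σ c) = Finsupp.single (M.step s σ) (c * M.weight s σ) := by
  simp [stepMap]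

theorem end_ext {f g : Module.End K (S →₀ K)}
    (h : ∀ σ, f (Finsupp.single σ 1) = g (Finsupp.single σ 1)) : f = g := by
  refine Finsupp.lhom_ext fun σ c => ?_
  have : Finsupp.single σ c = c • Finsupp.single σ (1 : K) := by simp
  rw [this, map_smul, map_smul, h]

/-- The regular representation in terms of diagrams. -/
def rep : TL G →ₐ[K] (Module.End K (S →₀ K))ᵐᵒᵖ :=
  liftTL (fun s => MulOpposite.op (M.stepMap s))
    (fun s => by
      rw [← MulOpposite.op_mul, ← MulOpposite.op_smul]
      congr 1
      refine end_ext fun σ => ?_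
      rw [Module.End.mul_apply, LinearMap.smul_apply, stepMap_single, stepMap_single, M.step_step,
        M.weight_step, Finsupp.smul_single, smul_eq_mul, mul_comm])
    (fun s t h => by
      rw [← MulOpposite.op_mul, ← MulOpposite.op_mul]
      congr 1
      refine end_ext fun σ => ?_
      rw [Module.End.mul_apply, Module.End.mul_apply, stepMap_single, stepMap_single,
        stepMap_single, M.step_braid s t σ h, mul_assoc, M.weight_braid s t σ h, mul_one])
    (fun s t h => by
      rw [← MulOpposite.op_mul, ← MulOpposite.op_mul]
      congr 1
      refine end_ext fun σ => ?_
      rw [Module.End.mul_apply, Module.End.mul_apply, stepMap_single, stepMap_single,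
        stepMap_single, stepMap_single, M.step_comm s t σ h, mul_assoc, mul_assoc, one_mul, one_mul,
        M.weight_comm s t σ h])

/-- The coordinates of an element with respect to the diagrams, up to scalars. -/
def coords : TL G →ₗ[K] S →₀ K where
  toFun x := (M.rep x).unop (Finsupp.single M.one 1)
  map_add' x y := by simp
  map_smul' r x := by simp

/-- Each generator sends a diagram to a nonzero multiple of a diagram. So the diagram of a word can
be recovered from its value in the algebra, even up to scalars; this separates the diagrams. -/
theorem coords_word (w : List V) :
    ∃ c : K, c ≠ 0 ∧ M.coords (word G w) = Finsupp.single (M.state w) c := by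
  induction w using List.reverseRecOn with
  | nil => exact ⟨1, one_ne_zero, by simp [coords, word, state]⟩
  | append_singleton w s ih =>
    obtain ⟨c, hc, h⟩ := ih
    refine ⟨c * M.weight s (M.state w), mul_ne_zero hc (M.weight_ne_zero _ _), ?_⟩
    rw [word_append, word_singleton, state_append_singleton, ← stepMap_single, ← h]
    change (M.rep (_ * _)).unop _ = _
    rw [map_mul, MulOpposite.unop_mul, Module.End.mul_apply, rep, liftTL_E]
    rfl

/-- A letter that only creates a loop is dropped in exchange for a factor `loopVal`. The word that
remains is equal to the element of its diagram. -/
theorem exists_shorter (w : List V) : ∃ (w' : List V) (k : ℕ), w'.length + k = w.length ∧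
    M.state w' = M.state w ∧ word G w' = M.elt (M.state w') ∧
    word G w = loopVal ^ k • word G w' := by
  induction w using List.reverseRecOn with
  | nil => exact ⟨[], 0, rfl, rfl, by simp [word, state, M.elt_one], by simp⟩
  | append_singleton w s ih =>
    obtain ⟨w', k, h1, h2, h3, h4⟩ := ih
    rcases M.elt_mul s (M.state w) with h | ⟨h, h'⟩
    · refine ⟨w' ++ [s], k, ?_, ?_, ?_, ?_⟩
      · simp only [List.length_append, List.length_singleton]; omega
      · rw [state_append_singleton, state_append_singleton, h2]
      · rw [word_append, word_singleton, state_append_singleton, h3, h2, h]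
      · rw [word_append, word_append, h4, smul_mul_assoc]
    · refine ⟨w', k + 1, ?_, ?_, h3, ?_⟩
      · simp only [List.length_append, List.length_singleton]; omega
      · rw [state_append_singleton, h2, h]
      · rw [word_append, word_singleton, h4, h3, h2, smul_mul_assoc, h', smul_smul, pow_succ]

theorem exists_coords_elt (σ : S) :
    ∃ c : K, c ≠ 0 ∧ M.coords (M.elt σ) = Finsupp.single σ c := by
  obtain ⟨w, hw⟩ := M.exists_word σ
  change M.state w = σ at hw
  obtain ⟨w', k, h1, h2, h3, h4⟩ := M.exists_shorter w
  obtain ⟨c, hc, h⟩ := M.coords_word w'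
  rw [h2, hw] at h
  rw [h3, h2, hw] at h
  exact ⟨c, hc, h⟩

theorem elt_injective : Function.Injective M.elt := by
  intro σ τ h
  obtain ⟨c, hc, h1⟩ := M.exists_coords_elt σ
  obtain ⟨c', hc', h2⟩ := M.exists_coords_elt τ
  rw [h, h2, Finsupp.single_eq_single_iff] at h1
  rcases h1 with h1 | h1
  · exact h1.1.symm
  · exact absurd h1.2 hc

theorem linearIndependent_elt : LinearIndependent K M.elt := by
  choose c hc h using M.exists_coords_elt
  refine LinearIndependent.of_comp M.coords ?_
  have := (Finsupp.basisSingleOne (R := K) (ι := S)).linearIndependent.units_smul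
    (fun σ => Units.mk0 (c σ) (hc σ))
  convert this using 1
  funext σ
  simp [h, Units.smul_def]

theorem span_elt : Submodule.span K (Set.range M.elt) = ⊤ := by
  rw [eq_top_iff, ← span_word, Submodule.span_le]
  rintro _ ⟨w, rfl⟩
  obtain ⟨w', k, h1, h2, h3, h4⟩ := M.exists_shorter w
  rw [h4, h3]
  exact Submodule.smul_mem _ _ (Submodule.subset_span ⟨_, rfl⟩)

/-- In a reduced word no letter can be dropped, so the number of extracted loops is zero. -/
theorem word_eq_elt {w : List V} (hw : IsReducedWord G w) : word G w = M.elt (M.state w) := by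
  obtain ⟨w', k, h1, h2, h3, h4⟩ := M.exists_shorter w
  have := hw w' _ h4
  have hk : k = 0 := by omega
  rw [h4, h3, h2, hk, pow_zero, one_smul]

/-- A shortest word among those with diagram `σ` and value `elt σ` is reduced: a proportional word
has the same diagram by its coordinates, and removing its loops gives a competitor. -/
theorem exists_reduced (σ : S) : ∃ w, IsReducedWord G w ∧ M.state w = σ := by
  classical
  have hex : ∃ l : ℕ, ∃ w : List V, w.length = l ∧ M.state w = σ ∧ word G w = M.elt σ := by
    obtain ⟨w, hw⟩ := M.exists_word σ
    change M.state w = σ at hw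
    obtain ⟨w', k, h1, h2, h3, h4⟩ := M.exists_shorter w
    exact ⟨_, w', rfl, h2.trans hw, by rw [h3, h2, hw]⟩
  obtain ⟨w, h1, h2, h3⟩ := Nat.find_spec hex
  refine ⟨w, fun v c hv => ?_, h2⟩
  obtain ⟨v', k, g1, g2, g3, g4⟩ := M.exists_shorter v
  obtain ⟨a, ha, ha'⟩ := M.coords_word w
  obtain ⟨a', hb, hb'⟩ := M.coords_word v
  have hs : M.state v = σ := by
    rw [hv, map_smul, hb', Finsupp.smul_single, Finsupp.single_eq_single_iff] at ha'
    rcases ha' with h | h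
    · rw [h.1, h2]
    · exact absurd h.2 ha
  have := Nat.find_min' hex ⟨v', rfl, g2.trans hs, by rw [g3, g2, hs]⟩
  omega

theorem monomials_eq : monomials G = Set.range M.elt := by
  ext x
  constructor
  · rintro ⟨w, hw, rfl⟩
    exact ⟨_, (M.word_eq_elt hw).symm⟩
  · rintro ⟨σ, rfl⟩
    obtain ⟨w, hw, h⟩ := M.exists_reduced σ
    exact ⟨w, hw, by rw [M.word_eq_elt hw, h]⟩

theorem monomialsFormBasis (M : DiagramModel G S) : MonomialsFormBasis G := by
  constructor
  · have := M.linearIndependent_elt.linearIndepOn_id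
    rw [← M.monomials_eq] at this
    exact this
  · rw [Subtype.range_coe, M.monomials_eq, M.span_elt]

/-- The basis of diagrams. -/
def basis : Module.Basis S K (TL G) :=
  Module.Basis.mk M.linearIndependent_elt M.span_elt.ge

@[simp] theorem basis_apply (σ : S) : M.basis σ = M.elt σ := by simp [basis]

/-- `coeff` refers to the basis indexed by the monomials themselves. The two coordinate functionals
are compared on the basis of diagrams. -/
theorem coeff_elt (x : TL G) (σ : S) : coeff x (M.elt σ) = M.basis.repr x σ := by
  classical
  have hm : M.elt σ ∈ monomials G := by rw [M.monomials_eq]; exact ⟨σ, rfl⟩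
  have h : MonomialsFormBasis G ∧ M.elt σ ∈ monomials G := ⟨M.monomialsFormBasis, hm⟩
  rw [coeff, dif_pos h]
  set B := Module.Basis.mk h.1.1 h.1.2 with hB
  have key : (Finsupp.lapply (⟨M.elt σ, h.2⟩ : monomials G)) ∘ₗ B.repr.toLinearMap =
      (Finsupp.lapply σ) ∘ₗ M.basis.repr.toLinearMap := by
    refine M.basis.ext fun τ => ?_
    have hτ : M.elt τ ∈ monomials G := by rw [M.monomials_eq]; exact ⟨τ, rfl⟩
    have h1 : M.elt τ = B ⟨M.elt τ, hτ⟩ := by rw [hB, Module.Basis.mk_apply]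
    simp only [LinearMap.comp_apply, LinearEquiv.coe_coe, Finsupp.lapply_apply,
      Module.Basis.repr_self]
    rw [basis_apply, h1, Module.Basis.repr_self, Finsupp.single_apply, Finsupp.single_apply]
    refine if_congr ⟨fun h => M.elt_injective (congrArg Subtype.val h), fun h => by
      subst h; rfl⟩ rfl rfl
  exact LinearMap.congr_fun key x

theorem isReducedWord_of_append {v w : List V} (h : IsReducedWord G (v ++ w)) :
    IsReducedWord G v := by
  intro v' c hv
  have := h (v' ++ w) c (by rw [word_append, word_append, hv, smul_mul_assoc])
  simp only [List.length_append] at this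
  omega

/-- If the last letter left the diagram unchanged, the word without it would have the same value.
This excludes ordinary loops while the graphical representation of a reduced word is built. -/
theorem step_ne_of_isReducedWord {w : List V} {s : V} (h : IsReducedWord G (w ++ [s])) :
    M.step s (M.state w) ≠ M.state w := by
  intro hs
  have h1 := M.word_eq_elt h
  rw [state_append_singleton, hs, ← M.word_eq_elt (isReducedWord_of_append h)] at h1
  have := h w 1 (by rw [one_smul, h1])
  simp at this

end DiagramModel
end
end TemperleyLieb

namespace TemperleyLieb
noncomputable section

/-! ## Relations between the actions of the generators on diagrams -/

namespace Config
variable {n : ℕ}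

theorem act_conn (s : ℕ) (σ : Config (Pt n)) :
    (act s σ).conn = join (footL (pos n s)) (footR (pos n s)) σ.conn := by
  rcases Nat.eq_zero_or_pos s with rfl | hs
  · rw [act_zero_conn, pos_zero, ← pos_one]; rfl
  · rw [act_of_ne_zero (by omega)]; rfl

theorem act_act (s : ℕ) (σ : Config (Pt n)) : act s (act s σ) = act s σ := by
  have key : ∀ s, s ≠ 0 → ∀ σ : Config (Pt n), act s (act s σ) = act s σ := by
    intro s hs σ
    rw [act_of_ne_zero hs, act_of_ne_zero hs]
    exact close_close (footL_ne_footR _)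
  rcases Nat.eq_zero_or_pos s with rfl | hs
  · rw [act_zero, act_zero, toggle_toggle, key 1 one_ne_zero]
  · exact key s (by omega) σ

theorem act_braid {s t : ℕ} (hs : s ≤ n) (ht : t ≤ n) (h : AdjD s t) {σ : Config (Pt n)}
    (hσ : σ.Wf) : act s (act t (act s σ)) = act s σ := by
  have key : ∀ s, 1 ≤ s → s + 1 ≤ n → ∀ σ : Config (Pt n), σ.Wf →
      act s (act (s + 1) (act s σ)) = act s σ ∧
      act (s + 1) (act s (act (s + 1) σ)) = act (s + 1) σ := by
    intro s hs1 hs2 σ hσ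
    simp only [act_of_ne_zero (show s ≠ 0 by omega), act_of_ne_zero (show s + 1 ≠ 0 by omega)]
    have hp : (pos n (s + 1)).val = (pos n s).val + 1 := by
      rw [pos_val (by omega), pos_val (by omega)]; omega
    have e1 := footR_eq_footL hp
    have h1 := footL_ne_footR (pos n s)
    have h2 := footL_ne_footR (pos n (s + 1))
    have h3 := footL_ne_footR' (i := pos n s) (j := pos n (s + 1)) (by omega)
    unfold closeAt
    rw [← e1] at h2 ⊢
    refine ⟨close_braid h1 h3 h2 hσ, ?_⟩
    rw [close_symm hσ, close_symm (hσ.close h2.symm), close_symm ((hσ.close h2.symm).close h1.symm)]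
    exact close_braid h2.symm h3.symm h1.symm hσ
  rcases h with ⟨rfl, rfl⟩ | ⟨rfl, rfl⟩ | ⟨h1, rfl⟩ | ⟨h1, rfl⟩
  · rw [act_zero σ, ← toggle_act le_rfl ht (hσ.toggle.act 1), act_zero, toggle_toggle,
      (key 1 le_rfl ht _ hσ.toggle).1]
  · rw [act_zero (act 2 σ), toggle_act le_rfl hs hσ, ← toggle_act le_rfl hs ((hσ.toggle.act 2).act 1),
      (key 1 le_rfl hs _ hσ.toggle).2, toggle_act le_rfl hs hσ.toggle, toggle_toggle]
  · exact (key s h1 ht σ hσ).1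
  · exact (key t h1 hs σ hσ).2

/-- Nodes that are not adjacent either share their position, as `0` and `1` do, or have disjoint
feet. -/
theorem pos_add_two_le {s t : ℕ} (hs : s ≤ n) (ht : t ≤ n) (h : ¬ AdjD s t) :
    pos n s = pos n t ∨ (pos n s).val + 2 ≤ (pos n t).val ∨ (pos n t).val + 2 ≤ (pos n s).val := by
  unfold AdjD at h
  rw [Fin.ext_iff, pos_val (by omega), pos_val (by omega)]
  omega

theorem act_comm {s t : ℕ} (hs : s ≤ n) (ht : t ≤ n) (h : ¬ AdjD s t) {σ : Config (Pt n)}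
    (hσ : σ.Wf) : act s (act t σ) = act t (act s σ) := by
  have far : ∀ s t, 1 ≤ s → s + 2 ≤ t → t ≤ n → ∀ σ : Config (Pt n), σ.Wf →
      act s (act t σ) = act t (act s σ) := by
    intro s t hs hst ht σ hσ
    simp only [act_of_ne_zero (show s ≠ 0 by omega), act_of_ne_zero (show t ≠ 0 by omega)]
    have hp : (pos n s).val + 2 ≤ (pos n t).val := by
      rw [pos_val (by omega), pos_val (by omega)]; omega
    refine close_comm (footL_ne_footR _) (footL_ne_footR _) ?_ ?_ ?_ ?_ hσ <;>
    · simp only [footL, footR, ne_eq, Fin.ext_iff]; omega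
  have hz : ∀ t, 3 ≤ t → t ≤ n → ∀ σ : Config (Pt n), σ.Wf →
      act 0 (act t σ) = act t (act 0 σ) := by
    intro t ht htn σ hσ
    rw [act_zero, toggle_act (by omega) htn hσ, far 1 t le_rfl ht htn _ hσ.toggle,
      toggle_act (by omega) htn (hσ.toggle.act 1), ← act_zero]
  -- The two generators share their position and differ in a dot, so in either order a dotted loop
  -- is deleted, and only the connectivity remains to be compared.
  have h01 : act 0 (act 1 σ) = act 1 (act 0 σ) := by
    have h1 : ∀ σ : Config (Pt n), act 1 (toggle (act 1 σ)) = ⟨(act 1 σ).conn, none⟩ := by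
      intro σ
      simp only [act_of_ne_zero one_ne_zero, pos_one, closeAt, toggle]
      rw [close_flip_close (footL_ne_footR 0), close_conn]
    rw [act_zero, h1, act_zero, h1]
    exact Config.ext (act_conn_congr _ rfl) rfl
  unfold AdjD at h
  rcases Nat.lt_trichotomy s t with hst | rfl | hst
  · rcases Nat.eq_zero_or_pos s with rfl | hs0
    · by_cases h1 : t = 1
      · rw [h1]; exact h01
      · exact hz t (by omega) ht σ hσ
    · exact far s t hs0 (by omega) ht σ hσ
  · rfl
  · rcases Nat.eq_zero_or_pos t with rfl | hs0
    · by_cases h1 : s = 1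
      · rw [h1]; exact h01.symm
      · exact (hz s (by omega) hs σ hσ).symm
    · exact (far t s hs0 (by omega) hs σ hσ).symm

theorem loops_act_of_pos {s t : ℕ} (h : pos n s = pos n t) (σ : Config (Pt n)) :
    loops s (act t σ).conn = 1 := by
  rw [loops, act_conn, h, join_left, if_pos rfl]

theorem loops_act_adj {s t : ℕ} (hs : s ≤ n) (ht : t ≤ n) (h : AdjD s t) {σ : Config (Pt n)}
    (hσ : σ.Wf) : loops t (act s σ).conn = 0 := by
  have hw := (hσ.act s).inv
  have h1 : (act s σ).conn (footL (pos n s)) = footR (pos n s) := by rw [act_conn, join_left]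
  have hp : (pos n t).val = (pos n s).val + 1 ∨ (pos n s).val = (pos n t).val + 1 := by
    unfold AdjD at h
    rw [pos_val (by omega), pos_val (by omega)]; omega
  rw [loops, if_neg]
  intro h2
  rcases hp with hp | hp
  · rw [← footR_eq_footL hp, ← h1, hw] at h2
    exact footL_ne_footR' (by omega) h2
  · rw [footR_eq_footL hp] at h2
    have := congrArg (act s σ).conn h2
    rw [hw, h1] at this
    exact footL_ne_footR' (by omega) this

/-- Both sides count the loops that two disjoint generators create together. If all four feet lie on
one loop, it is attributed to whichever generator comes second. -/
theorem loops_comm {s t : ℕ} (hs : s ≤ n) (ht : t ≤ n) (h : ¬ AdjD s t) {σ : Config (Pt n)}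
    (hσ : σ.Wf) : loops t σ.conn + loops s (act t σ).conn =
      loops s σ.conn + loops t (act s σ).conn := by
  rcases pos_add_two_le hs ht h with hp | hp
  · rw [loops_act_of_pos hp, loops_act_of_pos hp.symm, loops, loops, hp]
  · have a1 := footL_ne_footR (pos n s)
    have a2 := footL_ne_footR (pos n t)
    have a3 : footL (pos n s) ≠ footL (pos n t) := by
      simp only [footL, ne_eq, Fin.ext_iff]; omega
    have a4 : footR (pos n s) ≠ footL (pos n t) := by
      simp only [footL, footR, ne_eq, Fin.ext_iff]; omega
    have a5 : footR (pos n t) ≠ footL (pos n s) := by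
      simp only [footL, footR, ne_eq, Fin.ext_iff]; omega
    have a6 : footR (pos n t) ≠ footR (pos n s) := by
      simp only [footR, ne_eq, Fin.ext_iff]; omega
    have i1 := join_eq_iff a1 a2 a3 a4 a5 a6 hσ.inv hσ.ne
    have i2 := join_eq_iff a2 a1 a3.symm a5 a4 a6.symm hσ.inv hσ.ne
    have e : ∀ x y : Pt n, σ.conn x = y ↔ σ.conn y = x := fun x y =>
      ⟨fun h => by rw [← h, hσ.inv], fun h => by rw [← h, hσ.inv]⟩
    simp only [loops, act_conn, i1, i2]
    have e1 := e (footL (pos n s)) (footL (pos n t))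
    have e2 := e (footR (pos n s)) (footR (pos n t))
    have e3 := e (footL (pos n s)) (footR (pos n t))
    have e4 := e (footR (pos n s)) (footL (pos n t))
    clear i1 i2 e
    grind

theorem act_conn_of_loops {s : ℕ} {σ : Config (Pt n)} (hσ : σ.Wf) (h : loops s σ.conn = 1) :
    (act s σ).conn = σ.conn := by
  have h1 : σ.conn (footL (pos n s)) = footR (pos n s) := by
    by_contra hc; rw [loops, if_neg hc] at h; omega
  have h2 : σ.conn (footR (pos n s)) = footL (pos n s) := by rw [← h1, hσ.inv]
  rw [act_conn]
  funext x
  unfold join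
  rw [h1, h2]
  split_ifs with g1 g2
  · rw [g1, h1]
  · rw [g2, h2]
  · rfl

/-- Putting `E_s` below a diagram does nothing but create a loop. -/
theorem act_eq_self {s : ℕ} {σ : Config (Pt n)} (hσ : σ.Wf) (h : loops s σ.conn = 1)
    (hd : (act s σ).dots = none → σ.dots = none) : act s σ = σ := by
  have key : ∀ i : Fin (n + 1), ∀ σ : Config (Pt n), σ.Wf → σ.conn (footL i) = footR i →
      ((closeAt i σ).dots = none → σ.dots = none) → (closeAt i σ).dots = σ.dots := by
    intro i σ hσ hi hd
    have hi2 : σ.conn (footR i) = footL i := by rw [← hi, hσ.inv]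
    obtain ⟨p, _ | d⟩ := σ
    · rfl
    · have h1 := hσ.dots d rfl (footL i)
      simp only at hi hi2 h1
      rw [hi] at h1
      simp only [closeAt, close_some] at hd ⊢
      split_ifs with h
      · simp [h] at hd
      · have h2 : d (footL i) = false := by
          by_contra h3; exact h ⟨hi, by simpa using h3⟩
        congr 1
        funext x
        simp only [joinDots, hi, hi2]
        split_ifs with h3 h4
        · rcases h3 with rfl | rfl
          · exact h2.symm
          · rw [h1, h2]
        · exact absurd h4.symm h3
        · rfl
  have h1 : σ.conn (footL (pos n s)) = footR (pos n s) := by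
    by_contra hc; rw [loops, if_neg hc] at h; omega
  refine Config.ext (act_conn_of_loops hσ h) ?_
  have hf : ∀ σ : Config (Pt n), (toggle σ).dots = none ↔ σ.dots = none := by
    intro σ; simp [toggle, flip]
  rcases Nat.eq_zero_or_pos s with rfl | hs
  · have hc : (closeAt 0 (toggle σ)).conn = (toggle σ).conn := by
      have := act_conn_of_loops (s := 1) hσ.toggle h
      rwa [act_of_ne_zero one_ne_zero, pos_one] at this
    rw [act_zero, act_of_ne_zero one_ne_zero, pos_one] at hd ⊢
    rw [pos_zero] at h1
    have h2 := key 0 (toggle σ) hσ.toggle h1 (fun h => (hf σ).2 (hd ((hf _).2 h)))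
    rw [Config.ext hc h2, toggle_toggle]
  · rw [act_of_ne_zero (by omega)] at hd ⊢
    exact key _ _ hσ h1 hd

theorem loops_of_act_dots {s : ℕ} {σ : Config (Pt n)} (hd : σ.dots ≠ none)
    (h : (act s σ).dots = none) : loops s σ.conn = 1 := by
  have key : ∀ i : Fin (n + 1), ∀ σ : Config (Pt n), σ.dots ≠ none → (closeAt i σ).dots = none →
      σ.conn (footL i) = footR i := by
    intro i σ hd h
    obtain ⟨p, _ | d⟩ := σ
    · simp at hd
    · simp only [closeAt, close_some] at h
      split_ifs at h with h1
      exact h1.1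
  rw [loops, if_pos]
  have hf : ∀ σ : Config (Pt n), (toggle σ).dots = none ↔ σ.dots = none := by
    intro σ; simp [toggle, flip]
  rcases Nat.eq_zero_or_pos s with rfl | hs
  · rw [act_zero, act_of_ne_zero one_ne_zero, pos_one, hf] at h
    rw [pos_zero]
    exact key 0 (toggle σ) (fun h => hd ((hf _).1 h)) h
  · rw [act_of_ne_zero (by omega)] at h
    exact key _ _ hd h

theorem act_dots_of_eq_none {s : ℕ} {σ : Config (Pt n)} (h : σ.dots = none) :
    (act s σ).dots = none := by
  obtain ⟨p, d⟩ := σ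
  simp only at h
  subst h
  exact act_none s p

/-! ### The diagrams of type `D` -/

/-- The diagrams of words of type `D`. -/
structure Good (σ : Config (Pt n)) : Prop where
  valid : σ.Valid
  dotsMod : DotsMod 0 σ
  conn_ne : σ.dots = none → n = 0 ∨ σ.conn ≠ idConn n

theorem Good.act {s : ℕ} (hs : s ≤ n) {σ : Config (Pt n)} (h : σ.Good) : (act s σ).Good := by
  refine ⟨h.valid.act s, h.dotsMod.act h.valid.wf s, fun _ => ?_⟩
  rcases Nat.eq_zero_or_pos n with rfl | hn
  · exact Or.inl rfl
  · exact Or.inr (act_conn_ne_idConn hn hs σ)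

theorem isTL_idConn : IsTLDiagram (idConn n) := by
  refine ⟨Fin.rev_rev, fun x h => ?_, fun x y h => ?_⟩
  · simp only [idConn, Fin.ext_iff, Fin.val_rev] at h; omega
  · simp only [idConn, Fin.lt_def, Fin.val_rev] at h; omega

theorem good_one : (undot (idConn n)).Good :=
  ⟨valid_undot isTL_idConn, fun d hd => by cases hd; simp [dotCount], fun h => by simp [undot] at h⟩

/-- The diagram of a word that is put below a diagram. -/
def run (w : List ℕ) (σ : Config (Pt n)) : Config (Pt n) := w.foldl (fun σ s => act s σ) σ

@[simp] theorem run_append (v w : List ℕ) (σ : Config (Pt n)) :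
    run (v ++ w) σ = run w (run v σ) := by simp [run]

@[simp] theorem run_singleton (s : ℕ) (σ : Config (Pt n)) : run [s] σ = act s σ := rfl

theorem run_ins_top {w : List ℕ} (hw : ∀ s ∈ w, s ≤ n) (hn : 1 ≤ n ∨ w = []) (σ : Config (Pt n)) :
    run w (ins (n + 2) σ) = ins (n + 2) (run w σ) := by
  induction w generalizing σ with
  | nil => rfl
  | cons s w ih =>
    have hn1 : 1 ≤ n := hn.resolve_right (by simp)
    have hs : s ≤ n := hw s (by simp)
    have h1 : act s (ins (n + 2) σ) = ins (n + 2) (act s σ) := by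
      rcases Nat.eq_zero_or_pos s with rfl | hs0
      · exact act_zero_ins (by omega) le_rfl σ
      · exact act_ins_lt hs0 (by omega) le_rfl σ
    change run w (act s (ins (n + 2) σ)) = ins (n + 2) (run w (act s σ))
    rw [h1, ih (fun t ht => hw t (by simp [ht])) (Or.inl hn1)]

theorem ladder_last {m k : ℕ} (hk : 1 ≤ k) (h : k ≤ m) : ladder m k = ladder m (k + 1) ++ [k] := by
  have h1 : m + 1 - k = (m - k) + 1 := by omega
  have h2 : m + 1 - (k + 1) = m - k := by omega
  simp only [ladder, if_neg (show k ≠ 0 by omega), if_neg (show k + 1 ≠ 0 by omega), h1, h2,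
    List.range'_succ]
  simp

theorem ladder_gt {m k : ℕ} (h : m < k) : ladder m k = [] := by
  simp [ladder, if_neg (show k ≠ 0 by omega), show m + 1 - k = 0 by omega]

theorem ladder_zero {m : ℕ} : ladder m 0 = ladder m 2 ++ [0] := by
  simp [ladder]

/-- Each letter of the ladder moves the inserted strand one position to the left, starting with the
vertical strand on the far right. -/
theorem run_ladder {k : ℕ} (hk : k ≤ n + 2) {σ : Config (Pt n)} (hσ : σ.Wf) :
    run (ladder (n + 1) k) (ins (n + 2) σ) = ins k σ := by
  have key : ∀ l k, 1 ≤ k → k + l = n + 2 →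
      run (ladder (n + 1) k) (ins (n + 2) σ) = ins k σ := by
    intro l
    induction l with
    | zero =>
      intro k hk h
      obtain rfl : k = n + 2 := h
      rw [ladder_gt (by omega)]; rfl
    | succ l ih =>
      intro k hk h
      rw [ladder_last hk (by omega), run_append, ih (k + 1) (by omega) (by omega), run_singleton,
        act_ins_succ hk (by omega) hσ]
  rcases Nat.eq_zero_or_pos k with rfl | hk0
  · rw [ladder_zero, run_append, key n 2 (by omega) (by omega), run_singleton, act_zero_ins_two hσ]
  · exact key (n + 2 - k) k hk0 (by omega)

theorem ins_top_one : ins (n + 2) (undot (idConn n)) = undot (idConn (n + 1)) := by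
  have := ins_undot (n := n) (k := n + 2) (by omega) (undot (idConn n))
  rw [ins_top_conn (σ := undot (idConn n)) rfl] at this
  exact this

theorem eq_undot_of_zero {σ : Config (Pt 0)} (h : σ.Valid) (hm : DotsMod 0 σ) (hd : σ.dots ≠ none) :
    σ = undot (idConn 0) := by
  have hp := isTL_zero h.isTL
  obtain ⟨p, _ | d⟩ := σ
  · simp at hd
  · simp only at hp
    subst hp
    refine Config.ext rfl ?_
    have h1 := hm d rfl
    simp only [undot, Option.some.injEq]
    have h2 : dotCount d = (d 0).toNat + (d 1).toNat := Fin.sum_univ_two _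
    funext x
    rw [h2] at h1
    have h3 : d 0 = false ∧ d 1 = false := by
      revert h1; cases d 0 <;> cases d 1 <;> simp
    fin_cases x
    · exact h3.1
    · exact h3.2

theorem run_canon {σ : Config (Pt n)} (h : σ.Valid) (hm : DotsMod 0 σ) (hd : σ.dots ≠ none) :
    run (canon n σ) (undot (idConn n)) = σ := by
  induction n with
  | zero => rw [eq_undot_of_zero h hm hd]; rfl
  | succ n ih =>
    obtain ⟨k, τ, h1, h2, h3, h4⟩ := exists_canon h
    subst h3
    rw [h4, run_append, ← ins_top_one, run_ins_top (act_mem_canon τ) ?_,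
      ih h2 (hm.of_ins h2.wf) (by rwa [Ne, ins_dots_eq_none] at hd), run_ladder h1 h2.wf]
    rcases Nat.eq_zero_or_pos n with rfl | hn
    · exact Or.inr rfl
    · exact Or.inl hn

theorem act_zero_one_dots : (act 0 (undot (idConn 0))).dots = none := rfl

/-- Normally the dotted loop is already present in the smaller diagram. If that diagram is the
identity, the loop must be made with the last cap: a ladder ending in `E_0` followed by `E_1`, after
which the cap is moved to its position. -/
theorem exists_run_none {p : Conn n} (hp : IsTLDiagram p) (hne : p ≠ idConn n) :
    ∃ w : List ℕ, (∀ s ∈ w, s ≤ n) ∧ run w (undot (idConn n)) = ⟨p, none⟩ := by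
  induction n with
  | zero => exact absurd (isTL_zero hp) hne
  | succ n ih =>
    obtain ⟨k, τ, hk, hτ, h⟩ := (valid_none hp).exists_ins
    have hτd : τ.dots = none := by rw [← ins_dots_eq_none (k := k), h]
    by_cases hid : τ.conn = idConn n
    · have hk1 : k ≤ n + 1 := by
        by_contra hc
        obtain rfl : k = n + 2 := by omega
        exact hne (by rw [← ins_top_conn hid, h])
      obtain ⟨q, d⟩ := τ
      simp only at hid hτd
      subst hid hτd
      have hb : run (ladder (n + 1) 0 ++ [1]) (undot (idConn (n + 1))) =
          ins 1 ⟨idConn n, none⟩ := by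
        rw [run_append, ← ins_top_one, run_ladder (by omega) (good_one.valid.wf), run_singleton,
          act_one_ins_zero]
        exact Config.ext (ins_conn_congr 1 rfl) (ins_none 1 _).symm
      have hup : ∀ k, 1 ≤ k → k ≤ n + 1 → ∃ w : List ℕ, (∀ s ∈ w, s ≤ n + 1) ∧
          run w (undot (idConn (n + 1))) = ins k ⟨idConn n, none⟩ := by
        intro k hk
        induction k, hk using Nat.le_induction with
        | base =>
          intro _
          refine ⟨_, ?_, hb⟩
          intro s hs
          rcases List.mem_append.1 hs with hs | hs
          · exact mem_ladder_le (by omega) hs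
          · simp at hs; omega
        | succ k hk ih =>
          intro hk2
          obtain ⟨w, hw1, hw2⟩ := ih (by omega)
          refine ⟨w ++ [k + 1], ?_, ?_⟩
          · intro s hs
            rcases List.mem_append.1 hs with hs | hs
            · exact hw1 s hs
            · simp at hs; omega
          · rw [run_append, hw2, run_singleton, act_succ_ins hk (by omega) hτ.wf]
      rcases Nat.eq_zero_or_pos k with rfl | hk0
      · obtain ⟨w, hw1, hw2⟩ := hup 1 le_rfl (by omega)
        refine ⟨w, hw1, ?_⟩
        rw [hw2, ← h]
        exact Config.ext (ins_zero_conn _).symm (by rw [ins_none, ins_none])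
      · obtain ⟨w, hw1, hw2⟩ := hup k hk0 hk1
        exact ⟨w, hw1, by rw [hw2, h]⟩
    · obtain ⟨w, hw1, hw2⟩ := ih hτ.isTL hid
      have hn : 1 ≤ n := by
        rcases Nat.eq_zero_or_pos n with rfl | hn
        · exact absurd (isTL_zero hτ.isTL) hid
        · exact hn
      refine ⟨w ++ ladder (n + 1) k, ?_, ?_⟩
      · intro s hs
        rcases List.mem_append.1 hs with hs | hs
        · exact (hw1 s hs).trans (by omega)
        · exact mem_ladder_le (by omega) hs
      · rw [run_append, ← ins_top_one, run_ins_top hw1 (Or.inl hn), hw2]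
        have : (⟨τ.conn, none⟩ : Config (Pt n)) = τ := Config.ext rfl hτd.symm
        rw [this, run_ladder hk hτ.wf, h]

theorem Good.exists_run {σ : Config (Pt n)} (h : σ.Good) :
    ∃ w : List ℕ, (∀ s ∈ w, s ≤ n) ∧ run w (undot (idConn n)) = σ := by
  by_cases hd : σ.dots = none
  · obtain ⟨p, d⟩ := σ
    simp only at hd
    subst hd
    by_cases hp : p = idConn n
    · obtain rfl : n = 0 := (h.conn_ne rfl).resolve_right (not_not_intro hp)
      refine ⟨[0], by simp, ?_⟩
      subst hp
      exact Config.ext (isTL_zero ((good_one (n := 0)).valid.act 0).isTL) act_zero_one_dots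
    · exact exists_run_none h.valid.isTL hp
  · exact ⟨_, act_mem_canon σ, run_canon h.valid h.dotsMod hd⟩

end Config

open Config

theorem DRel.evCanon_one {R : Type} [Ring R] [Algebra K R] {e : ℕ → R} {N n : ℕ} (h : DRel e N)
    (hn : n ≤ N) : evCanon e (undot (idConn n)) = 1 := by
  induction n with
  | zero => rfl
  | succ n ih =>
    rw [← ins_top_one, h.evCanon_ins hn le_rfl good_one.valid (by simp [undot]), ih (by omega),
      lad_gt (by omega), mul_one]

theorem exists_map_val {n : ℕ} {w : List ℕ} (hw : ∀ s ∈ w, s ≤ n) :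
    ∃ v : List (Fin (n + 1)), v.map Fin.val = w :=
  ⟨w.pmap (fun s h => ⟨s, h⟩) (fun s hs => Nat.lt_succ_of_le (hw s hs)), by
    simp [List.map_pmap]⟩

/-- The diagrams of words of type `D`. -/
abbrev StateD (n : ℕ) : Type := {σ : Config (Pt n) // σ.Good}

open Classical in
/-- The element of `TL^D_{n+1}` that is represented by a diagram. -/
def stdD {n : ℕ} (σ : Config (Pt n)) : TLD n :=
  if σ.dots = none then (if n = 0 then eD n 0 else loopVal • eltD n σ) else evCanon (eD n) σ

theorem stdD_of_ne {n : ℕ} {σ : Config (Pt n)} (h : σ.dots ≠ none) : stdD σ = eltD n σ := by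
  rw [stdD, eltD, if_neg h, if_neg h]

theorem stdD_of_none {n : ℕ} (hn : 1 ≤ n) {σ : Config (Pt n)} (h : σ.dots = none) :
    stdD σ = loopVal • eltD n σ := by
  rw [stdD, if_pos h, if_neg (by omega)]

/-- In contrast to `eltD`, the element with a dotted loop carries no denominator, so producing the
first dotted loop costs no scalar. A factor appears only when an ordinary loop is removed, and then
the diagram is unchanged. For one strand the state `none` stands for `E_0`. -/
theorem stdD_mul {n s : ℕ} (hs : s ≤ n) {σ : Config (Pt n)} (hσ : σ.Good) :
    stdD σ * eD n s = stdD (act s σ) ∨ (act s σ = σ ∧ stdD σ * eD n s = loopVal • stdD σ) := by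
  rcases Nat.eq_zero_or_pos n with rfl | hn
  · obtain rfl : s = 0 := by omega
    by_cases hd : σ.dots = none
    · right
      refine ⟨act_eq_self hσ.valid.wf ?_ fun _ => hd, ?_⟩
      · rw [loops, if_pos]
        rw [isTL_zero hσ.valid.isTL]
        rfl
      · rw [stdD, if_pos hd, if_pos rfl]
        exact (dRel_eD 0).sq 0 le_rfl
    · left
      have h1 : (act 0 σ).dots = none := by
        rw [eq_undot_of_zero hσ.valid hσ.dotsMod hd, act_zero_one_dots]
      rw [stdD, if_neg hd, stdD, if_pos h1, if_pos rfl]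
      simp [evCanon, canon]
  · have hA : σ.dots ≠ none ∨ σ.conn ≠ idConn n := by
      by_cases hd : σ.dots = none
      · exact Or.inr ((hσ.conn_ne hd).resolve_left (by omega))
      · exact Or.inl hd
    have hmul := eltD_mul hn le_rfl hs hσ.valid hA
    have hl : loops s σ.conn = 0 ∨ loops s σ.conn = 1 := by unfold loops; split_ifs <;> simp
    by_cases hd : σ.dots = none
    · rw [stdD_of_none hn hd, stdD_of_none hn (act_dots_of_eq_none hd), smul_mul_assoc, hmul]
      rcases hl with hl | hl
      · left; rw [hl, pow_zero, one_smul]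
      · right
        have h1 := act_eq_self hσ.valid.wf hl fun _ => hd
        exact ⟨h1, by rw [h1, hl, pow_one]⟩
    · rw [stdD_of_ne hd, hmul]
      by_cases hd' : (act s σ).dots = none
      · left
        rw [stdD_of_none hn hd', loops_of_act_dots hd hd', pow_one]
      · rw [stdD_of_ne hd']
        rcases hl with hl | hl
        · left; rw [hl, pow_zero, one_smul]
        · right
          have h1 := act_eq_self hσ.valid.wf hl fun h => absurd h hd'
          exact ⟨h1, by rw [h1, hl, pow_one]⟩

/-- The basis of diagrams of type `D`. -/
def modelD (n : ℕ) : DiagramModel (dynkinD n) (StateD n) where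
  one := ⟨undot (idConn n), good_one⟩
  step s σ := ⟨act s.val σ.val, σ.2.act (by omega)⟩
  weight s σ := loopVal ^ loops s.val σ.val.conn
  elt σ := stdD σ.val
  weight_ne_zero s σ := pow_ne_zero _ loopVal_ne_zero
  step_step s σ := Subtype.ext (act_act _ _)
  weight_step s σ := by rw [loops_act_of_pos rfl, pow_one]
  step_braid s t σ h := Subtype.ext (act_braid (by omega) (by omega) h σ.2.valid.wf)
  weight_braid s t σ h := by
    rw [loops_act_adj (by omega) (by omega) h σ.2.valid.wf, loops_act_adj (by omega) (by omega)
      h.symm (σ.2.valid.wf.act _), pow_zero, mul_one]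
  step_comm s t σ h := Subtype.ext (act_comm (by omega) (by omega) h σ.2.valid.wf)
  weight_comm s t σ h := by
    rw [← pow_add, ← pow_add, loops_comm (by omega) (by omega) h σ.2.valid.wf]
  elt_one := by rw [stdD, if_neg (by simp [undot])]; exact (dRel_eD n).evCanon_one le_rfl
  elt_mul s σ := by
    rw [← eD_val]
    rcases stdD_mul (s := s.val) (by omega) σ.2 with h | h
    · exact Or.inl h
    · exact Or.inr ⟨Subtype.ext h.1, h.2⟩
  exists_word σ := by
    obtain ⟨w, hw1, hw2⟩ := σ.2.exists_run
    obtain ⟨v, rfl⟩ := exists_map_val hw1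
    refine ⟨v, Subtype.ext ?_⟩
    rw [← hw2, run, List.foldl_map]
    have : ∀ (v : List (Fin (n + 1))) (τ : StateD n), (v.foldl (fun σ s =>
        (⟨act s.val σ.val, σ.2.act (by omega)⟩ : StateD n)) τ).val =
        v.foldl (fun σ s => act s.val σ) τ.val := by
      intro v
      induction v with
      | nil => intro τ; rfl
      | cons s v ih => intro τ; rw [List.foldl_cons, ih]; rfl
    exact this v _

theorem act_undot_conn {n : ℕ} (s : ℕ) (σ : Config (Pt n)) :
    (act s (undot σ.conn)).conn = (act s σ).conn := act_conn_congr s rfl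

theorem adjD_of_pathGraph {n : ℕ} {s t : Fin n} :
    AdjD (s.val + 1) (t.val + 1) ↔ (dynkinA n).Adj s t := by
  rw [SimpleGraph.pathGraph_adj]; unfold AdjD; omega

theorem eltA_one {N n : ℕ} (hn : n ≤ N) : eltA N (idConn n) = 1 := (dRel_eA N).evCanon_one hn

/-- The basis of diagrams of type `A`. -/
def modelA (n : ℕ) : DiagramModel (dynkinA n) {p : Conn n // IsTLDiagram p} where
  one := ⟨idConn n, isTL_idConn⟩
  step s p := ⟨(act (s.val + 1) (undot p.val)).conn, ((valid_undot p.2).act _).isTL⟩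
  weight s p := loopVal ^ loops (s.val + 1) p.val
  elt p := eltA n p.val
  weight_ne_zero s σ := pow_ne_zero _ loopVal_ne_zero
  step_step s p := Subtype.ext (by simp only [act_undot_conn, act_act])
  weight_step s p := by simp only; rw [loops_act_of_pos rfl, pow_one]
  step_braid s t p h := Subtype.ext (by
    simp only [act_undot_conn]
    rw [act_braid (by omega) (by omega) (adjD_of_pathGraph.2 h) (valid_undot p.2).wf])
  weight_braid s t p h := by
    simp only [act_undot_conn]
    rw [loops_act_adj (by omega) (by omega) (adjD_of_pathGraph.2 h) (valid_undot p.2).wf,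
      loops_act_adj (by omega) (by omega) (adjD_of_pathGraph.2 h.symm)
        ((valid_undot p.2).wf.act _), pow_zero, mul_one]
  step_comm s t p h := Subtype.ext (by
    simp only [act_undot_conn]
    rw [act_comm (by omega) (by omega) (fun h' => h (adjD_of_pathGraph.1 h'))
      (valid_undot p.2).wf])
  weight_comm s t p h := by
    have := loops_comm (s := s.val + 1) (t := t.val + 1) (by omega) (by omega)
      (fun h' => h (adjD_of_pathGraph.1 h')) (valid_undot p.2).wf
    simp only
    rw [← pow_add, ← pow_add]
    exact congrArg _ this
  elt_one := eltA_one le_rfl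
  elt_mul s p := by
    have hn := s.2
    have hmul := eltA_mul (N := n) (n := n) (s := s.val + 1) (by omega) le_rfl (by omega)
      (valid_undot p.2)
    rw [← eA_val]
    have hl : loops (s.val + 1) p.val = 0 ∨ loops (s.val + 1) p.val = 1 := by
      unfold loops; split_ifs <;> simp
    rcases hl with hl | hl
    · left
      refine hmul.trans ?_
      rw [show (undot p.val).conn = p.val from rfl, hl, pow_zero, one_smul]
    · right
      have h1 := act_conn_of_loops (σ := undot p.val) (valid_undot p.2).wf hl
      refine ⟨Subtype.ext h1, hmul.trans ?_⟩
      rw [h1, show (undot p.val).conn = p.val from rfl, hl, pow_one]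
  exists_word p := by
    rcases Nat.eq_zero_or_pos n with rfl | hn
    · exact ⟨[], Subtype.ext (isTL_zero p.2).symm⟩
    obtain ⟨w, hw1, hw2⟩ := Good.exists_run (σ := undot p.val)
      ⟨valid_undot p.2, fun d hd => by cases hd; simp [dotCount], fun h => by simp [undot] at h⟩
    have key : ∀ w : List ℕ, (∀ s ∈ w, s ≤ n) → ∃ v : List (Fin n),
        (v.foldl (fun (p : {p : Conn n // IsTLDiagram p}) s =>
          ⟨(act (s.val + 1) (undot p.val)).conn, ((valid_undot p.2).act _).isTL⟩)
          ⟨idConn n, isTL_idConn⟩).val = (run w (undot (idConn n))).conn := by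
      intro w
      induction w using List.reverseRecOn with
      | nil => exact fun _ => ⟨[], rfl⟩
      | append_singleton w s ih =>
        intro hw
        obtain ⟨v, hv⟩ := ih fun t ht => hw t (by simp [ht])
        have hs : s ≤ n := hw s (by simp)
        -- The node with index `s - 1` has label `s`. By truncated subtraction the letter `0` goes
        -- to the same node as `1`, which is right because both act alike on connectivities.
        refine ⟨v ++ [⟨s - 1, by omega⟩], ?_⟩
        rw [List.foldl_append, List.foldl_cons, List.foldl_nil]
        simp only
        rw [hv, act_undot_conn, run_append, run_singleton]
        rcases Nat.eq_zero_or_pos s with rfl | hs0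
        · exact (act_zero_conn _).symm
        · rw [Nat.sub_add_cancel hs0]
    obtain ⟨v, hv⟩ := key w hw1
    exact ⟨v, Subtype.ext (by rw [hv, hw2]; rfl)⟩

end
end TemperleyLieb

namespace TemperleyLieb
noncomputable section

/-! ## Diagrams of reduced words -/

namespace Config

theorem joinDotsWith_join {X : Type} [DecidableEq X] {e : Bool} {a b : X} {p : X → X} {d : X → Bool}
    (hp : ∀ x, p (p x) = x) (hf : ∀ x, p x ≠ x) (hd : ∀ x, d (p x) = d x) (x : X) :
    joinDotsWith e a b p d (join a b p x) = joinDotsWith e a b p d x := by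
  have := hp a; have := hp b; have := hp x; have := hf a; have := hf b
  have := hd a; have := hd b; have := hd x
  unfold joinDotsWith join
  grind

theorem joinDots_flip {X : Type} [DecidableEq X] {a b : X} {p : X → X} {d : X → Bool}
    (hab : a ≠ b) (hp : ∀ x, p (p x) = x) (x : X) :
    (joinDots a b p (fun x => d x ^^ decide (x = a ∨ x = p a)) x ^^ decide (x = a ∨ x = b)) =
      joinDotsWith true a b p d x := by
  have h1 := hp a
  have h2 := hp b
  by_cases h3 : x = a ∨ x = b
  · simp [joinDots, joinDotsWith, h3]
  · by_cases h4 : x = p a ∨ x = p b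
    · have hb : ¬ (b = a ∨ b = p a) := by
        rintro (h | h)
        · exact hab h.symm
        · rcases h4 with h4 | h4
          · exact h3 (Or.inr (by rw [h4, ← h]))
          · exact h3 (Or.inl (by rw [h4, h, h1]))
      simp only [joinDots, joinDotsWith, if_neg h3, if_pos h4]
      simp [h3, hb]
    · have h5 : ¬ (x = a ∨ x = p a) := by tauto
      simp only [joinDots, joinDotsWith, if_neg h3, if_neg h4]
      simp [h3, h5]

variable {n : ℕ}

/-- Brings `E_0` and the undotted generators into the common form of `stackConn` and `stackDots`,
together with the condition under which a loop is odd. -/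
theorem act_some {s : ℕ} {p : Conn n} {d : Pt n → Bool} (hp : ∀ x, p (p x) = x) :
    act s ⟨p, some d⟩ = ⟨join (footL (pos n s)) (footR (pos n s)) p,
      if p (footL (pos n s)) = footR (pos n s) ∧ d (footL (pos n s)) ≠ decide (s = 0) then none
      else some (joinDotsWith (decide (s = 0)) (footL (pos n s)) (footR (pos n s)) p d)⟩ := by
  rcases Nat.eq_zero_or_pos s with rfl | hs
  · rw [act_zero, act_of_ne_zero one_ne_zero, pos_one, pos_zero]
    have h0 : (d (footL 0) ^^ decide (footL (0 : Fin (n + 1)) = footL 0 ∨ footL 0 = p (footL 0))) = true ↔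
        d (footL 0) ≠ decide ((0 : ℕ) = 0) := by
      simp
    unfold toggle closeAt
    rw [flip_some, close_some, if_congr (Iff.and Iff.rfl h0) rfl rfl]
    split_ifs with h
    · rfl
    · rw [flip_some, join_left]
      refine Config.ext rfl (congrArg some (funext fun x => ?_))
      exact joinDots_flip (footL_ne_footR 0) hp x
  · rw [act_of_ne_zero (by omega)]
    have h0 : decide (s = 0) = false := decide_eq_false (by omega)
    rw [h0, joinDotsWith_false, closeAt, close_some]
    simp only [ne_eq, Bool.not_eq_false]

theorem dotCount_eq_card {X : Type} [Fintype X] (d : X → Bool) :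
    dotCount d = (Finset.univ.filter fun x => d x = true).card := by
  rw [Finset.card_filter]
  refine Finset.sum_congr rfl fun x _ => ?_
  cases d x <;> simp

theorem dotCount_eq {D : Diagram n} (hp : ∀ x, D.partner (D.partner x) = x)
    (hf : ∀ x, D.partner x ≠ x) (hd : ∀ x, D.dotted (D.partner x) = D.dotted x) :
    dotCount D.dotted = 2 * D.numDots := by
  have h2 : (Finset.univ.filter fun x => ¬ x < D.partner x ∧ D.dotted x = true).card =
      D.numDots := by
    refine Finset.card_nbij' D.partner D.partner ?_ ?_ (fun x _ => hp x) (fun x _ => hp x)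
    · intro x hx
      simp only [Finset.coe_filter, Finset.mem_univ, true_and, Set.mem_ofPred_eq] at hx ⊢
      rw [hp, hd]
      exact ⟨lt_of_le_of_ne (not_lt.1 hx.1) (hf x), hx.2⟩
    · intro x hx
      simp only [Finset.coe_filter, Finset.mem_univ, true_and, Set.mem_ofPred_eq] at hx ⊢
      rw [hp, hd]
      exact ⟨not_lt.2 hx.1.le, hx.2⟩
  have h3 := Finset.card_filter_add_card_filter_not
    (s := Finset.univ.filter fun x => D.dotted x = true) (fun x => x < D.partner x)
  rw [Finset.filter_filter, Finset.filter_filter] at h3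
  simp only [and_comm (a := D.dotted _ = true)] at h3
  rw [h2] at h3
  rw [dotCount_eq_card, ← h3]
  change D.numDots + D.numDots = _
  omega

theorem dotCount_odd {p : Conn n} (hf : ∀ x, p x ≠ x) : dotCount (oddDiagram p).dotted = 2 := by
  have : (Finset.univ.filter fun x => x = footL 0 ∨ x = p (footL 0)) = {footL 0, p (footL 0)} := by
    ext x; simp
  rw [dotCount_eq_card]
  simp only [oddDiagram, decide_eq_true_eq]
  rw [this]
  exact Finset.card_pair (hf (footL 0)).symm

/-- The diagram with a dot moved to the strand through the left-most bottom point if there is a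
dotted loop. -/
def toDiagram (σ : Config (Pt n)) : Diagram n :=
  match σ.dots with
  | some d => ⟨σ.conn, d⟩
  | none => oddDiagram σ.conn

/-- `D` is obtained from `σ` by dots that are ignored if there is a dotted loop. -/
structure Matches (D : Diagram n) (σ : Config (Pt n)) : Prop where
  partner : D.partner = σ.conn
  sym : ∀ x, D.dotted (D.partner x) = D.dotted x
  dots : ∀ d, σ.dots = some d → D.dotted = d
  count : σ.dots = none → dotCount D.dotted % 4 = 2

/-- Since the letter changes the state, a deleted loop must have an odd number of dots and occurs
while no dotted loop has been deleted; it makes the number of remaining dots odd. From then on no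
loop is closed, and the parity persists. -/
theorem Matches.stackD {D : Diagram n} {σ : Config (Pt n)} (h : Matches D σ) (hσ : σ.Good)
    {s : Fin (n + 1)} (hs : act s σ ≠ σ) : Matches (stackD D s) (act s σ) := by
  obtain ⟨p, d⟩ := D
  obtain ⟨h1, h2, h3, h4⟩ := h
  simp only at h1 h2 h3 h4
  subst h1
  have hi : (⟨s.val - 1, by omega⟩ : Fin (n + 1)) = pos n s := by
    rw [Fin.ext_iff, pos_val (by omega)]
  have he : decide (s = 0) = decide (s.val = 0) := decide_eq_decide.2 Fin.ext_iff
  have hw := hσ.valid.wf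
  have hst : TemperleyLieb.stackD ⟨σ.conn, d⟩ s =
      ⟨join (footL (pos n s)) (footR (pos n s)) σ.conn,
        joinDotsWith (decide (s.val = 0)) (footL (pos n s)) (footR (pos n s)) σ.conn d⟩ := by
    unfold TemperleyLieb.stackD
    simp only [hi, he]
    rfl
  have hc := dotCount_joinDotsWith (decide (s.val = 0)) (footL_ne_footR (pos n s)) hw.inv hw.ne h2
  rw [hst]
  refine ⟨(act_conn _ _).symm, joinDotsWith_join hw.inv hw.ne h2, fun d' hd' => ?_, fun hn => ?_⟩
  · simp only
    obtain ⟨p, _ | d''⟩ := σ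
    · rw [act_dots_of_eq_none rfl] at hd'; simp at hd'
    · rw [act_some hw.inv] at hd'
      simp only at hd'
      split_ifs at hd' with hif
      rw [h3 _ rfl]
      exact Option.some.inj hd'
  · simp only
    obtain ⟨p, _ | d''⟩ := σ
    · rw [hc, if_neg, h4 rfl]
      rintro ⟨hl, -⟩
      exact hs (act_eq_self hw (by rw [loops, if_pos hl]) fun _ => rfl)
    · rw [act_some hw.inv] at hn
      simp only at hn
      split_ifs at hn with hif
      have h5 := hσ.dotsMod _ rfl
      rw [h3 _ rfl] at hc ⊢
      rw [hc, if_pos hif]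
      omega

theorem Matches.normalizeDots {D : Diagram n} {σ : Config (Pt n)} (h : Matches D σ)
    (hσ : σ.Good) : normalizeDots D = toDiagram σ := by
  have hw := hσ.valid.wf
  obtain ⟨p, d⟩ := D
  obtain ⟨h1, h2, h3, h4⟩ := h
  simp only at h1 h2 h3 h4
  subst h1
  have hc := dotCount_eq (D := ⟨σ.conn, d⟩) hw.inv hw.ne h2
  simp only at hc
  obtain ⟨p, _ | d'⟩ := σ
  · have := h4 rfl
    rw [TemperleyLieb.normalizeDots, if_neg]
    · rfl
    · rw [Nat.even_iff]; omega
  · have h5 := h3 _ rfl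
    subst h5
    have := hσ.dotsMod _ rfl
    rw [TemperleyLieb.normalizeDots, if_pos]
    · rfl
    · rw [Nat.even_iff]; omega

/-- The parity of the number of dots tells whether a dotted loop has been deleted; within each
parity the state is read off directly. -/
theorem toDiagram_injective {σ τ : Config (Pt n)} (hσ : σ.Good) (hτ : τ.Good)
    (h : toDiagram σ = toDiagram τ) : σ = τ := by
  obtain ⟨p, _ | d⟩ := σ <;> obtain ⟨p', _ | d'⟩ := τ <;>
    simp only [toDiagram] at h
  · have := congrArg Diagram.partner h
    simp only [oddDiagram] at this
    rw [this]
  · have h1 := hτ.dotsMod _ rfl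
    have h2 := dotCount_odd hσ.valid.isTL.2.1
    simp only at h2
    rw [h] at h2
    simp only at h2
    omega
  · have h1 := hσ.dotsMod _ rfl
    have h2 := dotCount_odd hτ.valid.isTL.2.1
    simp only at h2
    rw [← h] at h2
    simp only at h2
    omega
  · have h1 := congrArg Diagram.partner h
    have h2 := congrArg Diagram.dotted h
    simp only at h1 h2
    rw [h1, h2]

theorem good_of_isEven {D : Diagram n} (h : D.IsEven) :
    Good (⟨D.partner, some D.dotted⟩ : Config (Pt n)) := by
  obtain ⟨⟨h1, h2⟩, h3, h4⟩ := h
  refine ⟨⟨h1, fun d hd => ?_, fun d hd => ?_⟩, fun d hd => ?_, fun h => by simp at h⟩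
  · cases hd; exact h2
  · cases hd; exact h4
  · cases hd
    have := dotCount_eq h1.1 h1.2.1 h2
    rw [Nat.even_iff] at h3
    omega

theorem isEven_of_good {p : Conn n} {d : Pt n → Bool} (h : Good (⟨p, some d⟩ : Config (Pt n))) :
    (Diagram.mk p d).IsEven := by
  have h2 := h.valid.sym d rfl
  refine ⟨⟨h.valid.isTL, h2⟩, ?_, h.valid.outer d rfl⟩
  have := dotCount_eq (D := ⟨p, d⟩) h.valid.isTL.1 h.valid.isTL.2.1 h2
  have h3 := h.dotsMod d rfl
  rw [Nat.even_iff]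
  simp only at this
  omega

theorem good_none {p : Conn n} (hp : IsTLDiagram p) (h : p ≠ idConn n) :
    Good (⟨p, none⟩ : Config (Pt n)) :=
  ⟨valid_none hp, fun d hd => by simp at hd, fun _ => Or.inr h⟩

theorem eq_oddDiagram_of_isOdd {D : Diagram n} (h : D.IsOdd) : D = oddDiagram D.partner := by
  obtain ⟨⟨h1, h2⟩, h3, h4, -⟩ := h
  refine Diagram.ext rfl ?_
  have hc := dotCount_eq h1.1 h1.2.1 h2
  have h5 := dotCount_eq_card D.dotted
  have hsub : ({footL 0, D.partner (footL 0)} : Finset (Pt n)) ⊆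
      Finset.univ.filter fun x => D.dotted x = true := by
    intro x hx
    simp only [Finset.mem_insert, Finset.mem_singleton] at hx
    simp only [Finset.mem_filter, Finset.mem_univ, true_and]
    rcases hx with rfl | rfl
    · exact h4
    · rw [h2, h4]
  have heq := Finset.eq_of_subset_of_card_le hsub (by
    rw [Finset.card_pair (h1.2.1 _).symm, ← h5, hc, h3])
  funext x
  have hx := congrArg (x ∈ ·) heq
  simp only [Finset.mem_insert, Finset.mem_singleton, Finset.mem_filter, Finset.mem_univ, true_and,
    eq_iff_iff] at hx
  simp only [oddDiagram, hx, Bool.decide_eq_true]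

end Config

open Config

variable {n : ℕ}

theorem wordDiagramD_eq {w : List (Fin (n + 1))} (hw : IsReducedWord (dynkinD n) w) :
    wordDiagramD w = toDiagram ((modelD n).state w).val := by
  refine Matches.normalizeDots ?_ ((modelD n).state w).2
  induction w using List.reverseRecOn with
  | nil =>
    exact ⟨rfl, fun _ => rfl, fun d hd => Option.some.inj hd, fun h => by cases h⟩
  | append_singleton w s ih =>
    rw [List.foldl_append, List.foldl_cons, List.foldl_nil, DiagramModel.state_append_singleton]
    refine (ih (DiagramModel.isReducedWord_of_append hw)).stackD ((modelD n).state w).2 fun h => ?_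
    exact (modelD n).step_ne_of_isReducedWord hw (Subtype.ext h)

theorem representsD_iff {D : Diagram n} {x : TLD n} :
    RepresentsD D x ↔ ∃ σ : StateD n, toDiagram σ.val = D ∧ stdD σ.val = x := by
  constructor
  · rintro ⟨w, hw, h1, h2⟩
    refine ⟨(modelD n).state w, ?_, ?_⟩
    · rw [← wordDiagramD_eq hw, h1]
    · rw [← h2, (modelD n).word_eq_elt hw]; rfl
  · rintro ⟨σ, rfl, rfl⟩
    obtain ⟨w, hw, h⟩ := (modelD n).exists_reduced σ
    refine ⟨w, hw, ?_, ?_⟩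
    · rw [wordDiagramD_eq hw, h]
    · rw [(modelD n).word_eq_elt hw, h]; rfl

theorem existsUnique_representsD (σ : StateD n) : ∃! x, RepresentsD (toDiagram σ.val) x := by
  refine ⟨stdD σ.val, representsD_iff.2 ⟨σ, rfl, rfl⟩, fun x hx => ?_⟩
  obtain ⟨τ, h1, rfl⟩ := representsD_iff.1 hx
  rw [toDiagram_injective τ.2 σ.2 h1]

theorem coefD_toDiagram (x : TLD n) (σ : StateD n) :
    coefD x (toDiagram σ.val) = (modelD n).basis.repr x σ := by
  have h := Classical.epsilon_spec (existsUnique_representsD σ).exists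
  have h2 := (existsUnique_representsD σ).unique h (representsD_iff.2 ⟨σ, rfl, rfl⟩)
  rw [coefD, h2]
  exact (modelD n).coeff_elt x σ

theorem exists_toDiagram {D : Diagram n} (h : D.IsEven ∨ D.IsOdd) :
    ∃ σ : StateD n, toDiagram σ.val = D := by
  rcases h with h | h
  · exact ⟨⟨_, good_of_isEven h⟩, rfl⟩
  · exact ⟨⟨_, good_none h.1.1 h.2.2.2⟩, (eq_oddDiagram_of_isOdd h).symm⟩

theorem wordConnA_eq (w : List (Fin n)) : wordConnA w = ((modelA n).state w).val := by
  induction w using List.reverseRecOn with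
  | nil => rfl
  | append_singleton w s ih =>
    rw [DiagramModel.state_append_singleton]
    unfold wordConnA at ih ⊢
    rw [List.foldl_append, List.foldl_cons, List.foldl_nil, ih]
    have hp : pos n (s.val + 1) = s.castSucc := by
      rw [Fin.ext_iff, pos_val (by omega)]; simp
    change _ = (act (s.val + 1) (undot ((modelA n).state w).val)).conn
    rw [act_conn, hp]
    rfl

theorem representsA_iff {p : Conn n} {x : TLA n} :
    RepresentsA p x ↔ IsTLDiagram p ∧ eltA n p = x := by
  constructor
  · rintro ⟨w, hw, rfl, rfl⟩
    rw [wordConnA_eq]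
    exact ⟨((modelA n).state w).2, ((modelA n).word_eq_elt hw).symm⟩
  · rintro ⟨hp, rfl⟩
    obtain ⟨w, hw, h⟩ := (modelA n).exists_reduced ⟨p, hp⟩
    refine ⟨w, hw, ?_, ?_⟩
    · rw [wordConnA_eq, h]
    · rw [(modelA n).word_eq_elt hw, h]; rfl

theorem existsUnique_representsA {p : Conn n} (hp : IsTLDiagram p) : ∃! x, RepresentsA p x :=
  ⟨eltA n p, representsA_iff.2 ⟨hp, rfl⟩, fun _ hx => (representsA_iff.1 hx).2.symm⟩

theorem coefA_eq (x : TLA n) {p : Conn n} (hp : IsTLDiagram p) :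
    coefA x p = (modelA n).basis.repr x ⟨p, hp⟩ := by
  have h := Classical.epsilon_spec (existsUnique_representsA hp).exists
  have h2 := (existsUnique_representsA hp).unique h (representsA_iff.2 ⟨hp, rfl⟩)
  rw [coefA, h2]
  exact (modelA n).coeff_elt x ⟨p, hp⟩

end
end TemperleyLieb

namespace TemperleyLieb
noncomputable section

/-! ## Jones--Wenzl projections -/

section
variable {V : Type} {G : SimpleGraph V}

/-- The homomorphism that kills the generators. -/
def counit (G : SimpleGraph V) : TL G →ₐ[K] K :=
  liftTL (fun _ => 0) (fun _ => by simp) (fun _ _ _ => by simp) (fun _ _ _ => by simp)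

@[simp] theorem counit_E (i : V) : counit G (E G i) = 0 := liftTL_E _ _ _ _ i

/-- The anti-involution that fixes the generators. -/
def reverse (G : SimpleGraph V) : TL G →ₐ[K] (TL G)ᵐᵒᵖ :=
  liftTL (fun i => MulOpposite.op (E G i))
    (fun i => by rw [← MulOpposite.op_mul, E_mul_self, MulOpposite.op_smul])
    (fun i j h => by
      rw [← MulOpposite.op_mul, ← MulOpposite.op_mul, ← mul_assoc, E_braid _ h])
    (fun i j h => by rw [← MulOpposite.op_mul, ← MulOpposite.op_mul, E_comm _ h])

@[simp] theorem reverse_E (i : V) : reverse G (E G i) = MulOpposite.op (E G i) :=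
  liftTL_E _ _ _ _ i

theorem word_cons (s : V) (w : List V) : word G (s :: w) = E G s * word G w := by simp [word]

theorem counit_reverse (x : TL G) : counit G (reverse G x).unop = counit G x := by
  have : (counit G).toLinearMap ∘ₗ (MulOpposite.opLinearEquiv K).symm.toLinearMap ∘ₗ
      (reverse G).toLinearMap = (counit G).toLinearMap := by
    refine linearMap_ext_word fun w => ?_
    cases w with
    | nil => simp [word]
    | cons s w => simp [word_cons]
  exact LinearMap.congr_fun this x

/-- Every nonempty word begins with a generator, which `J` annihilates; only the constant term acts.
-/
theorem mul_eq_counit_smul {J : TL G} (hJ : ∀ i, J * E G i = 0) (x : TL G) :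
    J * x = counit G x • J := by
  have : LinearMap.mulLeft K J = (counit G).toLinearMap.smulRight J := by
    refine linearMap_ext_word fun w => ?_
    cases w with
    | nil => simp [word]
    | cons s w => simp [word_cons, ← mul_assoc, hJ]
  exact LinearMap.congr_fun this x

theorem mul_eq_counit_smul' {J : TL G} (hJ : ∀ i, E G i * J = 0) (x : TL G) :
    x * J = counit G x • J := by
  have : LinearMap.mulRight K J = (counit G).toLinearMap.smulRight J := by
    refine linearMap_ext_word fun w => ?_
    induction w using List.reverseRecOn with
    | nil => simp [word]
    | append_singleton w s => simp [DiagramModel.word_append, DiagramModel.word_singleton, mul_assoc, hJ]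
  exact LinearMap.congr_fun this x

/-- An element that kills the generators on one side kills them on both sides. -/
theorem E_mul_eq_zero {J : TL G} (hJ : ∀ i, J * E G i = 0) (h1 : counit G J = 1) (i : V) :
    E G i * J = 0 := by
  have hr : ∀ i, E G i * (reverse G J).unop = 0 := by
    intro i
    have := congrArg MulOpposite.unop (congrArg (reverse G) (hJ i))
    simpa using this
  -- The product of `J` with its reverse is evaluated from both sides; since both have counit one,
  -- `J` equals its reverse.
  have e1 := mul_eq_counit_smul hJ (reverse G J).unop
  have e2 := mul_eq_counit_smul' hr J
  rw [e1, counit_reverse, h1, one_smul, one_smul] at e2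
  rw [e2, hr]

/-- The product `J * J'` equals `J` when `J'` is replaced by its counit, and `J'` when `J` is. -/
theorem eq_of_kills {J J' : TL G} (hJ : ∀ i, J * E G i = 0) (h1 : counit G J = 1)
    (hJ' : ∀ i, E G i * J' = 0) (h1' : counit G J' = 1) : J = J' := by
  have e1 := mul_eq_counit_smul hJ J'
  have e2 := mul_eq_counit_smul' hJ' J
  rw [e1, h1, h1', one_smul, one_smul] at e2
  exact e2

theorem counit_map {W : Type} {H : SimpleGraph W} (f : G ↪g H) (x : TL G) :
    counit H (TL.map f x) = counit G x := by
  have : (counit H).toLinearMap ∘ₗ (TL.map f).toLinearMap = (counit G).toLinearMap := by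
    refine linearMap_ext_word fun w => ?_
    cases w with
    | nil => simp [word]
    | cons s w => simp [word_cons, TLmap_E]
  exact LinearMap.congr_fun this x

theorem counit_eq_one {J : TL G} (h0 : J ≠ 0) (hJ : ∀ i, J * E G i = 0) {x : TL G}
    (hx : J * x = J) : counit G x = 1 := by
  rw [mul_eq_counit_smul hJ] at hx
  exact smul_left_injective K h0 (hx.trans (one_smul K J).symm)

end

/-- Right annihilation and counit one suffice: annihilation on the left follows by reversal, and
absorption of the smaller projections holds because inclusions preserve the counit. -/
theorem isJonesWenzlD_of_kills {Q : ∀ n, TLD n} (hQ : ∀ n i, Q n * E (dynkinD n) i = 0)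
    (h1 : ∀ n, counit _ (Q n) = 1) : IsJonesWenzlD Q := by
  intro n
  refine ⟨fun h => ?_, fun i h => ⟨?_, ?_⟩, fun i => ⟨E_mul_eq_zero (hQ n) (h1 n) i, hQ n i⟩⟩
  · have := h1 n; rw [h, map_zero] at this; exact zero_ne_one this
  · rw [mul_eq_counit_smul (hQ n), inclD, counit_map, h1, one_smul]
  · rw [mul_eq_counit_smul' (E_mul_eq_zero (hQ n) (h1 n)), inclD, counit_map, h1, one_smul]

theorem isJonesWenzlA_of_kills {P : ∀ n, TLA n} (hP : ∀ n i, P n * E (dynkinA n) i = 0)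
    (h1 : ∀ n, counit _ (P n) = 1) : IsJonesWenzlA P := by
  intro n
  refine ⟨fun h => ?_, fun i h => ⟨?_, ?_⟩, fun i => ⟨E_mul_eq_zero (hP n) (h1 n) i, hP n i⟩⟩
  · have := h1 n; rw [h, map_zero] at this; exact zero_ne_one this
  · rw [mul_eq_counit_smul (hP n), inclA, counit_map, h1, one_smul]
  · rw [mul_eq_counit_smul' (E_mul_eq_zero (hP n) (h1 n)), inclA, counit_map, h1, one_smul]

theorem IsJonesWenzlD.unique {Q Q' : ∀ n, TLD n} (h : IsJonesWenzlD Q) (h' : IsJonesWenzlD Q') :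
    Q = Q' := by
  have key : ∀ {Q : ∀ n, TLD n}, IsJonesWenzlD Q → ∀ n, counit _ (Q n) = 1 := fun h n => by
    have := counit_eq_one (h n).1 (fun i => ((h n).2.2 i).2) ((h n).2.1 n le_rfl).1
    rwa [inclD, counit_map] at this
  funext n
  exact eq_of_kills (fun i => ((h n).2.2 i).2) (key h n) (fun i => ((h' n).2.2 i).1) (key h' n)

theorem IsJonesWenzlA.unique {P P' : ∀ n, TLA n} (h : IsJonesWenzlA P) (h' : IsJonesWenzlA P') :
    P = P' := by
  have key : ∀ {P : ∀ n, TLA n}, IsJonesWenzlA P → ∀ n, counit _ (P n) = 1 := fun h n => by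
    have := counit_eq_one (h n).1 (fun i => ((h n).2.2 i).2) ((h n).2.1 n le_rfl).1
    rwa [inclA, counit_map] at this
  funext n
  exact eq_of_kills (fun i => ((h n).2.2 i).2) (key h n) (fun i => ((h' n).2.2 i).1) (key h' n)

/-! ### Quantum integers -/

theorem qInt_zero : qInt 0 = 0 := by simp [qInt]

theorem qInt_two_mul (j : ℕ) : qInt (2 * j) = qInt j * (q ^ j + (q ^ j)⁻¹) := by
  have h := pow_ne_zero j q_ne_zero
  unfold qInt
  rw [two_mul, pow_add]
  field_simp
  ring

theorem qInt_one : qInt 1 = 1 := by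
  unfold qInt
  rw [pow_one, div_self q_sub_inv_ne_zero]

theorem loopVal_eq : loopVal = -(q + q⁻¹) := by
  have := qInt_two_mul 1
  rw [mul_one, qInt_one, one_mul, pow_one] at this
  rw [loopVal, this]

theorem qInt_add_two (a : ℕ) : qInt (a + 2) + qInt a = qInt 2 * qInt (a + 1) := by
  have h2 : qInt 2 = q + q⁻¹ := by rw [← neg_neg (qInt 2)]; change -loopVal = _; rw [loopVal_eq, neg_neg]
  rw [h2]
  have h := q_ne_zero
  unfold qInt
  rw [← add_div, ← mul_div_assoc]
  congr 1
  simp only [pow_add]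
  field_simp
  ring

theorem coefG_one (m : ℕ) : coefG m 1 = qInt m / qInt (2 * m) := if_pos rfl

/-- The quotient of quantum integers is `q^j + q^{-j}`. Up to a common factor the coefficients thus
form the sequence whose three-term recursion has middle coefficient `q + q⁻¹`, the negative of
`loopVal`. -/
theorem coefG_add_two (m k : ℕ) :
    coefG m (k + 2) = qInt m / qInt (2 * m) * (q ^ (k + 1) + (q ^ (k + 1))⁻¹) := by
  have h := qInt_ne_zero (m := k + 1) (by omega)
  rw [coefG, if_neg (by omega), show 2 * (k + 2) - 2 = 2 * (k + 1) by omega,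
    show k + 2 - 1 = k + 1 by omega, qInt_two_mul (k + 1)]
  rw [mul_comm (qInt (k + 1)), ← mul_assoc, mul_div_mul_right _ _ h]
  ring

theorem coefG_top {m : ℕ} (hm : 1 ≤ m) : coefG m (m + 1) = 1 := by
  have h1 := qInt_ne_zero hm
  have h2 := qInt_ne_zero (m := 2 * m) (by omega)
  rw [coefG, if_neg (by omega), show 2 * (m + 1) - 2 = 2 * m by omega, Nat.add_sub_cancel]
  field_simp

theorem coefG_three_term_one (m : ℕ) : loopVal * coefG m 1 + coefG m 2 = 0 := by
  rw [coefG_one, coefG_add_two m 0, loopVal_eq]; ring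

/-- The second `coefG m 1` belongs to the ladder ending in `E_0`. Together the two terms give `q^0 +
q^{-0} = 2`, which continues the recursion by one step. -/
theorem coefG_three_term_two (m : ℕ) :
    coefG m 1 + loopVal * coefG m 2 + coefG m 3 + coefG m 1 = 0 := by
  have h := q_ne_zero
  rw [coefG_one, coefG_add_two m 0, coefG_add_two m 1, loopVal_eq]
  field_simp; ring

theorem coefG_three_term (m : ℕ) {s : ℕ} (hs : 3 ≤ s) :
    coefG m (s - 1) + loopVal * coefG m s + coefG m (s + 1) = 0 := by
  obtain ⟨k, rfl⟩ : ∃ k, s = k + 3 := ⟨s - 3, by omega⟩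
  have h := q_ne_zero
  rw [show k + 3 - 1 = k + 2 by omega, coefG_add_two m k, coefG_add_two m (k + 1),
    coefG_add_two m (k + 2), loopVal_eq]
  simp only [pow_succ]
  field_simp; ring

theorem coefH_top (m : ℕ) : coefH m (m + 1) = 0 := by
  simp [coefH, qInt_zero]

/-- The inhomogeneous term comes from a ladder ending in one of `E_0`, `E_1` that is multiplied by
the other and thereby acquires a dotted loop. -/
theorem coefH_three_term_one {m : ℕ} (hm : 1 ≤ m) :
    loopVal * coefH m 1 + coefH m 2 + coefG m 1 = 0 := by
  obtain ⟨a, rfl⟩ : ∃ a, m = a + 1 := ⟨m - 1, by omega⟩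
  have h := qInt_add_two a
  have h1 := qInt_ne_zero (m := a + 2) (by omega)
  have h2 := qInt_ne_zero (m := 2 * (a + 1)) (by omega)
  rw [coefG_one, coefH, coefH, loopVal, show a + 1 + 1 - 1 = a + 1 by omega,
    show a + 1 + 1 - 2 = a by omega]
  field_simp
  linear_combination qInt (a + 1) * h

theorem coefH_three_term {m s : ℕ} (hs : 2 ≤ s) (hm : s ≤ m) :
    coefH m (s - 1) + loopVal * coefH m s + coefH m (s + 1) = 0 := by
  obtain ⟨a, rfl⟩ : ∃ a, m = s + a := ⟨m - s, by omega⟩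
  have h := qInt_add_two a
  rw [coefH, coefH, coefH, loopVal, show s + a + 1 - (s - 1) = a + 2 by omega,
    show s + a + 1 - s = a + 1 by omega, show s + a + 1 - (s + 1) = a by omega]
  linear_combination qInt (s + a) / (qInt (2 * (s + a)) * qInt (s + a + 1)) * h

end
end TemperleyLieb

namespace TemperleyLieb
noncomputable section

open Config

/-! ### The recursion for the Jones--Wenzl projections -/

theorem addLoop_one (N : ℕ) : addLoop N 1 = 0 := by simp [addLoop]

theorem counit_eD (N s : ℕ) : counit _ (eD N s) = 0 := by
  unfold eD; split_ifs <;> simp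

theorem counit_dloop (N s : ℕ) : counit _ (dloop (eD N) s) = 0 := by
  rcases s with _ | _ | s <;> simp [dloop, counit_eD]

theorem smul_add_eq_zero {M : Type} [AddCommMonoid M] [Module K M] {a b c d : K} {x y : M}
    (h1 : a + d = 0) (h2 : b + c = 0) : a • x + b • y + c • y + d • x = 0 := by
  have : a • x + b • y + c • y + d • x = (a + d) • x + (b + c) • y := by
    simp only [add_smul]; abel
  rw [this, h1, h2, zero_smul, zero_smul, add_zero]

theorem counit_addLoop {N : ℕ} (hN : 1 ≤ N) (x : TLA N) : counit _ (addLoop N x) = 0 := by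
  have : (counit (dynkinD N)).toLinearMap ∘ₗ addLoop N = 0 := by
    refine linearMap_ext_word fun w => ?_
    rw [word_eq_evA]
    cases w with
    | nil => simp [addLoop_one]
    | cons s w =>
      rw [List.map_cons, LinearMap.comp_apply, addLoop_ev hN _ _ (by omega) (fun t ht => by
        obtain ⟨i, -, rfl⟩ := List.mem_map.1 ht; omega)]
      rw [AlgHom.toLinearMap_apply, map_mul, counit_dloop, zero_mul]
      rfl
  exact LinearMap.congr_fun this x

/-- A sum against a tridiagonal family. -/
theorem sum_tridiagonal {M : Type} [AddCommMonoid M] [Module K M] {m s : ℕ} (hs : 1 ≤ s) (hm : s ≤ m)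
    (t : ℕ → M) (ht : ∀ k, 1 ≤ k → k ≤ m + 1 → (k + 2 ≤ s ∨ s + 2 ≤ k) → t k = 0) :
    ∑ i ∈ Finset.range (m + 1), t (i + 1) =
      (if 2 ≤ s then t (s - 1) else 0) + t s + t (s + 1) := by
  obtain ⟨u, rfl⟩ : ∃ u, s = u + 1 := ⟨s - 1, by omega⟩
  have h1 : ∑ i ∈ Finset.range (m + 1), t (i + 1) =
      ∑ i ∈ Finset.range (u + 2), t (i + 1) := by
    refine (Finset.sum_subset (fun i hi => ?_) fun i hi hi' => ?_).symm
    · rw [Finset.mem_range] at *; omega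
    · rw [Finset.mem_range] at *; exact ht _ (by omega) (by omega) (by omega)
  rw [h1, Finset.sum_range_succ, Finset.sum_range_succ]
  congr 2
  split_ifs with h
  · obtain ⟨v, rfl⟩ : ∃ v, u = v + 1 := ⟨u - 1, by omega⟩
    rw [Finset.sum_range_succ, Finset.sum_eq_zero fun i hi => ?_, zero_add]
    · rfl
    · rw [Finset.mem_range] at hi; exact ht _ (by omega) (by omega) (by omega)
  · obtain rfl : u = 0 := by omega
    rfl

/-- The factor by which `Q (n + 1)` is obtained from `Q n`, where `m = n + 1`. -/
def jwFactor (m : ℕ) : TLD m :=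
  ∑ i ∈ Finset.range (m + 1), coefG m (i + 1) • lad (eD m) m (i + 1) +
    coefG m 1 • lad (eD m) m 0 +
    ∑ i ∈ Finset.range (m + 1), coefH m (i + 1) • addLoop m (lad (eA m) m (i + 1))

section
variable {m : ℕ} {Z : TLD m}

theorem addLoop_lad_mul {j s : ℕ} (hm : 1 ≤ m) (hj : j ≤ m) (hs : s ≤ m) :
    addLoop m (lad (eA m) m j) * eD m s = addLoop m (lad (eA m) m j * eA m s) := by
  have := addLoop_mul_ev hm (w := ladder m j) (v := [s]) (ladder_ne_nil hj)
    (fun t ht => mem_ladder_le hm ht) (by simpa using hs)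
  simp only [ev_append, ev_cons, ev_nil, mul_one] at this
  exact this

theorem mul_addLoop_lad {j s : ℕ} (hm : 1 ≤ m) (hj : j ≤ m) (hs : s ≤ m) :
    addLoop m (eA m s * lad (eA m) m j) = eD m s * addLoop m (lad (eA m) m j) := by
  have := ev_mul_addLoop hm (w := ladder m j) (v := [s]) (ladder_ne_nil hj)
    (fun t ht => mem_ladder_le hm ht) (by simpa using hs)
  simp only [ev_append, ev_cons, ev_nil, mul_one] at this
  exact this.symm

/-- Modulo the left annihilator condition on `Z`, right multiplication by `E_s` sends the ladders
ending at `s - 1`, `s` and `s + 1` to multiples of the one ending at `s`. In all others a generator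
of index below `m` comes out on the left and is killed by `Z`. The empty ladder has coefficient
zero. -/
theorem sum_coefH_mul (hm : 1 ≤ m) (hZ : ∀ s, s < m → Z * eD m s = 0) {s : ℕ} (hs : 1 ≤ s)
    (hsm : s ≤ m) :
    ∑ i ∈ Finset.range (m + 1), coefH m (i + 1) • (Z * addLoop m (lad (eA m) m (i + 1)) * eD m s) =
      ((if 2 ≤ s then coefH m (s - 1) else 0) + loopVal * coefH m s + coefH m (s + 1)) •
        (Z * addLoop m (lad (eA m) m s)) := by
  have hA := dRel_eA m
  rw [sum_tridiagonal hs hsm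
    (fun k => coefH m k • (Z * addLoop m (lad (eA m) m k) * eD m s))]
  · have h1 : coefH m s • (Z * addLoop m (lad (eA m) m s) * eD m s) =
        (loopVal * coefH m s) • (Z * addLoop m (lad (eA m) m s)) := by
      rw [mul_assoc, addLoop_lad_mul hm hsm hsm, hA.lad_mul_self le_rfl hm hsm, map_smul,
        mul_smul_comm, smul_smul, mul_comm]
    have h2 : coefH m (s + 1) • (Z * addLoop m (lad (eA m) m (s + 1)) * eD m s) =
        coefH m (s + 1) • (Z * addLoop m (lad (eA m) m s)) := by
      rcases Nat.eq_or_lt_of_le hsm with rfl | h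
      · rw [coefH_top, zero_smul, zero_smul]
      · rw [mul_assoc, addLoop_lad_mul hm h hsm, ← lad_last hs hsm]
    have h3 : (if 2 ≤ s then coefH m (s - 1) • (Z * addLoop m (lad (eA m) m (s - 1)) * eD m s)
        else 0) = (if 2 ≤ s then coefH m (s - 1) else 0) • (Z * addLoop m (lad (eA m) m s)) := by
      split_ifs with h
      · obtain ⟨k, rfl⟩ : ∃ k, s = k + 1 := ⟨s - 1, by omega⟩
        rw [Nat.add_sub_cancel, mul_assoc, addLoop_lad_mul hm (by omega) hsm,
          hA.lad_mul_succ le_rfl (by omega) hsm]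
      · rw [zero_smul]
    rw [h1, h2, h3, ← add_smul, ← add_smul]
  · rintro k hk hkm (h | h)
    · obtain ⟨t, rfl⟩ : ∃ t, s = t + 2 := ⟨s - 2, by omega⟩
      rw [mul_assoc, addLoop_lad_mul hm (by omega) hsm, hA.lad_mul_gt le_rfl hk (by omega) hsm,
        mul_addLoop_lad hm (by omega) (by omega), ← mul_assoc, hZ t (by omega), zero_mul, smul_zero]
    · rcases Nat.eq_or_lt_of_le hkm with rfl | hk2
      · rw [coefH_top, zero_smul]
      · rw [mul_assoc, addLoop_lad_mul hm (by omega) hsm,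
          hA.lad_mul_lt le_rfl h (Or.inl hs) (by omega) hm,
          mul_addLoop_lad hm (by omega) (by omega), ← mul_assoc, hZ s (by omega), zero_mul,
          smul_zero]

theorem sum_coefG_mul (hm : 1 ≤ m) (hZ : ∀ s, s < m → Z * eD m s = 0) {s : ℕ} (hs : 1 ≤ s)
    (hsm : s ≤ m) :
    ∑ i ∈ Finset.range (m + 1), coefG m (i + 1) • (Z * lad (eD m) m (i + 1) * eD m s) =
      ((if 2 ≤ s then coefG m (s - 1) else 0) + loopVal * coefG m s + coefG m (s + 1)) •
        (Z * lad (eD m) m s) := by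
  have hA := dRel_eD m
  rw [sum_tridiagonal hs hsm (fun k => coefG m k • (Z * lad (eD m) m k * eD m s))]
  · have h1 : coefG m s • (Z * lad (eD m) m s * eD m s) =
        (loopVal * coefG m s) • (Z * lad (eD m) m s) := by
      rw [mul_assoc, hA.lad_mul_self le_rfl hm hsm, mul_smul_comm, smul_smul, mul_comm]
    have h3 : (if 2 ≤ s then coefG m (s - 1) • (Z * lad (eD m) m (s - 1) * eD m s)
        else 0) = (if 2 ≤ s then coefG m (s - 1) else 0) • (Z * lad (eD m) m s) := by
      split_ifs with h
      · obtain ⟨k, rfl⟩ : ∃ k, s = k + 1 := ⟨s - 1, by omega⟩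
        rw [Nat.add_sub_cancel, mul_assoc, hA.lad_mul_succ le_rfl (by omega) hsm]
      · rw [zero_smul]
    rw [h1, h3, mul_assoc Z (lad (eD m) m (s + 1)), ← lad_last hs hsm, ← add_smul, ← add_smul]
  · rintro k hk hkm (h | h)
    · obtain ⟨t, rfl⟩ : ∃ t, s = t + 2 := ⟨s - 2, by omega⟩
      rw [mul_assoc, hA.lad_mul_gt le_rfl hk (by omega) hsm, ← mul_assoc, hZ t (by omega),
        zero_mul, smul_zero]
    · rw [mul_assoc, hA.lad_mul_lt le_rfl h (Or.inl hs) (by omega) hm, ← mul_assoc,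
        hZ s (by omega), zero_mul, smul_zero]

theorem mul_jwFactor (s : ℕ) : Z * jwFactor m * eD m s =
    ∑ i ∈ Finset.range (m + 1), coefG m (i + 1) • (Z * lad (eD m) m (i + 1) * eD m s) +
    coefG m 1 • (Z * lad (eD m) m 0 * eD m s) +
    ∑ i ∈ Finset.range (m + 1), coefH m (i + 1) •
      (Z * addLoop m (lad (eA m) m (i + 1)) * eD m s) := by
  simp only [jwFactor, mul_add, add_mul, Finset.mul_sum, Finset.sum_mul, mul_smul_comm,
    smul_mul_assoc]

/-- Ladders with and without a dotted loop cancel separately. The ladder ending in `E_0` interferes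
in four ways: `E_0` fixes it up to a scalar, `E_1` adds a dotted loop to it, `E_2` turns it into the
ladder ending in `E_2`, and the higher generators pass through it and are killed by `Z`. -/
theorem mul_jwFactor_mul_eq_zero (hm : 1 ≤ m) (hZ : ∀ s, s < m → Z * eD m s = 0) {s : ℕ}
    (hsm : s ≤ m) : Z * jwFactor m * eD m s = 0 := by
  have hD := dRel_eD m
  have h01 : lad (eD m) m 0 * eD m 1 = addLoop m (lad (eA m) m 1) := by
    rw [lad_zero, addLoop_lad_one hm le_rfl, mul_assoc]
  have h10 : lad (eD m) m 1 * eD m 0 = addLoop m (lad (eA m) m 1) := by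
    rw [lad_one hm, addLoop_lad_one hm le_rfl, mul_assoc,
      hD.comm 0 1 (by omega) hm (by unfold AdjD; omega)]
  rcases Nat.eq_zero_or_pos s with rfl | hs
  · have hH : ∑ i ∈ Finset.range (m + 1), coefH m (i + 1) •
        (Z * addLoop m (lad (eA m) m (i + 1)) * eD m 0) =
        ∑ i ∈ Finset.range (m + 1), coefH m (i + 1) •
        (Z * addLoop m (lad (eA m) m (i + 1)) * eD m 1) := by
      refine Finset.sum_congr rfl fun i hi => ?_
      rw [Finset.mem_range] at hi
      rcases Nat.eq_or_lt_of_le hi with h | h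
      · obtain rfl : i = m := by omega
        rw [coefH_top, zero_smul, zero_smul]
      · rw [mul_assoc, mul_assoc, addLoop_lad_mul hm (by omega) hsm,
          addLoop_lad_mul hm (by omega) hm, eA_zero]
    have hG : ∑ i ∈ Finset.range (m + 1), coefG m (i + 1) • (Z * lad (eD m) m (i + 1) * eD m 0) =
        coefG m 1 • (Z * addLoop m (lad (eA m) m 1)) + coefG m 2 • (Z * lad (eD m) m 0) := by
      rw [sum_tridiagonal le_rfl hm (fun k => coefG m k • (Z * lad (eD m) m k * eD m 0))]
      · rw [if_neg (by omega), zero_add, mul_assoc, h10, mul_assoc, ← lad_zero]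
      · rintro k hk hkm (h | h)
        · omega
        · rw [mul_assoc, hD.lad_mul_lt le_rfl (by omega) (Or.inr h) (by omega) hm, ← mul_assoc,
            hZ 0 (by omega), zero_mul, smul_zero]
    rw [mul_jwFactor, hH, sum_coefH_mul hm hZ le_rfl hm, if_neg (by omega), zero_add, hG,
      mul_assoc Z (lad _ _ _), hD.lad_mul_self le_rfl hm hsm, mul_smul_comm, smul_smul]
    refine smul_add_eq_zero ?_ ?_
    · rw [add_comm]; exact coefH_three_term_one hm
    · rw [add_comm, mul_comm]; exact coefG_three_term_one m
  · rw [mul_jwFactor, sum_coefH_mul hm hZ hs hsm, sum_coefG_mul hm hZ hs hsm, mul_assoc Z (lad _ _ 0)]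
    by_cases h1 : s = 1
    · subst h1
      rw [h01, if_neg (by omega), if_neg (by omega), zero_add, zero_add,
        coefG_three_term_one, zero_smul, zero_add, ← add_smul, add_comm (coefG m 1), coefH_three_term_one hm,
        zero_smul]
    rw [if_pos (by omega), if_pos (by omega), coefH_three_term (by omega) hsm, zero_smul, add_zero]
    by_cases h2 : s = 2
    · subst h2
      rw [hD.lad_zero_mul_two le_rfl hsm, ← add_smul, coefG_three_term_two, zero_smul]
    · rw [coefG_three_term m (by omega), zero_smul, zero_add]
      by_cases h3 : s = 3
      · subst h3
        rw [hD.lad_zero_mul_three le_rfl hsm, ← mul_assoc, hZ 0 (by omega), zero_mul, smul_zero]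
      · obtain ⟨t, rfl⟩ : ∃ t, s = t + 2 := ⟨s - 2, by omega⟩
        rw [hD.lad_zero_mul_gt le_rfl (by omega) hsm, ← mul_assoc, hZ t (by omega), zero_mul,
          smul_zero]
end

theorem counit_lad {m k : ℕ} (h : k ≤ m) : counit _ (lad (eD m) m k) = 0 := by
  rcases Nat.eq_zero_or_pos k with rfl | hk
  · rw [lad_zero, map_mul, counit_eD, mul_zero]
  · rw [lad_last hk h, map_mul, counit_eD, mul_zero]

/-- Only the empty ladder has nonzero counit, and its coefficient is one. -/
theorem counit_jwFactor {m : ℕ} (hm : 1 ≤ m) : counit _ (jwFactor m) = 1 := by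
  simp only [jwFactor, map_add, map_sum, map_smul, counit_addLoop hm, smul_zero,
    Finset.sum_const_zero, add_zero, counit_lad (Nat.zero_le m)]
  rw [Finset.sum_range_succ, Finset.sum_eq_zero fun i hi => ?_, lad_gt (by omega), map_one,
    coefG_top hm]
  · simp
  · rw [Finset.mem_range] at hi
    rw [counit_lad (by omega), smul_zero]

/-- The Jones--Wenzl projections of type `D`. -/
def jwD : ∀ n, TLD n
  | 0 => 1 + (qInt 2)⁻¹ • eD 0 0
  | n + 1 => inclD (Nat.le_succ n) (jwD n) * jwFactor (n + 1)

theorem jwD_mul (n : ℕ) : ∀ s, s ≤ n → jwD n * eD n s = 0 := by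
  induction n with
  | zero =>
    intro s hs
    obtain rfl : s = 0 := by omega
    rw [jwD, add_mul, one_mul, smul_mul_assoc, (dRel_eD 0).sq 0 le_rfl, smul_smul, loopVal,
      mul_neg, inv_mul_cancel₀ (qInt_ne_zero (by omega)), neg_smul, one_smul, add_neg_cancel]
  | succ n ih =>
    intro s hs
    refine mul_jwFactor_mul_eq_zero (by omega) (fun t ht => ?_) hs
    rw [← inclD_eD (Nat.le_succ n) (Nat.le_of_lt_succ ht), ← map_mul, ih t (by omega), map_zero]

theorem counit_jwD (n : ℕ) : counit _ (jwD n) = 1 := by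
  induction n with
  | zero => simp [jwD, counit_eD]
  | succ n ih => rw [jwD, map_mul, counit_jwFactor (by omega), inclD, counit_map, ih, mul_one]

theorem isJonesWenzlD_jwD : IsJonesWenzlD jwD :=
  isJonesWenzlD_of_kills (fun n i => by rw [← eD_val]; exact jwD_mul n _ (by omega)) counit_jwD

theorem counit_forget {n : ℕ} (x : TLD n) : counit _ (forget n x) = counit _ x := by
  have : (counit (dynkinA n)).toLinearMap ∘ₗ (forget n).toLinearMap =
      (counit (dynkinD n)).toLinearMap := by
    refine linearMap_ext_word fun w => ?_
    cases w with
    | nil => simp [word]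
    | cons s w =>
      rw [word_cons]
      simp only [LinearMap.comp_apply, AlgHom.toLinearMap_apply, map_mul, counit_E, zero_mul]
      rw [← eD_val, forget_eD (by omega), eA]
      split_ifs <;> simp
  exact LinearMap.congr_fun this x

/-- Forgetting dots maps onto the generators of type `A` and preserves the counit. This proves
existence in type `A` and, by uniqueness, identifies the image of `Q` with `P`. -/
theorem isJonesWenzlA_forget : IsJonesWenzlA fun n => forget n (jwD n) :=
  isJonesWenzlA_of_kills (fun n i => by
    have := i.2
    rw [← eA_val, ← forget_eD (by omega), ← map_mul, jwD_mul n _ (by omega), map_zero])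
    (fun n => by rw [counit_forget, counit_jwD])

end
end TemperleyLieb

namespace TemperleyLieb
noncomputable section

open Config

/-! ## The recurrence for the coefficients -/

/-- The coefficient of a reduced word is linear. -/
def coeffLin {V : Type} {G : SimpleGraph V} (m : TL G) : TL G →ₗ[K] K where
  toFun x := coeff x m
  map_add' x y := by
    unfold coeff
    split_ifs
    · rw [map_add (Module.Basis.mk _ _).repr x y]; rfl
    · rw [add_zero]
  map_smul' r x := by
    unfold coeff
    split_ifs
    · rw [map_smul]; rfl
    · rw [smul_zero]

/-- The coefficient of a diagram of type `D`, as a linear map. -/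
def coefDLin {n : ℕ} (D : Diagram n) : TLD n →ₗ[K] K := coeffLin (Classical.epsilon (RepresentsD D))

/-- The coefficient of a diagram of type `A`, as a linear map. -/
def coefALin {n : ℕ} (p : Conn n) : TLA n →ₗ[K] K := coeffLin (Classical.epsilon (RepresentsA p))

open Classical in
/-- The coefficient of the diagram with a unique dot, as a linear map. -/
def oddTermLin {n : ℕ} (p : Conn n) : TLD n →ₗ[K] K :=
  if p = idConn n then 0 else coefDLin (oddDiagram p)

theorem oddTermLin_apply {n : ℕ} (p : Conn n) (x : TLD n) : oddTermLin p x = oddTerm x p := by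
  unfold oddTermLin oddTerm; split_ifs <;> rfl

open Classical in
/-- The type `A` combination, as a linear map. -/
def typeALin {n : ℕ} (p : Conn n) : TLD n →ₗ[K] K :=
  (∑ d ∈ Finset.univ.filter (fun d : Fin (2 * (n + 1)) → Bool => (Diagram.mk p d).IsEven),
      coefDLin ⟨p, d⟩) - qInt 2 • oddTermLin p

theorem typeALin_apply {n : ℕ} (p : Conn n) (x : TLD n) :
    typeALin p x = typeACombination x p := by
  unfold typeALin typeACombination
  rw [LinearMap.sub_apply, LinearMap.sum_apply, LinearMap.smul_apply, oddTermLin_apply, smul_eq_mul]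
  rfl

section
variable {n : ℕ}

open Classical in
theorem coefD_stdD (τ σ : StateD n) :
    coefD (stdD τ.val) (toDiagram σ.val) = if τ = σ then 1 else 0 := by
  rw [coefD_toDiagram]
  have : stdD τ.val = (modelD n).basis τ := ((modelD n).basis_apply τ).symm
  rw [this, Module.Basis.repr_self, Finsupp.single_apply]

open Classical in
theorem coefD_stdD_odd (τ : StateD n) {p : Conn n} (hp : IsTLDiagram p) (h : p ≠ idConn n) :
    coefD (stdD τ.val) (oddDiagram p) = if τ.val.dots = none ∧ τ.val.conn = p then 1 else 0 := by
  refine (coefD_stdD τ ⟨⟨p, none⟩, good_none hp h⟩).trans (if_congr ?_ rfl rfl)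
  rw [Subtype.ext_iff, Config.ext_iff, and_comm]

open Classical in
theorem oddTerm_stdD (τ : StateD n) (hA : τ.val.dots ≠ none ∨ 1 ≤ n) {p : Conn n} (hp : IsTLDiagram p) :
    oddTerm (stdD τ.val) p = if τ.val.dots = none ∧ τ.val.conn = p then 1 else 0 := by
  unfold oddTerm
  split_ifs with h1 h2 h2
  · exact absurd (h2.2.trans h1) ((τ.2.conn_ne h2.1).resolve_left
      (by have := hA.resolve_left (not_not_intro h2.1); omega))
  · rfl
  · rw [coefD_stdD_odd τ hp h1, if_pos h2]
  · rw [coefD_stdD_odd τ hp h1, if_neg h2]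

theorem oddTerm_of_zero (x : TLD 0) {p : Conn 0} (hp : IsTLDiagram p) : oddTerm x p = 0 :=
  if_pos (isTL_zero hp)

open Classical in
theorem sum_coefD_stdD (τ : StateD n) (p : Conn n) :
    ∑ d ∈ Finset.univ.filter (fun d : Fin (2 * (n + 1)) → Bool => (Diagram.mk p d).IsEven),
      coefD (stdD τ.val) ⟨p, d⟩ = if τ.val.dots ≠ none ∧ τ.val.conn = p then 1 else 0 := by
  have h1 : ∀ d ∈ Finset.univ.filter
      (fun d : Fin (2 * (n + 1)) → Bool => (Diagram.mk p d).IsEven),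
      coefD (stdD τ.val) ⟨p, d⟩ = if τ.val = ⟨p, some d⟩ then 1 else 0 := by
    intro d hd
    refine (coefD_stdD τ ⟨_, good_of_isEven (Finset.mem_filter.1 hd).2⟩).trans
      (if_congr Subtype.ext_iff rfl rfl)
  rw [Finset.sum_congr rfl h1]
  obtain ⟨⟨p', _ | d'⟩, hτ⟩ := τ
  · simp
  · simp only [Config.mk.injEq, Option.some.injEq, ne_eq, reduceCtorEq, not_false_eq_true, true_and]
    by_cases hp : p' = p
    · subst hp
      simp only [true_and, if_true]
      rw [Finset.sum_ite_eq, if_pos]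
      exact Finset.mem_filter.2 ⟨Finset.mem_univ _, isEven_of_good hτ⟩
    · simp [hp]

theorem Config.Good.dots_or_conn {τ : Config (Pt n)} (hτ : τ.Good) (hA : τ.dots ≠ none ∨ 1 ≤ n) :
    τ.dots ≠ none ∨ τ.conn ≠ idConn n := by
  rcases hA with h | h
  · exact Or.inl h
  · by_cases hd : τ.dots = none
    · exact Or.inr ((hτ.conn_ne hd).resolve_left (by omega))
    · exact Or.inl hd

open Classical in
theorem coefA_eltA {p p' : Conn n} (hp' : IsTLDiagram p') (hp : IsTLDiagram p) :
    coefA (eltA n p') p = if p' = p then 1 else 0 := by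
  have : eltA n p' = (modelA n).basis ⟨p', hp'⟩ := ((modelA n).basis_apply ⟨p', hp'⟩).symm
  rw [coefA_eq _ hp, this, Module.Basis.repr_self, Finsupp.single_apply]
  exact if_congr Subtype.ext_iff rfl rfl

open Classical in
theorem coefA_forget_stdD (τ : StateD n) (hA : τ.val.dots ≠ none ∨ 1 ≤ n) {p : Conn n}
    (hp : IsTLDiagram p) : coefA (forget n (stdD τ.val)) p =
      (if τ.val.dots = none then loopVal else 1) * if τ.val.conn = p then 1 else 0 := by
  have hb := coefA_eltA τ.2.valid.isTL hp
  by_cases hd : τ.val.dots = none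
  · have hn := hA.resolve_left (not_not_intro hd)
    have hf := forget_eltD hn le_rfl τ.2.valid (τ.2.dots_or_conn hA)
    rw [if_pos hd, ← hb, stdD_of_none hn hd, map_smul, hf]
    exact map_smul (coeffLin _) _ _
  · rw [if_neg hd, one_mul, ← hb, stdD, if_neg hd, forget_evCanon le_rfl τ.2.valid hd]

theorem stdD_zero {τ : Config (Pt 0)} (hd : τ.dots = none) : stdD τ = eD 0 0 := by
  rw [stdD, if_pos hd, if_pos rfl]

theorem linearMap_ext_stdD {M : Type} [AddCommMonoid M] [Module K M] {f g : TLD n →ₗ[K] M}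
    (h : ∀ τ : StateD n, f (stdD τ.val) = g (stdD τ.val)) : f = g :=
  (modelD n).basis.ext fun τ => by rw [(modelD n).basis_apply]; exact h τ

/-- Checked on basis diagrams: an even one contributes `1` and an odd one `-[2]`, the value of the
loop that appears when dots are forgotten. -/
theorem typeACombination_eq (x : TLD n) {p : Conn n} (hp : IsTLDiagram p) :
    typeACombination x p = coefA (forget n x) p := by
  classical
  have : typeALin p = coefALin p ∘ₗ (forget n).toLinearMap := by
    refine linearMap_ext_stdD fun τ => ?_
    rw [typeALin_apply]
    change _ = coefA (forget n (stdD τ.val)) p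
    rw [typeACombination, sum_coefD_stdD]
    by_cases hA : τ.val.dots ≠ none ∨ 1 ≤ n
    · rw [coefA_forget_stdD τ hA hp, oddTerm_stdD τ hA hp]
      by_cases hd : τ.val.dots = none
      · by_cases hc : τ.val.conn = p <;> simp [hd, hc, loopVal]
      · by_cases hc : τ.val.conn = p <;> simp [hd, hc]
    -- The exceptional basis element `E_0` on a single strand has no diagram, and it is sent to `0`
    -- in type `A`.
    · obtain ⟨hd, hn⟩ : τ.val.dots = none ∧ n = 0 := by
        push Not at hA; exact ⟨hA.1, by omega⟩
      subst hn
      rw [oddTerm_of_zero _ hp, mul_zero, sub_zero, if_neg (fun h => h.1 hd), stdD_zero hd,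
        forget_eD le_rfl, eA, dif_neg (by omega)]
      exact (map_zero (coeffLin _)).symm
  rw [← typeALin_apply, this]
  rfl

/-! ### The last factor of the recursion -/

theorem Config.Good.run {w : List ℕ} (hw : ∀ s ∈ w, s ≤ n) {σ : Config (Pt n)} (h : σ.Good) :
    (Config.run w σ).Good := by
  induction w generalizing σ with
  | nil => exact h
  | cons s w ih => exact ih (fun t ht => hw t (by simp [ht])) (h.act (hw s (by simp)))

/-- The result is reached by a word, so it inherits goodness from the generators. The single strand
with a dotted loop has to be excluded: adding a vertical strand to it would give the identity
connectivity with a dotted loop. -/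
theorem Config.Good.ins {τ : Config (Pt n)} (h : τ.Good) (hA : τ.dots ≠ none ∨ 1 ≤ n) {k : ℕ}
    (hk : k ≤ n + 2) : (Config.ins k τ).Good := by
  have htop : (Config.ins (n + 2) τ).Good := by
    rcases Nat.eq_zero_or_pos n with rfl | hn
    · rw [eq_undot_of_zero h.valid h.dotsMod (hA.resolve_right (by omega)), ins_top_one]
      exact good_one
    · obtain ⟨w, h1, h2⟩ := h.exists_run
      rw [← h2, ← run_ins_top h1 (Or.inl hn), ins_top_one]
      exact good_one.run fun s hs => (h1 s hs).trans (by omega)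
  rw [← run_ladder hk h.valid.wf]
  exact htop.run fun s hs => mem_ladder_le (by omega) hs

/-- In the presence of a dotted loop, a second dotted loop counts as an ordinary one. -/
theorem DRel.dloop_mul_dloop {R : Type} [Ring R] [Algebra K R] {e : ℕ → R} {N : ℕ} (h : DRel e N)
    {s t : ℕ} (hs : s ≤ N) (ht : t ≤ N) (hN : 1 ≤ N) :
    dloop e s * dloop e t = loopVal • (dloop e s * e t) := by
  have h0 : ∀ t, t ≤ N → e 0 * e 1 * dloop e t = loopVal • (e 0 * e 1 * e t) := by
    intro t ht
    rw [mul_assoc, h.mul_dloop hN ht hN, ← mul_assoc, h.mul_dloop (Nat.zero_le N) hN hN]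
    change e 0 * e 1 * e 1 * e t = _
    rw [mul_assoc (e 0), h.sq 1 hN, mul_smul_comm, smul_mul_assoc]
  induction s generalizing t with
  | zero => exact h0 t ht
  | succ s ih =>
    rcases Nat.eq_zero_or_pos s with rfl | hs1
    · exact h0 t ht
    · have e2 : e (s + 1) * dloop e s * e (s + 1) * dloop e t =
          e (s + 1) * (dloop e s * dloop e (s + 1)) * e t := by
        rw [mul_assoc _ (e (s + 1)), h.mul_dloop hs ht hN]; simp only [mul_assoc]
      rw [dloop_succ hs1, e2, ih (by omega) hs, mul_smul_comm, smul_mul_assoc]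
      simp only [mul_assoc]

theorem inclD_dloop {m s : ℕ} (h : n ≤ m) (hn : 1 ≤ n) (hs : s ≤ n) :
    inclD h (dloop (eD n) s) = dloop (eD m) s := by
  have h0 : inclD h (eD n 0 * eD n 1) = eD m 0 * eD m 1 := by
    rw [map_mul, inclD_eD h (by omega), inclD_eD h hn]
  induction s with
  | zero => exact h0
  | succ s ih =>
    rcases Nat.eq_zero_or_pos s with rfl | hs1
    · exact h0
    · rw [dloop_succ hs1, map_mul, map_mul, ih (by omega), inclD_eD h hs, dloop_succ hs1]

theorem inclD_addLoop_eltA {m : ℕ} (h : n ≤ m) (hn : 1 ≤ n) {p : Conn n} (hp : IsTLDiagram p)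
    (hne : p ≠ idConn n) : inclD h (addLoop n (eltA n p)) = addLoop m (eltA m p) := by
  have h0 : canon n (undot p) ≠ [] := fun hc => hne (conn_of_canon_eq_nil (valid_undot hp) hc)
  have h1 := act_mem_canon (undot p)
  unfold eltA evCanon
  obtain ⟨s, w, hw⟩ := List.exists_cons_of_ne_nil h0
  rw [hw] at h1 ⊢
  have hs : s ≤ n := h1 s (by simp)
  have hw : ∀ t ∈ w, t ≤ n := fun t ht => h1 t (by simp [ht])
  rw [addLoop_ev hn s w hs hw, addLoop_ev (by omega) s w (hs.trans h)
    (fun t ht => (hw t ht).trans h), map_mul, inclD_dloop h hn hs, inclD_ev h hw]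

theorem inclD_stdD {m : ℕ} (h : n ≤ m) {τ : Config (Pt n)} (hτ : τ.Good)
    (hA : τ.dots ≠ none ∨ 1 ≤ n) : inclD h (stdD τ) =
      open Classical in (if τ.dots = none then loopVal else (1 : K)) • eltD m τ := by
  split_ifs with hd
  · have hn := hA.resolve_left (not_not_intro hd)
    rw [stdD_of_none hn hd, map_smul, eltD, if_pos hd, eltD, if_pos hd, map_smul,
      inclD_addLoop_eltA h hn hτ.valid.isTL ((hτ.conn_ne hd).resolve_left (by omega))]
  · rw [stdD, if_neg hd, eltD, if_neg hd, one_smul, evCanon, inclD_ev h (act_mem_canon τ)]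
    rfl

theorem inclD_stdD_mul_lad {τ : Config (Pt n)} (hτ : τ.Good) (hA : τ.dots ≠ none ∨ 1 ≤ n) {k : ℕ}
    (hk : k ≤ n + 2) :
    inclD (Nat.le_succ n) (stdD τ) * lad (eD (n + 1)) (n + 1) k = stdD (ins k τ) := by
  rw [inclD_stdD _ hτ hA, smul_mul_assoc]
  change _ • (eltD (n + 1) τ * _) = _
  rw [← eltD_ins le_rfl hk hτ.valid (hτ.dots_or_conn hA)]
  split_ifs with hd
  · rw [stdD_of_none (by omega) (ins_dots_eq_none.2 hd)]
  · rw [stdD_of_ne (fun h => hd (ins_dots_eq_none.1 h)), one_smul]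

theorem addLoop_eltA_mul_addLoop {N : ℕ} (h1 : 1 ≤ N) (hN : n ≤ N) {p : Conn n}
    (hp : IsTLDiagram p) (hp1 : p ≠ idConn n) {v : List ℕ} (hv0 : v ≠ []) (hv : ∀ s ∈ v, s ≤ N) :
    addLoop N (eltA N p) * addLoop N (ev (eA N) v) =
      loopVal • addLoop N (eltA N p * ev (eA N) v) := by
  have h0 : canon n (undot p) ≠ [] := fun hc => hp1 (conn_of_canon_eq_nil (valid_undot hp) hc)
  have h2 := act_mem_canon (undot p)
  unfold eltA evCanon
  obtain ⟨s, w, hw⟩ := List.exists_cons_of_ne_nil h0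
  rw [hw] at h2 ⊢
  have hs : s ≤ N := (h2 s (by simp)).trans hN
  have hw : ∀ t ∈ w, t ≤ N := fun t ht => (h2 t (by simp [ht])).trans hN
  rw [← ev_append, List.cons_append, addLoop_ev h1 s w hs hw, mul_assoc, ev_mul_addLoop h1 hv0 hv hw]
  obtain ⟨t, u, hu⟩ := List.exists_cons_of_ne_nil (l := w ++ v) (by simp [hv0])
  have hmem : ∀ x ∈ t :: u, x ≤ N := by
    rw [← hu]; intro x hx
    rcases List.mem_append.1 hx with h | h
    · exact hw x h
    · exact hv x h
  rw [hu, addLoop_ev h1 t u (hmem t (by simp)) (fun x hx => hmem x (by simp [hx])),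
    addLoop_ev h1 s (t :: u) hs hmem, ← mul_assoc,
    (dRel_eD N).dloop_mul_dloop hs (hmem t (by simp)) h1, smul_mul_assoc, ev_cons, mul_assoc]

/-- If `τ` is even, the dotted loop of the ladder is the only one; if `τ` is odd, there are two, and
one of them is replaced by the value of a loop. -/
theorem inclD_stdD_mul_addLoop {τ : Config (Pt n)} (hτ : τ.Good) (hA : τ.dots ≠ none ∨ 1 ≤ n)
    {k : ℕ} (hk : k ≤ n + 1) :
    inclD (Nat.le_succ n) (stdD τ) * addLoop (n + 1) (lad (eA (n + 1)) (n + 1) k) =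
      open Classical in (if τ.dots = none then loopVal else (1 : K)) •
        stdD (⟨(ins k τ).conn, none⟩ : Config (Pt (n + 1))) := by
  have hv : ∀ s ∈ ladder (n + 1) k, s ≤ n + 1 := fun s hs => mem_ladder_le (by omega) hs
  have hE : stdD (⟨(ins k τ).conn, none⟩ : Config (Pt (n + 1))) =
      addLoop (n + 1) (eltA (n + 1) τ.conn * lad (eA (n + 1)) (n + 1) k) := by
    rw [stdD_of_none (by omega) rfl, eltD, if_pos rfl, smul_smul, mul_inv_cancel₀ loopVal_ne_zero,
      one_smul, eltA_ins le_rfl (by omega) hτ.valid]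
  rw [inclD_stdD _ hτ hA, smul_mul_assoc, hE]
  split_ifs with hd
  · have hc := (hτ.dots_or_conn hA).resolve_left (not_not_intro hd)
    rw [eltD, if_pos hd, smul_mul_assoc]
    congr 1
    unfold lad
    rw [addLoop_eltA_mul_addLoop (by omega) (by omega) hτ.valid.isTL hc (ladder_ne_nil hk) hv,
      smul_smul, inv_mul_cancel₀ loopVal_ne_zero, one_smul]
  · rw [eltD, if_neg hd]
    unfold lad
    rw [evCanon_mul_addLoop (by omega) (by omega) hτ.valid hd (ladder_ne_nil hk) hv]

theorem ins_conn_eq_iff {τ : Config (Pt n)} {p : Conn (n + 1)} (hp : IsTLDiagram p)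
    (i : Fin (n + 2)) :
    (ins (i.val + 1) τ).conn = p ↔ p (footL i) = footR i ∧ τ.conn = remove p i := by
  rw [ins_conn, pos_succ]
  constructor
  · rintro rfl
    refine ⟨insert_conn_a _ _ _ _ _, ?_⟩
    funext x
    have := insert_conn (isGap i) τ x
    unfold remove insertAt
    rw [this, (isGap i).left]
  · rintro ⟨h1, h2⟩
    have h3 := insertAt_removeAt (i := i) (σ := ⟨p, none⟩) (valid_none hp).wf h1 (by simp)
    have h4 := congrArg Config.conn h3
    simp only at h4
    rw [← h4]
    simp only [insertAt, Config.insert, h2]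
    rfl

theorem remove_isTL {p : Conn (n + 1)} (hp : IsTLDiagram p) {i : Fin (n + 2)}
    (hi : p (footL i) = footR i) : IsTLDiagram (remove p i) := by
  have h3 := insertAt_removeAt (i := i) (σ := ⟨p, none⟩) (valid_none hp).wf hi (by simp)
  have : (removeAt i ⟨p, none⟩).Valid := Valid.of_insertAt (i := i) (by rw [h3]; exact valid_none hp)
  exact this.isTL

/-- Serves the basis element `E_0` of the algebra with one strand, which has no diagram: it must not
contribute to the recurrence. -/
theorem eD_zero_mul_jwFactor : eD 1 0 * jwFactor 1 = 0 := by
  have hD := dRel_eD 1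
  have h1 : lad (eD 1) 1 1 = eD 1 1 := by rw [lad_one le_rfl, lad_gt (by omega), one_mul]
  have h2 : lad (eD 1) 1 0 = eD 1 0 := by rw [lad_zero, lad_gt (by omega), one_mul]
  have h3 : addLoop 1 (lad (eA 1) 1 1) = eD 1 0 * eD 1 1 := by
    rw [addLoop_lad_one le_rfl le_rfl, lad_gt (by omega), one_mul]
  have h4 := coefH_three_term_one (le_refl 1)
  have h5 := coefG_three_term_one 1
  have h6 := coefH_top 1
  rw [h6, add_zero] at h4
  simp only [jwFactor, Finset.sum_range_succ, Finset.sum_range_zero, zero_add, h6, zero_smul,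
    add_zero, h1, h2, h3, lad_gt (Nat.lt_succ_self 1), mul_add, mul_smul_comm, mul_one]
  rw [← mul_assoc (eD 1 0) (eD 1 0), hD.sq 0 (by omega), smul_mul_assoc, smul_smul, smul_smul]
  refine smul_add_eq_zero ?_ ?_
  · rw [add_comm, mul_comm]; exact h4
  · rw [add_comm, mul_comm]; exact h5

/-- Both sides are linear in `x` and are compared on basis diagrams `τ`. Inserting a cap at position
`i` into `τ` gives the connectivity `p` exactly if `i` is innermost in `p` and `τ` has the
connectivity with that cap removed. -/
theorem coefD_mul_jwFactor (x : TLD n) {p : Conn (n + 1)} (hp : IsTLDiagram p)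
    (hne : p ≠ idConn (n + 1)) :
    coefD (inclD (Nat.le_succ n) x * jwFactor (n + 1)) (oddDiagram p) =
      (∑ i ∈ innermost p, coefH (n + 1) (i.val + 1) * coefA (forget n x) (remove p i)) +
      (∑ i ∈ innermost p, 2 ^ (if i.val + 1 = 1 then 1 else 0) * coefG (n + 1) (i.val + 1) *
        oddTerm x (remove p i)) := by
  classical
  have key : coefDLin (oddDiagram p) ∘ₗ LinearMap.mulRight K (jwFactor (n + 1)) ∘ₗ
      (inclD (Nat.le_succ n)).toLinearMap =
      (∑ i ∈ innermost p, coefH (n + 1) (i.val + 1) •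
        (coefALin (remove p i) ∘ₗ (forget n).toLinearMap)) +
      (∑ i ∈ innermost p, (2 ^ (if i.val + 1 = 1 then 1 else 0) * coefG (n + 1) (i.val + 1)) •
        oddTermLin (remove p i)) := by
    refine linearMap_ext_stdD fun τ => ?_
    simp only [LinearMap.add_apply, LinearMap.sum_apply, LinearMap.smul_apply, oddTermLin_apply,
      LinearMap.comp_apply, LinearMap.mulRight_apply, AlgHom.toLinearMap_apply, smul_eq_mul]
    change _ = (∑ i ∈ innermost p, coefH (n + 1) (i.val + 1) *
        coefA (forget n (stdD τ.val)) (remove p i)) + _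
    by_cases hA : τ.val.dots ≠ none ∨ 1 ≤ n
    · have L1 : ∀ k, k ≤ n + 2 → coefDLin (oddDiagram p) (inclD (Nat.le_succ n) (stdD τ.val) *
          lad (eD (n + 1)) (n + 1) k) =
          if τ.val.dots = none ∧ (ins k τ.val).conn = p then 1 else 0 := by
        intro k hk
        rw [inclD_stdD_mul_lad τ.2 hA hk]
        refine (coefD_stdD_odd ⟨_, τ.2.ins hA hk⟩ hp hne).trans (if_congr ?_ rfl rfl)
        rw [ins_dots_eq_none]
      have L2 : ∀ k, k ≤ n + 1 → coefDLin (oddDiagram p) (inclD (Nat.le_succ n) (stdD τ.val) *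
          addLoop (n + 1) (lad (eA (n + 1)) (n + 1) k)) =
          (if τ.val.dots = none then loopVal else 1) *
            if (ins k τ.val).conn = p then 1 else 0 := by
        intro k hk
        have hc : (ins k τ.val).conn ≠ idConn (n + 1) := by
          rw [← act_ins_self]; exact act_conn_ne_idConn (by omega) hk _
        rw [inclD_stdD_mul_addLoop τ.2 hA hk, map_smul, smul_eq_mul]
        congr 1
        refine (coefD_stdD_odd ⟨_, good_none (τ.2.ins hA (by omega)).valid.isTL hc⟩ hp hne).trans
          (if_congr ?_ rfl rfl)
        simp
      -- The sum over innermost caps is extended to all positions, where the added terms vanish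
      -- because no insertion there yields `p`.
      have R1 : ∑ i ∈ innermost p, coefH (n + 1) (i.val + 1) *
          coefA (forget n (stdD τ.val)) (remove p i) = ∑ i : Fin (n + 2), coefH (n + 1) (i.val + 1) *
          ((if τ.val.dots = none then loopVal else 1) *
            if (ins (i.val + 1) τ.val).conn = p then 1 else 0) := by
        rw [innermost, Finset.sum_filter]
        refine Finset.sum_congr rfl fun i _ => ?_
        by_cases h1 : p (footL i) = footR i
        · rw [if_pos h1, coefA_forget_stdD τ hA (remove_isTL hp h1)]
          simp only [(ins_conn_eq_iff hp i).trans (and_iff_right h1)]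
        · rw [if_neg h1, if_neg (fun h => h1 ((ins_conn_eq_iff hp i).1 h).1), mul_zero, mul_zero]
      have R2 : ∑ i ∈ innermost p, 2 ^ (if i.val + 1 = 1 then 1 else 0) *
          coefG (n + 1) (i.val + 1) * oddTerm (stdD τ.val) (remove p i) =
          ∑ i : Fin (n + 2), 2 ^ (if i.val + 1 = 1 then 1 else 0) * coefG (n + 1) (i.val + 1) *
            if τ.val.dots = none ∧ (ins (i.val + 1) τ.val).conn = p then 1 else 0 := by
        rw [innermost, Finset.sum_filter]
        refine Finset.sum_congr rfl fun i _ => ?_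
        by_cases h1 : p (footL i) = footR i
        · rw [if_pos h1, oddTerm_stdD τ hA (remove_isTL hp h1)]
          simp only [(ins_conn_eq_iff hp i).trans (and_iff_right h1)]
        · have hc : ¬ (τ.val.dots = none ∧ (ins (i.val + 1) τ.val).conn = p) :=
            fun h => h1 ((ins_conn_eq_iff hp i).1 h.2).1
          rw [if_neg h1, if_neg hc, mul_zero]
      rw [R1, R2, jwFactor, mul_add, mul_add, Finset.mul_sum, Finset.mul_sum, map_add, map_add,
        map_sum, map_sum, Finset.sum_range, Finset.sum_range, mul_smul_comm, map_smul, smul_eq_mul,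
        L1 0 (by omega), ins_zero_conn, add_comm]
      congr 1
      · refine Finset.sum_congr rfl fun i _ => ?_
        rw [mul_smul_comm, map_smul, smul_eq_mul]
        -- The empty ladder is not covered by `L2`, but its coefficient `coefH` is zero.
        rcases Nat.eq_or_lt_of_le (Nat.le_of_lt_succ i.2) with h | h
        · rw [h, coefH_top, zero_mul, zero_mul]
        · rw [L2 _ h]
      -- The ladders ending in `E_0` and `E_1` have equal coefficients and give the same
      -- connectivity; combined, they produce the factor 2 at the first position.
      · rw [Fin.sum_univ_succ, Fin.sum_univ_succ (n := n + 1)]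
        have h1 : ∀ i : Fin (n + 1), i.succ.val + 1 ≠ 1 := fun i => by simp
        simp only [mul_smul_comm, map_smul, smul_eq_mul, L1 _ (Nat.succ_le_of_lt (Fin.is_lt _)),
          L1 1 (by omega), h1,
          if_false, pow_zero, one_mul, Fin.val_zero, zero_add, if_true, pow_one]
        ring
    · obtain ⟨hd, hn⟩ : τ.val.dots = none ∧ n = 0 := by
        push Not at hA; exact ⟨hA.1, by omega⟩
      subst hn
      have hz : inclD (Nat.le_succ 0) (eD 0 0) * jwFactor (0 + 1) = 0 := by
        rw [inclD_eD _ le_rfl]; exact eD_zero_mul_jwFactor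
      have hf : forget 0 (eD 0 0) = 0 := by rw [forget_eD le_rfl, eA, dif_neg (by omega)]
      rw [stdD_zero hd, hz, map_zero, hf, Finset.sum_eq_zero, Finset.sum_eq_zero, add_zero]
      · intro i hi
        rw [oddTerm_of_zero _ (remove_isTL hp (Finset.mem_filter.1 hi).2), mul_zero]
      · intro i _
        rw [show coefA (0 : TLA 0) (remove p i) = 0 from map_zero (coeffLin _), mul_zero]
  have := LinearMap.congr_fun key x
  simp only [LinearMap.add_apply, LinearMap.sum_apply, LinearMap.smul_apply, oddTermLin_apply,
    LinearMap.comp_apply, LinearMap.mulRight_apply, AlgHom.toLinearMap_apply, smul_eq_mul] at this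
  exact this

end
end
end TemperleyLieb

open TemperleyLieb
theorem mainTheorem5 :
    -- coefficients of diagrams and the Jones--Wenzl projections are well defined
    (∀ n, MonomialsFormBasis (dynkinD n) ∧
      ∀ D : Diagram n, D.IsEven ∨ D.IsOdd → ∃! x, RepresentsD D x) ∧
    (∀ n, MonomialsFormBasis (dynkinA n) ∧
      ∀ p : Conn n, IsTLDiagram p → ∃! x, RepresentsA p x) ∧
    (∃! Q : ∀ n, TLD n, IsJonesWenzlD Q) ∧
    (∃! P : ∀ n, TLA n, IsJonesWenzlA P) ∧
    -- the recurrence, for a diagram `D` with a unique dot and `n + 2` strands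
    ∀ (Q : ∀ n, TLD n) (P : ∀ n, TLA n), IsJonesWenzlD Q → IsJonesWenzlA P →
      ∀ (n : ℕ) (D : Diagram (n + 1)), D.IsOdd →
        (coefD (Q (n + 1)) D =
          (∑ i ∈ innermost D.partner,
            coefH (n + 1) (i.val + 1) * typeACombination (Q n) (remove D.partner i)) +
          (∑ i ∈ innermost D.partner,
            2 ^ (if i.val + 1 = 1 then 1 else 0) * coefG (n + 1) (i.val + 1) *
              oddTerm (Q n) (remove D.partner i))) ∧
        ∀ i ∈ innermost D.partner,
          typeACombination (Q n) (remove D.partner i) = coefA (P n) (remove D.partner i) := by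
  refine ⟨fun n => ⟨(modelD n).monomialsFormBasis, fun D hD => ?_⟩,
    fun n => ⟨(modelA n).monomialsFormBasis, fun p hp => existsUnique_representsA hp⟩,
    ⟨jwD, isJonesWenzlD_jwD, fun Q hQ => hQ.unique isJonesWenzlD_jwD⟩,
    ⟨_, isJonesWenzlA_forget, fun P hP => hP.unique isJonesWenzlA_forget⟩,
    fun Q P hQ hP n D hD => ?_⟩
  · obtain ⟨σ, rfl⟩ := exists_toDiagram hD
    exact existsUnique_representsD σ
  · obtain rfl : Q = jwD := hQ.unique isJonesWenzlD_jwD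
    -- By uniqueness `P` is the image of `Q` under `forget`, so the type `A` combination becomes a
    -- coefficient of `P`.
    obtain rfl := hP.unique isJonesWenzlA_forget
    have hp := hD.1.1
    have hA : ∀ i ∈ innermost D.partner, typeACombination (jwD n) (remove D.partner i) =
        coefA (forget n (jwD n)) (remove D.partner i) := fun i hi =>
      typeACombination_eq _ (remove_isTL hp (Finset.mem_filter.1 hi).2)
    refine ⟨?_, hA⟩
    rw [Finset.sum_congr rfl fun i hi => by rw [hA i hi]]
    conv_lhs => rw [Config.eq_oddDiagram_of_isOdd hD]
    exact coefD_mul_jwFactor (jwD n) hp hD.2.2.2
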